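/- Let $\nu,\mu,L_1,L_2>0$ and $\Omega=[0,L_1]\times[0,L_2]$ (for instance $L_1=L/\gamma$, $L_2=L$). Consider on $\Omega$, with space-periodic boundary conditions, the damped two-dimensional Navier--Stokes system $$\partial_t u+\sum_{i=1}^2u^i\partial_iu=\nu\Delta u-\mu u-\nabla p+f,\qquad \operatorname{div}u=0,\qquad u(0)=u_0 ,$$ where $u_0$, $u(t)$ and $f(t)$ are $\Omega$-periodic with mean value zero. Here $u_0\in H$, the space of solenoidal $\Omega$-periodic vector fields in $L_2(\Omega)^2$ with mean value zero, and $f\in L_2(0,T;L_2(\Omega)^2)$ for all $T>0$ (in particular every $f\in L_\infty(0,\infty;H)$ is allowed). A solution is a weak solution on $[0,\infty)$: $u(t)\in H$ for every $t\ge0$, $u\in L_\infty(0,T;H)\cap L_2(0,T;H^1(\Omega)^2)$ for every $T>0$, and for every smooth $\Omega$-periodic solenoidal field $v$ and every $t\ge0$ $$\int_\Omega u(t)\cdot v\,dx=\int_\Omega u_0\cdot v\,dx+\int_0^t\int_\Omega\Big(\sum_{i,j=1}^2u^iu^j\partial_iv^j+\nu\,u\cdot\Delta v-\mu\,u\cdot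 v+f\cdot v\Big)dx\,ds .$$ For a vector field $g$ let $\operatorname{rot}g=\partial_1g^2-\partial_2g^1$ in the weak sense on the torus, and let $\|\operatorname{rot}g\|_\infty$ be its $L_\infty(\Omega)$-norm (equal to $\infty$ if $\operatorname{rot}g$ is not a function in $L_\infty(\Omega)$). Suppose that $$\limsup_{t\to\infty}\|\operatorname{rot}f(t)\|_\infty=:\mathbf F_\infty<\infty ,$$ where, since $f(t)$ is defined only for almost every $t$, the upper limit is the essential one (null sets of times are disregarded). Then every solution $u$ satisfies $$\limsup_{t\to\infty}\|\operatorname{rot}u(t)\|_\infty\le\frac{\mathbf F_\infty}{\mu},$$ the upper limit being over all $t\to\infty$. -/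

import Mathlib

open MeasureTheory Filter Set
open scoped ENNReal NNReal ContDiff

noncomputable section

namespace PeriodicNS

/-- The plane. All `L²` conditions below are imposed componentwise, so the choice of norm on the
plane plays no role. -/
abbrev Plane : Type := Fin 2 → ℝ

/-- The period cell `Ω = [0, L₁] × [0, L₂]`. -/
def cell (L : Plane) : Set Plane := Icc 0 L

/-- The measure on the space-time cylinder `(0, T) × Ω`. -/
def cylinder (L : Plane) (T : ℝ) : Measure (ℝ × Plane) :=
  (volume.restrict (Ioc 0 T)).prod (volume.restrict (cell L))

/-- `g` has period `L i` in the `i`-th coordinate, for both `i`. -/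
def IsPeriodic {α : Type} (L : Plane) (g : Plane → α) : Prop :=
  ∀ i x, g (x + Pi.single i (L i)) = g x

/-- The classical partial derivative `∂ᵢ g`. -/
def pd (i : Fin 2) (g : Plane → ℝ) (x : Plane) : ℝ := fderiv ℝ g x (Pi.single i 1)

/-- Scalar test functions: smooth and `Ω`-periodic. -/
structure IsTest (L : Plane) (η : Plane → ℝ) : Prop where
  smooth : ContDiff ℝ ∞ η
  periodic : IsPeriodic L η

/-- Solenoidal test fields: smooth, `Ω`-periodic and divergence free. -/
structure IsSolenoidalTest (L : Plane) (v : Plane → Plane) : Prop where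
  test : ∀ j, IsTest L (fun x => v x j)
  div_eq_zero : ∀ x, ∑ i, pd i (fun y => v y i) x = 0

/-- `w ∈ L₁(Ω)` is the weak derivative `∂ᵢ g` on the torus. -/
def IsWeakPartial (L : Plane) (i : Fin 2) (g w : Plane → ℝ) : Prop :=
  IntegrableOn w (cell L) ∧
    ∀ η, IsTest L η → ∫ x in cell L, g x * pd i η x = -∫ x in cell L, w x * η x

/-- `w ∈ L₁(Ω)` is the weak vorticity `rot g = ∂₁ g₂ - ∂₂ g₁` on the torus (the components `1, 2`
of the plane have the indices `0, 1`). -/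
def IsWeakRot (L : Plane) (g : Plane → Plane) (w : Plane → ℝ) : Prop :=
  IntegrableOn w (cell L) ∧
    ∀ η, IsTest L η →
      ∫ x in cell L, (g x 1 * pd 0 η x - g x 0 * pd 1 η x) = -∫ x in cell L, w x * η x

/-- The norm `‖rot g‖_∞` of the weak vorticity in `L_∞(Ω)`, with value `∞` if `rot g` is not an
integrable function. The weak vorticity is unique almost everywhere in `Ω`, so that the infimum is
over at most one number. -/
def rotSup (L : Plane) (g : Plane → Plane) : ℝ≥0∞ :=
  ⨅ (w : Plane → ℝ) (_ : IsWeakRot L g w), eLpNorm w ∞ (volume.restrict (cell L))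

/-- Periodic vector fields in `L₂(Ω)²` with mean value zero. -/
structure MemL2Dot (L : Plane) (g : Plane → Plane) : Prop where
  periodic : IsPeriodic L g
  memLp : ∀ i, MemLp (fun x => g x i) 2 (volume.restrict (cell L))
  mean_eq_zero : ∀ i, ∫ x in cell L, g x i = 0

/-- The space `H` of periodic solenoidal vector fields in `L₂(Ω)²` with mean value zero. -/
structure MemH (L : Plane) (g : Plane → Plane) : Prop extends MemL2Dot L g where
  div_eq_zero : ∀ η, IsTest L η → ∫ x in cell L, ∑ i, g x i * pd i η x = 0

/-- Forces `f ∈ L₂(0, T; L₂(Ω)²)` for all `T`, periodic in space with mean value zero. This contains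
`L_∞(0, ∞; H)`. -/
structure IsForce (L : Plane) (f : ℝ → Plane → Plane) : Prop where
  memLp : ∀ T i, MemLp (fun p : ℝ × Plane => f p.1 p.2 i) 2 (cylinder L T)
  memL2Dot : ∀ᵐ t ∂(volume.restrict (Ioi (0 : ℝ))), MemL2Dot L (f t)

/-- `u` is a (Leray) weak solution, on `[0, ∞)` and with initial value `u₀ ∈ H`, of the
space-periodic damped Navier-Stokes system
`∂ₜu + (u·∇)u = νΔu - μu - ∇p + f`, `div u = 0`:
for every `T`, `u ∈ L_∞(0, T; H) ∩ L₂(0, T; H¹)`, and the equation holds when tested with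
solenoidal fields (which removes the pressure). -/
structure IsWeakSolution (L : Plane) (ν μ : ℝ) (f : ℝ → Plane → Plane) (u₀ : Plane → Plane)
    (u : ℝ → Plane → Plane) : Prop where
  init_memH : MemH L u₀
  memH : ∀ t, 0 ≤ t → MemH L (u t)
  memLp : ∀ T i, MemLp (fun p : ℝ × Plane => u p.1 p.2 i) 2 (cylinder L T)
  bounded : ∀ T, ∃ C : ℝ, ∀ t ∈ Icc 0 T, ∀ i, ∫ x in cell L, (u t x i) ^ 2 ≤ C
  gradient : ∃ D : Fin 2 → Fin 2 → ℝ → Plane → ℝ,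
    (∀ i j T, MemLp (fun p : ℝ × Plane => D i j p.1 p.2) 2 (cylinder L T)) ∧
    ∀ᵐ t ∂(volume.restrict (Ioi (0 : ℝ))),
      ∀ i j, IsWeakPartial L i (fun x => u t x j) (D i j t)
  equation : ∀ v, IsSolenoidalTest L v → ∀ t, 0 ≤ t →
    ∫ x in cell L, ∑ j, u t x j * v x j =
      (∫ x in cell L, ∑ j, u₀ x j * v x j) +
      ∫ s in (0 : ℝ)..t, ∫ x in cell L,
        ((∑ i, ∑ j, u s x i * u s x j * pd i (fun y => v y j) x)
          + ν * (∑ j, u s x j * ∑ i, pd i (pd i (fun y => v y j)) x)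
          - μ * (∑ j, u s x j * v x j)
          + ∑ j, f s x j * v x j)

end PeriodicNS

end

/-!
The vorticity `ω = rot u` of a damped flow solves `∂ₜω + u·∇ω = νΔω - μω + rot f`. At a maximum of
`ω` transport and diffusion do not increase `ω`, so that `ω` stays below the solution of
`k' = -μk + sup (rot f)`, which tends to `sup (rot f) / μ`; the same applies to `-ω`. The proof has
to justify this for weak solutions, whose force has a bounded rotation for late times only and for
which no regularity of the vorticity is given.

Everything is done with Fourier coefficients on the period cell, given by Parseval's identity and
the Riesz-Fischer theorem (`hasSum_conj_fc_mul_fc`, `exists_fc_eq`). Testing the weak formulation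
with solenoidal plane waves shows that the coefficients `zₙ(t)` of `ω` solve an infinite system of
ordinary differential equations, the structure `VorticityModes`
(`IsWeakSolution.vorticityModes`). Its quadratic term `conv` is the transport term; the identity
between the transport terms of momentum and of vorticity is an antisymmetry in the two interacting
modes (`fcr_momentum_flux_eq_conv`).

Regularity comes in two steps. The balance of the enstrophy regularized by the weights
`(1 + δ|κₙ|²)⁻¹` closes with constants independent of `δ`, by an antisymmetrization of the cubic
term and the trilinear estimate `trilinear_sq_le`; letting `δ → 0` gives
`VorticityModes.enstrophy_bound`, that is `ω ∈ L_∞(L²) ∩ L²(H¹)`. The smoothing of the heat equation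
then gains half a derivative (`VorticityModes.half_derivative_bound`), which suffices for a time `t₂`
with `∑ |zₙ(t₂)| < ∞` and for velocities with absolutely convergent Fourier series from `t₂` on
(`VorticityModes.exists_regular_time`).

For the maximum principle (`VorticityModes.vorticity_le`), let `w` be a truncation of the Fourier
series of `ω` and `k(t) = M + C e^{-μ(t - t₂)}` with `M` slightly larger than `sup |rot f| / μ` and
`C = ∑ |zₙ(t₂)|`. For a smooth convex substitute `posPart` of the positive part, the integral of
`posPart (w - k)` starts from zero. Diffusion decreases it, the transport term integrates to zero
because `u` is solenoidal, and the rest is controlled by the `defect`, the error which the truncation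
makes in the equation. The margin in `M` absorbs the defect up to its squared `L²` norm, which is a
tail of a convergent series (`tsum_fc_defect_le`) and vanishes in the limit. Hence `ω ≤ k`.
-/

open scoped ComplexConjugate Topology

noncomputable section

namespace PeriodicNS

/-! ### Calculus along absolutely continuous functions -/

/-- The chain rule for a primitive `y` of an integrable function and a `C¹` outer function. -/
theorem chain_of_primitive {φ φ' : ℝ → ℝ} {s : Set ℝ}
    (hφ : ∀ x ∈ s, HasDerivAt φ (φ' x) x) (hφ' : ContinuousOn φ' s)
    {y h : ℝ → ℝ} {a b : ℝ} (hab : a ≤ b)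
    (hh : IntervalIntegrable h volume a b)
    (hy : ∀ t ∈ Icc a b, y t = y a + ∫ x in a..t, h x) {c d : ℝ} (hcd : Icc c d ⊆ s)
    (hys : ∀ t ∈ Icc a b, y t ∈ Icc c d) :
    φ (y b) = φ (y a) + ∫ x in a..b, φ' (y x) * h x := by
  have hyac : AbsolutelyContinuousOnInterval y a b := by
    have h1 := hh.absolutelyContinuousOnInterval_intervalIntegral (c := a) (by simp)
    have h2 : AbsolutelyContinuousOnInterval (fun _ : ℝ => y a) a b :=
      (contDiffOn_const (c := y a)).absolutelyContinuousOnInterval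
    have h3 := h2.add h1
    rw [absolutelyContinuousOnInterval_iff] at h3 ⊢
    intro ε hε
    obtain ⟨δ, hδ, H⟩ := h3 ε hε
    refine ⟨δ, hδ, fun E hE hE' => ?_⟩
    have := H E hE hE'
    convert this using 2 with i hi
    have hE1 := hE.1 i hi
    rw [uIcc_of_le hab] at hE1
    simp only [Pi.add_apply]
    rw [hy _ hE1.1, hy _ hE1.2]
  obtain ⟨K, hK⟩ : ∃ K, LipschitzOnWith K φ (Icc c d) := by
    obtain ⟨B, hB⟩ := (isCompact_Icc (a := c) (b := d)).exists_bound_of_continuousOn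
      (hφ'.mono hcd)
    refine ⟨B.toNNReal, (convex_Icc c d).lipschitzOnWith_of_nnnorm_hasDerivWithin_le
      (f' := φ') (fun x hx => (hφ x (hcd hx)).hasDerivWithinAt) fun x hx => ?_⟩
    rw [← NNReal.coe_le_coe, coe_nnnorm]
    exact (hB x hx).trans (Real.le_coe_toNNReal B)
  have hac : AbsolutelyContinuousOnInterval (fun t => φ (y t)) a b := by
    rw [absolutelyContinuousOnInterval_iff] at hyac ⊢
    intro ε hε
    obtain ⟨δ, hδ, H⟩ := hyac (ε / (K + 1)) (by positivity)
    refine ⟨δ, hδ, fun E hE hE' => ?_⟩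
    have h1 := H E hE hE'
    have hle : ∑ i ∈ Finset.range E.1, dist (φ (y (E.2 i).1)) (φ (y (E.2 i).2)) ≤
        K * ∑ i ∈ Finset.range E.1, dist (y (E.2 i).1) (y (E.2 i).2) := by
      rw [Finset.mul_sum]
      refine Finset.sum_le_sum fun i hi => ?_
      have hE1 := hE.1 i hi
      rw [uIcc_of_le hab] at hE1
      exact hK.dist_le_mul _ (hys _ hE1.1) _ (hys _ hE1.2)
    have hS : 0 ≤ ∑ i ∈ Finset.range E.1, dist (y (E.2 i).1) (y (E.2 i).2) :=
      Finset.sum_nonneg fun _ _ => dist_nonneg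
    rw [lt_div_iff₀ (by positivity)] at h1
    nlinarith
  have hint := hac.integral_deriv_eq_sub
  rw [← sub_eq_iff_eq_add', ← hint]
  refine intervalIntegral.integral_congr_ae ?_
  have hb : ∀ᵐ x : ℝ, x ≠ b := by simp [ae_iff, measure_singleton]
  filter_upwards [hh.ae_hasDerivAt_integral, hb] with x hx hxb hxm
  rw [uIoc_of_le hab] at hxm
  have hx' : x ∈ Ioo a b := ⟨hxm.1, lt_of_le_of_ne hxm.2 hxb⟩
  have h1 := hx (by rw [uIcc_of_le hab]; exact Ioo_subset_Icc_self hx') a (by simp)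
  have h2 : HasDerivAt y (h x) x := by
    refine (h1.const_add (y a)).congr_of_eventuallyEq ?_
    filter_upwards [Icc_mem_nhds hx'.1 hx'.2] with t ht using hy t ht
  exact ((hφ _ (hcd (hys x (Ioo_subset_Icc_self hx')))).comp x h2).deriv

/-! ### Lattice sums -/

/-- The frequency vector `κₙ = 2π (n₁ / L₁, n₂ / L₂)`. -/
def freq (L : Plane) (n : Fin 2 → ℤ) (i : Fin 2) : ℝ := 2 * Real.pi * n i / L i

/-- The Laplace symbol `|κₙ|²`. -/
def lam (L : Plane) (n : Fin 2 → ℤ) : ℝ := freq L n 0 ^ 2 + freq L n 1 ^ 2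

/-- The length `|κₙ|`. -/
def kap (L : Plane) (n : Fin 2 → ℤ) : ℝ := √(lam L n)

variable {L : Plane}

lemma lam_nonneg (n) : 0 ≤ lam L n := by unfold lam; positivity

lemma kap_nonneg (n) : 0 ≤ kap L n := Real.sqrt_nonneg _

lemma kap_sq (n) : kap L n ^ 2 = lam L n := Real.sq_sqrt (lam_nonneg n)

@[simp] lemma freq_zero (i) : freq L 0 i = 0 := by simp [freq]

@[simp] lemma freq_neg (n i) : freq L (-n) i = -freq L n i := by simp [freq]; ring

lemma freq_add (n m i) : freq L (n + m) i = freq L n i + freq L m i := by simp [freq]; ring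

lemma freq_sub (n m i) : freq L (n - m) i = freq L n i - freq L m i := by simp [freq]; ring

@[simp] lemma lam_zero : lam L 0 = 0 := by simp [lam]

@[simp] lemma lam_neg (n) : lam L (-n) = lam L n := by simp [lam]

@[simp] lemma kap_neg (n) : kap L (-n) = kap L n := by simp [kap]

lemma abs_freq_le_kap (n i) : |freq L n i| ≤ kap L n := by
  refine Real.abs_le_sqrt ?_
  unfold lam
  fin_cases i <;> simp <;> positivity

/-- `|κₙ|` dominates the sup norm of the index `n`. -/
lemma exists_mul_norm_le_kap (hL : ∀ i, 0 < L i) : ∃ c > 0, ∀ n : Fin 2 → ℤ, c * ‖n‖ ≤ kap L n := by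
  refine ⟨2 * Real.pi / (L 0 + L 1), by have := hL 0; have := hL 1; positivity, fun n => ?_⟩
  have h0 := hL 0
  have h1 := hL 1
  have key : ∀ i, 2 * Real.pi / (L 0 + L 1) * |(n i : ℝ)| ≤ kap L n := by
    intro i
    refine le_trans ?_ (abs_freq_le_kap n i)
    have hi := hL i
    have hle : L i ≤ L 0 + L 1 := by fin_cases i <;> simp <;> linarith
    rw [freq, abs_div, abs_mul, abs_of_pos hi, abs_of_pos (by positivity : 0 < 2 * Real.pi),
      mul_div_right_comm _ _ (L i)]
    exact mul_le_mul_of_nonneg_right (div_le_div_of_nonneg_left (by positivity) hi hle)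
      (abs_nonneg _)
  have hc : 0 < 2 * Real.pi / (L 0 + L 1) := by positivity
  rw [← le_div_iff₀' hc, pi_norm_le_iff_of_nonneg (by have := kap_nonneg (L := L) n; positivity)]
  intro i
  rw [le_div_iff₀' hc, Int.norm_eq_abs]
  exact key i

lemma kap_pos (hL : ∀ i, 0 < L i) {n : Fin 2 → ℤ} (hn : n ≠ 0) : 0 < kap L n := by
  obtain ⟨c, hc, h⟩ := exists_mul_norm_le_kap hL
  exact lt_of_lt_of_le (by have := norm_pos_iff.2 hn; positivity) (h n)

lemma lam_pos (hL : ∀ i, 0 < L i) {n : Fin 2 → ℤ} (hn : n ≠ 0) : 0 < lam L n := by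
  rw [← kap_sq]; exact pow_pos (kap_pos hL hn) 2

lemma summable_kap_inv_pow_three (hL : ∀ i, 0 < L i) :
    Summable fun n : Fin 2 → ℤ => ((kap L n) ^ 3)⁻¹ := by
  obtain ⟨c, hc, h⟩ := exists_mul_norm_le_kap hL
  have hs := (EisensteinSeries.summable_one_div_norm_rpow (k := 3) (by norm_num)).mul_left (c ^ 3)⁻¹
  refine hs.of_nonneg_of_le (fun n => by have := kap_nonneg (L := L) n; positivity) fun n => ?_
  by_cases hn : n = 0
  · subst hn
    simp [kap]
  have hn' : 0 < ‖n‖ := norm_pos_iff.2 hn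
  rw [show (-3 : ℝ) = ((-3 : ℤ) : ℝ) by norm_num, Real.rpow_intCast, zpow_neg, ← mul_inv]
  have h3 : (c * ‖n‖) ^ 3 ≤ kap L n ^ 3 := by gcongr; exact h n
  refine inv_anti₀ (by positivity) ?_
  calc _ = (c * ‖n‖) ^ 3 := by rw [mul_pow]; norm_cast
    _ ≤ _ := h3

/-- The sum is bounded by a telescoping one, uniformly in `N`. -/
lemma sum_range_inv_one_add_sq_le {θ : ℝ} (hθ : 0 < θ) (N : ℕ) :
    ∑ j ∈ Finset.range N, (1 + (θ * j) ^ 2)⁻¹ ≤ 1 + 2 / θ := by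
  have key : ∀ N : ℕ, ∑ j ∈ Finset.range (N + 1), (1 + (θ * j) ^ 2)⁻¹ ≤
      1 + 2 / θ * (1 - (1 + θ * N)⁻¹) := by
    intro N
    induction N with
    | zero => simp
    | succ N ih =>
      rw [Finset.sum_range_succ]
      have hstep : (1 + (θ * ((N + 1 : ℕ) : ℝ)) ^ 2)⁻¹ ≤
          2 / θ * ((1 + θ * N)⁻¹ - (1 + θ * ((N + 1 : ℕ) : ℝ))⁻¹) := by
        have h1 : 0 < 1 + θ * (N : ℝ) := by positivity
        have h2 : 0 < 1 + θ * ((N + 1 : ℕ) : ℝ) := by positivity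
        have e : 2 / θ * ((1 + θ * N)⁻¹ - (1 + θ * ((N + 1 : ℕ) : ℝ))⁻¹) =
            2 / ((1 + θ * N) * (1 + θ * ((N + 1 : ℕ) : ℝ))) := by
          field_simp
          push_cast
          ring
        rw [e, inv_eq_one_div, div_le_div_iff₀ (by positivity) (by positivity)]
        push_cast
        nlinarith [sq_nonneg (1 - θ * ((N : ℝ) + 1)), mul_pos hθ h1]
      linarith
  rcases N with _ | N
  · simp; positivity
  refine (key N).trans ?_
  have : 0 < (1 + θ * (N : ℝ))⁻¹ := by positivity
  have h2 : 0 < 2 / θ := by positivity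
  nlinarith

lemma tsum_int_inv_one_add_sq_le {θ : ℝ} (hθ : 0 < θ) :
    ∑' j : ℤ, ENNReal.ofReal (1 + (θ * j) ^ 2)⁻¹ ≤ ENNReal.ofReal (2 + 4 / θ) := by
  have hN : ∑' j : ℕ, ENNReal.ofReal (1 + (θ * j) ^ 2)⁻¹ ≤ ENNReal.ofReal (1 + 2 / θ) := by
    refine ENNReal.tsum_le_of_sum_range_le fun N => ?_
    rw [← ENNReal.ofReal_sum_of_nonneg (fun _ _ => by positivity)]
    exact ENNReal.ofReal_le_ofReal (sum_range_inv_one_add_sq_le hθ N)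
  have hs := HasSum.of_nat_of_neg_add_one (f := fun j : ℤ => ENNReal.ofReal (1 + (θ * j) ^ 2)⁻¹)
    ENNReal.summable.hasSum ENNReal.summable.hasSum
  rw [hs.tsum_eq]
  have h2 : ∑' j : ℕ, ENNReal.ofReal (1 + (θ * ((-((j : ℤ) + 1) : ℤ) : ℝ)) ^ 2)⁻¹ ≤
      ∑' j : ℕ, ENNReal.ofReal (1 + (θ * j) ^ 2)⁻¹ := by
    refine ENNReal.tsum_le_tsum fun j => ENNReal.ofReal_le_ofReal ?_
    refine inv_anti₀ (by positivity) ?_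
    push_cast
    have : 0 ≤ θ * j := by positivity
    nlinarith
  calc _ ≤ ENNReal.ofReal (1 + 2 / θ) + ENNReal.ofReal (1 + 2 / θ) := by
        refine add_le_add ?_ (h2.trans hN)
        simpa using hN
    _ = _ := by rw [← ENNReal.ofReal_add (by positivity) (by positivity)]; congr 1; ring

/-- The Cauchy-Schwarz inequality for series in `[0, ∞]`. -/
lemma tsum_mul_sq_le {ι : Type*} (f g : ι → ℝ≥0∞) :
    (∑' i, f i * g i) ^ 2 ≤ (∑' i, f i ^ 2) * ∑' i, g i ^ 2 := by
  let _ : MeasurableSpace ι := ⊤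
  have h := ENNReal.lintegral_mul_le_Lp_mul_Lq (Measure.count : Measure ι)
    (p := 2) (q := 2) (by constructor <;> norm_num) (f := f) (g := g)
    (measurable_from_top).aemeasurable (measurable_from_top).aemeasurable
  simp only [lintegral_count, Pi.mul_apply] at h
  calc _ ≤ ((∑' i, f i ^ (2 : ℝ)) ^ (1 / 2 : ℝ) * (∑' i, g i ^ (2 : ℝ)) ^ (1 / 2 : ℝ)) ^ 2 := by
        gcongr
    _ = _ := by
        rw [mul_pow, ← ENNReal.rpow_natCast, ← ENNReal.rpow_natCast, ← ENNReal.rpow_mul,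
          ← ENNReal.rpow_mul]
        norm_num

/-- Fubini for a double series over the planar lattice that splits after a shear. -/
lemma tsum_lattice_shear (p r : ℤ → ℝ≥0∞) (a : (Fin 2 → ℤ) → ℝ≥0∞) :
    ∑' n : Fin 2 → ℤ, ∑' l : Fin 2 → ℤ, a (n - l) * (p (l 0) * r (n 1)) =
      (∑' k, a k) * ((∑' i, p i) * ∑' j, r j) := by
  rw [ENNReal.tsum_comm]
  have h1 : ∀ l : Fin 2 → ℤ, ∑' n : Fin 2 → ℤ, a (n - l) * (p (l 0) * r (n 1)) =
      ∑' k : Fin 2 → ℤ, a k * (p (l 0) * r (k 1 + l 1)) := by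
    intro l
    rw [← (Equiv.addRight l).tsum_eq]
    simp
  simp_rw [h1]
  rw [ENNReal.tsum_comm, ← ENNReal.tsum_mul_right]
  refine tsum_congr fun k => ?_
  rw [ENNReal.tsum_mul_left]
  congr 1
  rw [← (finTwoArrowEquiv ℤ).symm.tsum_eq, ENNReal.tsum_prod', ← ENNReal.tsum_mul_right]
  refine tsum_congr fun i => ?_
  simp only [finTwoArrowEquiv_symm_apply, Matrix.cons_val_zero, Matrix.cons_val_one]
  rw [ENNReal.tsum_mul_left]
  congr 1
  rw [← (Equiv.addLeft (k 1)).tsum_eq r]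
  simp

/-- The weight `1 + (2πj / (ℓR))²` has an inverse summable over `j ∈ ℤ`, with sum `O(R)`. -/
lemma tsum_weight_inv_le {ℓ R : ℝ} (hℓ : 0 < ℓ) (hR : 1 ≤ R) :
    ∑' j : ℤ, ENNReal.ofReal (1 + (2 * Real.pi * j / ℓ) ^ 2 / R ^ 2)⁻¹ ≤
      ENNReal.ofReal ((2 + ℓ) * R) := by
  have hR0 : 0 < R := by linarith
  have hθ : 0 < 2 * Real.pi / (ℓ * R) := by positivity
  have h := tsum_int_inv_one_add_sq_le hθ
  have e : ∀ j : ℤ, (1 + (2 * Real.pi * j / ℓ) ^ 2 / R ^ 2)⁻¹ =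
      (1 + (2 * Real.pi / (ℓ * R) * j) ^ 2)⁻¹ := by
    intro j
    congr 2
    field_simp
  simp_rw [e]
  refine h.trans (ENNReal.ofReal_le_ofReal ?_)
  have h3 : 4 / (2 * Real.pi / (ℓ * R)) = 2 / Real.pi * (ℓ * R) := by
    field_simp
    ring
  rw [h3]
  have h4 : 2 / Real.pi ≤ 1 := by
    rw [div_le_one Real.pi_pos]; linarith [Real.pi_gt_three]
  have : 2 / Real.pi * (ℓ * R) ≤ 1 * (ℓ * R) := by gcongr
  nlinarith

/-- A discrete form of the Ladyzhenskaya inequality. The free parameter `R` plays the role of the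
ratio `‖∇b‖ / ‖b‖`. Weights that depend on one coordinate each turn the Cauchy-Schwarz inequality
into a product of one-dimensional sums. -/
theorem trilinear_sq_le (hL : ∀ i, 0 < L i) {R : ℝ} (hR : 1 ≤ R)
    (a b c : (Fin 2 → ℤ) → ℝ≥0∞) :
    (∑' n, ∑' l, a (n - l) * b l * c n) ^ 2 ≤
      (∑' k, a k ^ 2) * ENNReal.ofReal ((2 + L 0) * R * ((2 + L 1) * R)) *
        ((∑' l, b l ^ 2 * ENNReal.ofReal (1 + lam L l / R ^ 2)) *
          ∑' n, c n ^ 2 * ENNReal.ofReal (1 + lam L n / R ^ 2)) := by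
  have hR0 : 0 < R := by linarith
  set w : Fin 2 → ℤ → ℝ := fun i j => 1 + (2 * Real.pi * j / L i) ^ 2 / R ^ 2 with hw
  have hw0 : ∀ i j, 0 < w i j := fun i j => by simp only [hw]; positivity
  have hmul : ∀ i j, ENNReal.ofReal √(w i j)⁻¹ * ENNReal.ofReal √(w i j) = 1 := by
    intro i j
    rw [← ENNReal.ofReal_mul (by positivity), ← Real.sqrt_mul (by have := hw0 i j; positivity),
      inv_mul_cancel₀ (hw0 i j).ne']
    simp
  have hsq : ∀ x : ℝ, 0 ≤ x → ENNReal.ofReal √x ^ 2 = ENNReal.ofReal x := by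
    intro x hx
    rw [← ENNReal.ofReal_pow (by positivity), Real.sq_sqrt hx]
  have hle : ∀ n i, w i (n i) ≤ 1 + lam L n / R ^ 2 := by
    intro n i
    simp only [hw]
    gcongr
    have := abs_freq_le_kap (L := L) n i
    rw [← sq_le_sq₀ (abs_nonneg _) (kap_nonneg _), sq_abs, kap_sq] at this
    exact this
  let F : (Fin 2 → ℤ) × (Fin 2 → ℤ) → ℝ≥0∞ := fun q =>
    a (q.1 - q.2) * (ENNReal.ofReal √(w 0 (q.2 0))⁻¹ * ENNReal.ofReal √(w 1 (q.1 1))⁻¹)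
  let G : (Fin 2 → ℤ) × (Fin 2 → ℤ) → ℝ≥0∞ := fun q =>
    (b q.2 * ENNReal.ofReal √(w 0 (q.2 0))) * (c q.1 * ENNReal.ofReal √(w 1 (q.1 1)))
  have hFG : ∑' n, ∑' l, a (n - l) * b l * c n = ∑' q, F q * G q := by
    rw [ENNReal.tsum_prod']
    refine tsum_congr fun n => tsum_congr fun l => ?_
    simp only [F, G]
    calc _ = a (n - l) * b l * c n * (ENNReal.ofReal √(w 0 (l 0))⁻¹ * ENNReal.ofReal √(w 0 (l 0))) *
          (ENNReal.ofReal √(w 1 (n 1))⁻¹ * ENNReal.ofReal √(w 1 (n 1))) := by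
          rw [hmul, hmul, mul_one, mul_one]
      _ = _ := by ring
  rw [hFG]
  refine (tsum_mul_sq_le F G).trans (mul_le_mul' ?_ ?_)
  · rw [ENNReal.tsum_prod']
    have e : ∀ n l : Fin 2 → ℤ, F (n, l) ^ 2 = (fun k => a k ^ 2) (n - l) *
        ((fun j => ENNReal.ofReal (w 0 j)⁻¹) (l 0) *
          (fun j => ENNReal.ofReal (w 1 j)⁻¹) (n 1)) := by
      intro n l
      simp only [F, mul_pow]
      rw [hsq _ (inv_nonneg.2 (hw0 _ _).le), hsq _ (inv_nonneg.2 (hw0 _ _).le)]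
    simp_rw [e]
    rw [tsum_lattice_shear (fun j => ENNReal.ofReal (w 0 j)⁻¹)
      (fun j => ENNReal.ofReal (w 1 j)⁻¹) (fun k => a k ^ 2)]
    gcongr
    rw [ENNReal.ofReal_mul (by have := hL 0; positivity)]
    exact mul_le_mul' (tsum_weight_inv_le (hL 0) hR) (tsum_weight_inv_le (hL 1) hR)
  · rw [ENNReal.tsum_prod', mul_comm, ← ENNReal.tsum_mul_right]
    refine ENNReal.tsum_le_tsum fun n => ?_
    rw [← ENNReal.tsum_mul_left]
    refine ENNReal.tsum_le_tsum fun l => ?_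
    simp only [G, mul_pow]
    rw [hsq _ (hw0 _ _).le, hsq _ (hw0 _ _).le, mul_comm]
    gcongr
    · exact hle n 1
    · exact hle l 0

/-! ### The nonlinearity on the Fourier side -/

/-- The coefficient `(κₖ × κₙ) / |κₖ|²` (up to sign) with which the modes `k` and `n - k` of the
vorticity interact to act on the mode `n`. -/
def qc (L : Plane) (k n : Fin 2 → ℤ) : ℝ :=
  (freq L k 1 * freq L n 0 - freq L k 0 * freq L n 1) / lam L k

/-- The Fourier coefficients of `-div (u ω)`, where `ω` has the coefficients `z` and `u` is the
solenoidal field with the vorticity `ω`. -/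
def conv (L : Plane) (z : (Fin 2 → ℤ) → ℂ) (n : Fin 2 → ℤ) : ℂ :=
  ∑' k, (qc L k n : ℂ) * (z k * z (n - k))

lemma cross_sq_le (k n : Fin 2 → ℤ) :
    |freq L k 1 * freq L n 0 - freq L k 0 * freq L n 1| ≤ kap L k * kap L n := by
  rw [kap, kap, ← Real.sqrt_mul (lam_nonneg k)]
  refine Real.abs_le_sqrt ?_
  unfold lam
  nlinarith [sq_nonneg (freq L k 0 * freq L n 0 + freq L k 1 * freq L n 1)]

lemma cross_sub (k n : Fin 2 → ℤ) :
    freq L k 1 * freq L n 0 - freq L k 0 * freq L n 1 =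
      freq L k 1 * freq L (n - k) 0 - freq L k 0 * freq L (n - k) 1 := by
  rw [freq_sub, freq_sub]; ring

lemma abs_qc_le (k n : Fin 2 → ℤ) : |qc L k n| ≤ kap L n / kap L k := by
  rw [qc, abs_div, abs_of_nonneg (lam_nonneg k), ← kap_sq]
  rcases (kap_nonneg (L := L) k).eq_or_lt with h | h
  · simp [← h]
  rw [div_le_div_iff₀ (by positivity) h]
  have := cross_sq_le (L := L) k n
  nlinarith

lemma abs_qc_le' (k n : Fin 2 → ℤ) : |qc L k n| ≤ kap L (n - k) / kap L k := by
  have : qc L k n = qc L k (n - k) := by rw [qc, qc, cross_sub]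
  rw [this]; exact abs_qc_le k (n - k)

/-- Antisymmetry of the interaction coefficient, which expresses energy conservation of transport
by a solenoidal field. -/
lemma qc_antisymm (n l : Fin 2 → ℤ) : qc L (l - n) l = -qc L (n - l) n := by
  rw [qc, qc, cross_sub, show l - n = -(n - l) by abel, lam_neg, cross_sub (n - l) n, ← neg_div]
  congr 1
  simp only [freq_neg, freq_sub]
  ring

lemma kap_le_add (k l : Fin 2 → ℤ) : kap L (k + l) ≤ kap L k + kap L l := by
  have h1 := kap_nonneg (L := L) k
  have h2 := kap_nonneg (L := L) l
  rw [kap, Real.sqrt_le_iff]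
  refine ⟨by positivity, ?_⟩
  have hk := kap_sq (L := L) k
  have hl := kap_sq (L := L) l
  have hc : freq L k 0 * freq L l 0 + freq L k 1 * freq L l 1 ≤ kap L k * kap L l := by
    rw [kap, kap, ← Real.sqrt_mul (lam_nonneg k)]
    refine Real.le_sqrt_of_sq_le ?_
    unfold lam
    nlinarith [sq_nonneg (freq L k 0 * freq L l 1 - freq L k 1 * freq L l 0)]
  rw [add_sq, hk, hl]
  simp only [lam, freq_add]
  nlinarith

lemma abs_lam_sub_le (n l : Fin 2 → ℤ) :
    |lam L n - lam L l| ≤ kap L (n - l) * (kap L n + kap L l) := by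
  rw [← kap_sq, ← kap_sq]
  have h1 := kap_le_add (L := L) (n - l) l
  have h2 := kap_le_add (L := L) (l - n) n
  rw [sub_add_cancel] at h1 h2
  rw [show l - n = -(n - l) by abel, kap_neg] at h2
  have hn := kap_nonneg (L := L) n
  have hl := kap_nonneg (L := L) l
  rw [abs_le]
  constructor <;> nlinarith

/-- The commutator estimate that makes the regularized enstrophy balance uniform. -/
lemma abs_lam_sub_mul_qc_le (n l : Fin 2 → ℤ) :
    |lam L n - lam L l| * |qc L (n - l) n| ≤ 2 * (kap L n * kap L l) := by
  have hn := kap_nonneg (L := L) n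
  have hl := kap_nonneg (L := L) l
  have hk := kap_nonneg (L := L) (n - l)
  have h0 := abs_lam_sub_le (L := L) n l
  have h1 := abs_qc_le (L := L) (n - l) n
  have h2 := abs_qc_le' (L := L) (n - l) n
  rw [sub_sub_cancel] at h2
  rcases hk.eq_or_lt with h | h
  · rw [← h] at h1
    simp only [div_zero, abs_nonpos_iff] at h1
    rw [h1]
    simp
    positivity
  rw [le_div_iff₀ h] at h1 h2
  have hq := abs_nonneg (qc L (n - l) n)
  calc _ ≤ kap L (n - l) * (kap L n + kap L l) * |qc L (n - l) n| := by gcongr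
    _ = kap L n * (|qc L (n - l) n| * kap L (n - l)) +
        kap L l * (|qc L (n - l) n| * kap L (n - l)) := by ring
    _ ≤ kap L n * kap L l + kap L l * kap L n := by gcongr
    _ = _ := by ring

/-- The constant in the trilinear estimate. -/
def Ctri (L : Plane) : ℝ := (2 + L 0) * (2 + L 1)

lemma one_le_Ctri (hL : ∀ i, 0 < L i) : 1 ≤ Ctri L := by
  have h0 := hL 0
  have h1 := hL 1
  unfold Ctri
  nlinarith

/-- The trilinear estimate for two equal factors. The length `R` separates low from high frequencies
and is free, so that the term with the derivative can be made small. -/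
theorem trilinear_le (hL : ∀ i, 0 < L i) {R : ℝ} (hR : 1 ≤ R) {a b : (Fin 2 → ℤ) → ℝ}
    (ha : ∀ n, 0 ≤ a n) (hb : ∀ n, 0 ≤ b n)
    {A B₀ B₁ : ℝ} (hA : 0 ≤ A) (hB₀ : 0 ≤ B₀) (hB₁ : 0 ≤ B₁)
    (hA' : ∑' n, ENNReal.ofReal (a n ^ 2) ≤ ENNReal.ofReal (A ^ 2))
    (hB₀' : ∑' n, ENNReal.ofReal (b n ^ 2) ≤ ENNReal.ofReal B₀)
    (hB₁' : ∑' n, ENNReal.ofReal (lam L n * b n ^ 2) ≤ ENNReal.ofReal B₁) :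
    ∑' n, ∑' l, ENNReal.ofReal (a (n - l) * b l * b n) ≤
      ENNReal.ofReal (Ctri L * A * (R * B₀ + B₁ / R)) := by
  have hR0 : 0 < R := by linarith
  have hC := one_le_Ctri hL
  have h := trilinear_sq_le hL hR (fun n => ENNReal.ofReal (a n)) (fun n => ENNReal.ofReal (b n))
    (fun n => ENNReal.ofReal (b n))
  simp only [← ENNReal.ofReal_mul (ha _), ← ENNReal.ofReal_mul (mul_nonneg (ha _) (hb _)),
    ← ENNReal.ofReal_pow (ha _), ← ENNReal.ofReal_pow (hb _),
    ← ENNReal.ofReal_mul (sq_nonneg (b _))] at h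
  have hsum : ∑' l, ENNReal.ofReal (b l ^ 2 * (1 + lam L l / R ^ 2)) ≤
      ENNReal.ofReal (B₀ + B₁ / R ^ 2) := by
    have e : ∀ l, ENNReal.ofReal (b l ^ 2 * (1 + lam L l / R ^ 2)) =
        ENNReal.ofReal (b l ^ 2) + ENNReal.ofReal (lam L l * b l ^ 2) *
          ENNReal.ofReal (R ^ 2)⁻¹ := by
      intro l
      have := lam_nonneg (L := L) l
      rw [← ENNReal.ofReal_mul (by positivity),
        ← ENNReal.ofReal_add (by positivity) (by positivity)]
      congr 1
      field_simp
    simp_rw [e]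
    rw [ENNReal.tsum_add, ENNReal.tsum_mul_right, ENNReal.ofReal_add hB₀ (by positivity),
      div_eq_mul_inv, ENNReal.ofReal_mul hB₁]
    gcongr
  rw [← ENNReal.pow_le_pow_left_iff (two_ne_zero)]
  refine h.trans ?_
  calc _ ≤ ENNReal.ofReal (A ^ 2) * ENNReal.ofReal ((2 + L 0) * R * ((2 + L 1) * R)) *
        (ENNReal.ofReal (B₀ + B₁ / R ^ 2) * ENNReal.ofReal (B₀ + B₁ / R ^ 2)) := by gcongr
    _ = ENNReal.ofReal (A ^ 2 * (Ctri L * R ^ 2) * (B₀ + B₁ / R ^ 2) ^ 2) := by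
        rw [← ENNReal.ofReal_mul (by positivity), ← ENNReal.ofReal_mul (by positivity),
          ← ENNReal.ofReal_mul (by unfold Ctri at hC; nlinarith [sq_nonneg A, sq_nonneg (A * R)])]
        congr 1
        unfold Ctri
        ring
    _ ≤ ENNReal.ofReal ((Ctri L * A * (R * B₀ + B₁ / R)) ^ 2) := by
        refine ENNReal.ofReal_le_ofReal ?_
        have e : R * B₀ + B₁ / R = R * (B₀ + B₁ / R ^ 2) := by field_simp
        rw [e]
        have hX : 0 ≤ A ^ 2 * R ^ 2 * (B₀ + B₁ / R ^ 2) ^ 2 := by positivity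
        nlinarith [mul_nonneg hX (sub_nonneg.2 hC)]
    _ = _ := by rw [ENNReal.ofReal_pow]; positivity

/-! ### The regularized enstrophy balance at a fixed time -/

/-- The regularizing weight `(1 + δ|κₙ|²)⁻¹`. -/
def wt (L : Plane) (δ : ℝ) (n : Fin 2 → ℤ) : ℝ := (1 + δ * lam L n)⁻¹

lemma wt_pos {δ : ℝ} (hδ : 0 < δ) (n : Fin 2 → ℤ) : 0 < wt L δ n := by
  have := lam_nonneg (L := L) n
  unfold wt; positivity

lemma wt_le_one {δ : ℝ} (hδ : 0 < δ) (n : Fin 2 → ℤ) : wt L δ n ≤ 1 := by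
  have := lam_nonneg (L := L) n
  exact inv_le_one_of_one_le₀ (by nlinarith)

lemma wt_mul_lam_le {δ : ℝ} (hδ : 0 < δ) (n : Fin 2 → ℤ) : wt L δ n * lam L n ≤ δ⁻¹ := by
  have := lam_nonneg (L := L) n
  unfold wt
  rw [inv_mul_le_iff₀ (by positivity)]
  field_simp
  nlinarith

/-- The sum `∑ ‖zₙ‖²`, the enstrophy up to a factor. -/
def enst (z : (Fin 2 → ℤ) → ℂ) : ℝ := ∑' n, ‖z n‖ ^ 2

lemma enst_nonneg (z) : 0 ≤ enst z := tsum_nonneg fun _ => by positivity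

lemma ofReal_enst {z : (Fin 2 → ℤ) → ℂ} (hz : Summable fun n => ‖z n‖ ^ 2) :
    ∑' n, ENNReal.ofReal (‖z n‖ ^ 2) = ENNReal.ofReal (enst z) :=
  (ENNReal.ofReal_tsum_of_nonneg (fun _ => by positivity) hz).symm

/-- The cubic term of the regularized enstrophy balance converges absolutely. The bound degenerates
as `δ → 0`; it only justifies rearranging the double sum. -/
lemma flux_norm_le (hL : ∀ i, 0 < L i) {δ : ℝ} (hδ : 0 < δ) {z : (Fin 2 → ℤ) → ℂ}
    (hz : Summable fun n => ‖z n‖ ^ 2) {U : ℝ} (hU : 0 ≤ U)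
    (hzU : ∑' n, ENNReal.ofReal (‖z n‖ ^ 2 / lam L n) ≤ ENNReal.ofReal U) :
    ∑' n, ∑' k, ENNReal.ofReal (wt L δ n * (|qc L k n| * (‖z n‖ * (‖z k‖ * ‖z (n - k)‖)))) ≤
      ENNReal.ofReal (δ⁻¹ * (Ctri L * ((1 + 2 * enst z) * U + enst z))) := by
  have hY := enst_nonneg z
  have hC := one_le_Ctri hL
  set Y := enst z
  have hs := Real.sqrt_nonneg Y
  have hsq := Real.sq_sqrt hY
  have h := trilinear_le hL (R := 1 + √Y) (by linarith) (a := fun n => ‖z n‖)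
    (b := fun n => ‖z n‖ / kap L n) (A := √Y) (B₀ := U) (B₁ := Y)
    (fun _ => norm_nonneg _) (fun n => div_nonneg (norm_nonneg _) (kap_nonneg n)) hs hU hY
    (by rw [hsq]; exact (ofReal_enst hz).le)
    (by simpa only [div_pow, kap_sq] using hzU)
    (by
      refine le_trans (ENNReal.tsum_le_tsum fun n => ENNReal.ofReal_le_ofReal ?_)
        (ofReal_enst hz).le
      rw [div_pow, kap_sq]
      rcases (lam_nonneg (L := L) n).eq_or_lt with h | h
      · rw [← h]; simp
      · rw [mul_div_cancel₀ _ h.ne'])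
  have hle : ∑' n, ∑' k, ENNReal.ofReal (wt L δ n * (|qc L k n| * (‖z n‖ * (‖z k‖ * ‖z (n - k)‖))))
      ≤ ENNReal.ofReal δ⁻¹ * ∑' n, ∑' k, ENNReal.ofReal (‖z (n - k)‖ * (‖z k‖ / kap L k) *
        (‖z n‖ / kap L n)) := by
    rw [← ENNReal.tsum_mul_left]
    refine ENNReal.tsum_le_tsum fun n => ?_
    rw [← ENNReal.tsum_mul_left]
    refine ENNReal.tsum_le_tsum fun k => ?_
    rw [← ENNReal.ofReal_mul (by positivity)]
    refine ENNReal.ofReal_le_ofReal ?_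
    have hw := wt_pos (L := L) hδ n
    have hk := kap_nonneg (L := L) k
    calc _ ≤ wt L δ n * (kap L n / kap L k * (‖z n‖ * (‖z k‖ * ‖z (n - k)‖))) := by
          gcongr; exact abs_qc_le k n
      _ = (wt L δ n * kap L n) * (‖z n‖ * (‖z (n - k)‖ * (‖z k‖ / kap L k))) := by ring
      _ ≤ (δ⁻¹ * (kap L n)⁻¹) * (‖z n‖ * (‖z (n - k)‖ * (‖z k‖ / kap L k))) := by
          refine mul_le_mul_of_nonneg_right ?_ (by positivity)
          rcases (kap_nonneg (L := L) n).eq_or_lt with h | h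
          · simp [← h]
          have := wt_mul_lam_le (L := L) hδ n
          rw [← kap_sq] at this
          rw [← div_eq_mul_inv, le_div_iff₀ h]
          linarith [this, sq (kap L n)]
      _ = _ := by ring
  refine hle.trans ((mul_le_mul' le_rfl h).trans ?_)
  rw [← ENNReal.ofReal_mul (by positivity)]
  refine ENNReal.ofReal_le_ofReal ?_
  rw [mul_assoc]
  gcongr
  have e1 : √Y * ((1 + √Y) * U) ≤ (1 + 2 * Y) * U := by
    rw [← mul_assoc]
    gcongr
    nlinarith [sq_nonneg (√Y - 1)]
  have e2 : √Y * (Y / (1 + √Y)) ≤ Y := by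
    rw [← mul_div_assoc, div_le_iff₀ (by positivity)]
    nlinarith
  linarith

/-- The summands of the regularized enstrophy flux, as a double family symmetric under exchange. -/
def fluxTerm (L : Plane) (δ : ℝ) (z : (Fin 2 → ℤ) → ℂ) (q : (Fin 2 → ℤ) × (Fin 2 → ℤ)) : ℂ :=
  (wt L δ q.1 : ℂ) * (conj (z q.1) * ((qc L (q.1 - q.2) q.1 : ℂ) * (z (q.1 - q.2) * z q.2)))

lemma norm_fluxTerm {δ : ℝ} (hδ : 0 < δ) (z : (Fin 2 → ℤ) → ℂ) (n l) :
    ‖fluxTerm L δ z (n, l)‖ =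
      wt L δ n * (|qc L (n - l) n| * (‖z n‖ * (‖z (n - l)‖ * ‖z l‖))) := by
  simp only [fluxTerm, norm_mul, RCLike.norm_conj, Complex.norm_real, Real.norm_eq_abs,
    abs_of_pos (wt_pos (L := L) hδ n)]
  ring

lemma tsum_sub_comm (f : (Fin 2 → ℤ) → (Fin 2 → ℤ) → ℝ≥0∞) (n : Fin 2 → ℤ) :
    ∑' l, f (n - l) l = ∑' k, f k (n - k) := by
  rw [← (Equiv.subLeft n).tsum_eq]
  simp

lemma summable_fluxTerm (hL : ∀ i, 0 < L i) {δ : ℝ} (hδ : 0 < δ) {z : (Fin 2 → ℤ) → ℂ}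
    (hz : Summable fun n => ‖z n‖ ^ 2) {U : ℝ} (hU : 0 ≤ U)
    (hzU : ∑' n, ENNReal.ofReal (‖z n‖ ^ 2 / lam L n) ≤ ENNReal.ofReal U) :
    Summable (fluxTerm L δ z) := by
  refine Summable.of_norm ?_
  rw [← summable_norm_iff]
  have h := flux_norm_le hL hδ hz hU hzU
  have : ∑' q, ENNReal.ofReal ‖fluxTerm L δ z q‖ ≠ (⊤ : ℝ≥0∞) := by
    rw [ENNReal.tsum_prod']
    simp_rw [norm_fluxTerm hδ]
    have e := fun n => tsum_sub_comm (fun k l => ENNReal.ofReal (wt L δ n *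
      (|qc L k n| * (‖z n‖ * (‖z k‖ * ‖z l‖))))) n
    simp_rw [e]
    exact (h.trans_lt ENNReal.ofReal_lt_top).ne
  have h2 := ENNReal.summable_toReal this
  simpa [ENNReal.toReal_ofReal] using h2

lemma tsum_fluxTerm (δ : ℝ) (z : (Fin 2 → ℤ) → ℂ) (n) :
    ∑' l, fluxTerm L δ z (n, l) = (wt L δ n : ℂ) * (conj (z n) * conv L z n) := by
  simp only [fluxTerm]
  rw [tsum_mul_left, tsum_mul_left, conv, ← (Equiv.subLeft n).tsum_eq]
  simp

/-- Transport by a solenoidal field conserves the enstrophy. For the regularized enstrophy only a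
commutator remains, bounded uniformly in the regularization. -/
lemma flux_le {δ : ℝ} (hδ : 0 < δ) {z : (Fin 2 → ℤ) → ℂ}
    (hneg : ∀ n, z (-n) = conj (z n))
    (hs : Summable (fluxTerm L δ z)) {T : ℝ} (hT0 : 0 ≤ T)
    (hT : ∑' n, ∑' l, ENNReal.ofReal (‖z (n - l)‖ * (√(wt L δ l) * ‖z l‖) *
      (√(wt L δ n) * ‖z n‖)) ≤ ENNReal.ofReal T) :
    ∑' n, wt L δ n * (conj (z n) * conv L z n).re ≤ T := by
  have hre : Summable fun q => (fluxTerm L δ z q).re :=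
    hs.norm.of_norm_bounded fun q => Complex.abs_re_le_norm _
  have e1 : ∑' n, wt L δ n * (conj (z n) * conv L z n).re = ∑' q, (fluxTerm L δ z q).re := by
    have hn : Summable fun n => ∑' l, fluxTerm L δ z (n, l) := hs.prod
    have h := hs.tsum_prod
    rw [← Complex.re_tsum hs, h, Complex.re_tsum hn]
    refine tsum_congr fun n => ?_
    rw [tsum_fluxTerm, Complex.re_ofReal_mul]
  have hswap : Summable fun q : (Fin 2 → ℤ) × (Fin 2 → ℤ) => (fluxTerm L δ z q.swap).re :=
    (Equiv.prodComm _ _).summable_iff.2 hre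
  have e2 : ∑' q : (Fin 2 → ℤ) × (Fin 2 → ℤ), (fluxTerm L δ z q.swap).re =
      ∑' q, (fluxTerm L δ z q).re := (Equiv.prodComm _ _).tsum_eq fun q => (fluxTerm L δ z q).re
  have e3 : 2 * ∑' q, (fluxTerm L δ z q).re =
      ∑' q, ((fluxTerm L δ z q).re + (fluxTerm L δ z q.swap).re) := by
    rw [hre.tsum_add hswap, e2]; ring
  -- Exchanging `n` and `l` changes the sign of the coefficient `qc`, so that only the difference of
  -- the two weights enters the symmetrized sum.
  have key : ∀ q, (fluxTerm L δ z q).re + (fluxTerm L δ z q.swap).re ≤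
      2 * (‖z (q.1 - q.2)‖ * (√(wt L δ q.2) * ‖z q.2‖) * (√(wt L δ q.1) * ‖z q.1‖)) := by
    rintro ⟨n, l⟩
    simp only [Prod.swap_prod_mk]
    set x : ℝ := (conj (z n) * (z (n - l) * z l)).re with hx
    have hA : (fluxTerm L δ z (n, l)).re = wt L δ n * (qc L (n - l) n * x) := by
      simp only [fluxTerm, hx]
      rw [Complex.re_ofReal_mul, mul_left_comm, Complex.re_ofReal_mul]
    have hB : (fluxTerm L δ z (l, n)).re = -(wt L δ l * (qc L (n - l) n * x)) := by
      simp only [fluxTerm, hx]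
      rw [Complex.re_ofReal_mul, mul_left_comm, Complex.re_ofReal_mul, qc_antisymm,
        show l - n = -(n - l) by abel, hneg,
        show conj (z l) * (conj (z (n - l)) * z n) = conj (conj (z n) * (z (n - l) * z l)) by
          simp only [map_mul, Complex.conj_conj]; ring, Complex.conj_re]
      ring
    have hxn : |x| ≤ ‖z n‖ * (‖z (n - l)‖ * ‖z l‖) := by
      refine (Complex.abs_re_le_norm _).trans ?_
      simp
    rw [hA, hB]
    have hwn := wt_pos (L := L) hδ n
    have hwl := wt_pos (L := L) hδ l
    have hn := lam_nonneg (L := L) n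
    have hl := lam_nonneg (L := L) l
    have hkn := kap_nonneg (L := L) n
    have hkl := kap_nonneg (L := L) l
    have hd : wt L δ n - wt L δ l = wt L δ n * wt L δ l * δ * (lam L l - lam L n) := by
      unfold wt
      field_simp
      ring
    -- The weights absorb the two derivatives produced by the commutator.
    have hsw : ∀ m, √(wt L δ m) * (√δ * kap L m) ≤ 1 := by
      intro m
      rw [kap, ← Real.sqrt_mul hδ.le, ← Real.sqrt_mul (wt_pos hδ m).le]
      refine Real.sqrt_le_one.2 ?_
      have := wt_mul_lam_le (L := L) hδ m
      calc _ = (wt L δ m * lam L m) * δ := by ring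
        _ ≤ δ⁻¹ * δ := by gcongr
        _ = 1 := inv_mul_cancel₀ hδ.ne'
    calc _ = (wt L δ n - wt L δ l) * qc L (n - l) n * x := by ring
      _ ≤ |(wt L δ n - wt L δ l) * qc L (n - l) n * x| := le_abs_self _
      _ = wt L δ n * wt L δ l * δ * (|lam L n - lam L l| * |qc L (n - l) n|) * |x| := by
          rw [hd, abs_mul, abs_mul, abs_mul,
            abs_of_pos (by positivity : 0 < wt L δ n * wt L δ l * δ),
            abs_sub_comm (lam L l)]
          ring
      _ ≤ wt L δ n * wt L δ l * δ * (2 * (kap L n * kap L l)) *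
            (‖z n‖ * (‖z (n - l)‖ * ‖z l‖)) := by
          gcongr wt L δ n * wt L δ l * δ * ?_ * ?_
          exact abs_lam_sub_mul_qc_le n l
      _ = 2 * ((√(wt L δ n) * (√δ * kap L n)) * (√(wt L δ l) * (√δ * kap L l))) *
            (‖z (n - l)‖ * (√(wt L δ l) * ‖z l‖) * (√(wt L δ n) * ‖z n‖)) := by
          have h1 := Real.mul_self_sqrt hwn.le
          have h2 := Real.mul_self_sqrt hwl.le
          have h3 := Real.mul_self_sqrt hδ.le
          rw [show ∀ a b d X Y Z : ℝ, 2 * ((a * (d * X)) * (b * (d * Y))) * (Z * (b * ‖z l‖) *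
            (a * ‖z n‖)) = (a * a) * (b * b) * (d * d) * (2 * (X * Y)) * (‖z n‖ * (Z * ‖z l‖)) by
            intros; ring, h1, h2, h3]
      _ ≤ 2 * (1 * 1) *
            (‖z (n - l)‖ * (√(wt L δ l) * ‖z l‖) * (√(wt L δ n) * ‖z n‖)) := by
          gcongr
          · exact hsw n
          · exact hsw l
      _ = _ := by ring
  set B : (Fin 2 → ℤ) × (Fin 2 → ℤ) → ℝ := fun q =>
    ‖z (q.1 - q.2)‖ * (√(wt L δ q.2) * ‖z q.2‖) * (√(wt L δ q.1) * ‖z q.1‖) with hB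
  have hB0 : ∀ q, 0 ≤ B q := fun q => by simp only [hB]; positivity
  have hBt : ∑' q, ENNReal.ofReal (B q) ≤ ENNReal.ofReal T := by
    rw [ENNReal.tsum_prod']; exact hT
  have hBs : Summable B := by
    have h2 := ENNReal.summable_toReal (hBt.trans_lt ENNReal.ofReal_lt_top).ne
    simpa [ENNReal.toReal_ofReal, hB0] using h2
  have hBT : ∑' q, B q ≤ T := by
    rw [← ENNReal.ofReal_le_ofReal_iff hT0, ENNReal.ofReal_tsum_of_nonneg hB0 hBs]
    exact hBt
  have h4 := (hre.add hswap).tsum_le_tsum key (hBs.mul_left 2)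
  rw [← e3, tsum_mul_left] at h4
  rw [e1]
  linarith

lemma summable_of_tsum_ofReal_le {ι : Type*} {f : ι → ℝ} (hf : ∀ i, 0 ≤ f i) {C : ℝ}
    (h : ∑' i, ENNReal.ofReal (f i) ≤ ENNReal.ofReal C) : Summable f := by
  have h2 := ENNReal.summable_toReal (h.trans_lt ENNReal.ofReal_lt_top).ne
  simpa [ENNReal.toReal_ofReal, hf] using h2

lemma tsum_le_of_tsum_ofReal_le {ι : Type*} {f : ι → ℝ} (hf : ∀ i, 0 ≤ f i) {C : ℝ} (hC : 0 ≤ C)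
    (h : ∑' i, ENNReal.ofReal (f i) ≤ ENNReal.ofReal C) : ∑' i, f i ≤ C := by
  rw [← ENNReal.ofReal_le_ofReal_iff hC,
    ENNReal.ofReal_tsum_of_nonneg hf (summable_of_tsum_ofReal_le hf h)]
  exact h

/-- The right-hand side of the vorticity equation in the mode `n`. -/
def modeRhs (L : Plane) (ν μ : ℝ) (z g : (Fin 2 → ℤ) → ℂ) (n : Fin 2 → ℤ) : ℂ :=
  -((ν * lam L n + μ : ℝ) : ℂ) * z n + g n + conv L z n

/-- The rate of change of the mode `n` of the regularized enstrophy. -/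
def enstRate (L : Plane) (ν μ δ : ℝ) (z g : (Fin 2 → ℤ) → ℂ) (n : Fin 2 → ℤ) : ℝ :=
  wt L δ n * (2 * (conj (z n) * modeRhs L ν μ z g n).re)

lemma enstRate_eq (ν μ δ : ℝ) (z g : (Fin 2 → ℤ) → ℂ) (n : Fin 2 → ℤ) :
    enstRate L ν μ δ z g n = -(2 * (ν * lam L n + μ) * (wt L δ n * ‖z n‖ ^ 2)) +
      2 * wt L δ n * (conj (z n) * g n).re + 2 * (wt L δ n * (conj (z n) * conv L z n).re) := by
  have h : conj (z n) * modeRhs L ν μ z g n =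
      ((-(ν * lam L n + μ) * ‖z n‖ ^ 2 : ℝ) : ℂ) + conj (z n) * g n + conj (z n) * conv L z n := by
    have := Complex.conj_mul' (z n)
    unfold modeRhs
    push_cast
    linear_combination (-((ν : ℂ) * lam L n + μ)) * this
  rw [enstRate, h, Complex.add_re, Complex.add_re, Complex.ofReal_re]
  ring

lemma two_mul_re_conj_mul_le (a b : ℂ) : |2 * (conj a * b).re| ≤ ‖a‖ ^ 2 + ‖b‖ ^ 2 := by
  have h := Complex.abs_re_le_norm (conj a * b)
  rw [norm_mul, RCLike.norm_conj] at h
  rw [abs_mul, abs_two]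
  nlinarith [sq_nonneg (‖a‖ - ‖b‖)]

/-- The regularized enstrophy balance converges absolutely, which allows the sum over the modes and
the time integral to be interchanged. The bound degenerates as `δ → 0`. -/
lemma tsum_enstRate_norm_le (hL : ∀ i, 0 < L i) {ν μ δ : ℝ} (hν : 0 < ν) (hμ : 0 < μ) (hδ : 0 < δ)
    {z g : (Fin 2 → ℤ) → ℂ} {U G : ℝ} (hz : Summable fun n => ‖z n‖ ^ 2) (hU : 0 ≤ U)
    (hzU : ∑' n, ENNReal.ofReal (‖z n‖ ^ 2 / lam L n) ≤ ENNReal.ofReal U)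
    (hg : ∑' n, ENNReal.ofReal (‖g n‖ ^ 2) ≤ ENNReal.ofReal (G ^ 2)) :
    ∑' n, ENNReal.ofReal |enstRate L ν μ δ z g n| ≤
      ENNReal.ofReal ((2 * (ν / δ + μ) + 1) * enst z + G ^ 2 +
        2 * (δ⁻¹ * (Ctri L * ((1 + 2 * enst z) * U + enst z)))) := by
  have hflux := flux_norm_le hL hδ hz hU hzU
  have hY := enst_nonneg z
  have hC := one_le_Ctri hL
  have hs := summable_fluxTerm hL hδ hz hU hzU
  have h3 : ∑' n, ENNReal.ofReal ‖(wt L δ n : ℂ) * (conj (z n) * conv L z n)‖ ≤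
      ENNReal.ofReal (δ⁻¹ * (Ctri L * ((1 + 2 * enst z) * U + enst z))) := by
    refine le_trans (ENNReal.tsum_le_tsum fun n => ?_) hflux
    rw [← tsum_fluxTerm, ← tsum_sub_comm (fun k l => ENNReal.ofReal (wt L δ n *
      (|qc L k n| * (‖z n‖ * (‖z k‖ * ‖z l‖))))) n]
    simp only [← norm_fluxTerm hδ]
    simp only [ofReal_norm]
    exact enorm_tsum_le_tsum_enorm
  have hpt : ∀ n, |enstRate L ν μ δ z g n| ≤ (2 * (ν / δ + μ) + 1) * ‖z n‖ ^ 2 + ‖g n‖ ^ 2 +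
      2 * ‖(wt L δ n : ℂ) * (conj (z n) * conv L z n)‖ := by
    intro n
    have hw := wt_pos (L := L) hδ n
    have hw1 := wt_le_one (L := L) hδ n
    have hl := lam_nonneg (L := L) n
    have hwl := wt_mul_lam_le (L := L) hδ n
    rw [enstRate_eq]
    have e1 : |2 * (ν * lam L n + μ) * (wt L δ n * ‖z n‖ ^ 2)| ≤ 2 * (ν / δ + μ) * ‖z n‖ ^ 2 := by
      rw [abs_of_nonneg (by positivity)]
      calc _ = 2 * (ν * (wt L δ n * lam L n) + μ * wt L δ n) * ‖z n‖ ^ 2 := by ring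
        _ ≤ 2 * (ν * δ⁻¹ + μ * 1) * ‖z n‖ ^ 2 := by gcongr
        _ = _ := by ring
    have e2 : |2 * wt L δ n * (conj (z n) * g n).re| ≤ ‖z n‖ ^ 2 + ‖g n‖ ^ 2 := by
      rw [show 2 * wt L δ n * (conj (z n) * g n).re =
        wt L δ n * (2 * (conj (z n) * g n).re) by ring,
        abs_mul, abs_of_pos hw]
      calc _ ≤ 1 * (‖z n‖ ^ 2 + ‖g n‖ ^ 2) := by gcongr; exact two_mul_re_conj_mul_le _ _
        _ = _ := one_mul _
    have e3 : |2 * (wt L δ n * (conj (z n) * conv L z n).re)| ≤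
        2 * ‖(wt L δ n : ℂ) * (conj (z n) * conv L z n)‖ := by
      rw [abs_mul, abs_two, ← Complex.re_ofReal_mul]
      gcongr
      exact Complex.abs_re_le_norm _
    have := abs_add_le (-(2 * (ν * lam L n + μ) * (wt L δ n * ‖z n‖ ^ 2)) +
      2 * wt L δ n * (conj (z n) * g n).re) (2 * (wt L δ n * (conj (z n) * conv L z n).re))
    have := abs_add_le (-(2 * (ν * lam L n + μ) * (wt L δ n * ‖z n‖ ^ 2)))
      (2 * wt L δ n * (conj (z n) * g n).re)
    rw [abs_neg] at this
    linarith
  refine (ENNReal.tsum_le_tsum fun n => ENNReal.ofReal_le_ofReal (hpt n)).trans ?_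
  have hA : 0 ≤ 2 * (ν / δ + μ) + 1 := by positivity
  generalize 2 * (ν / δ + μ) + 1 = A at hA ⊢
  have e : ∀ n, ENNReal.ofReal (A * ‖z n‖ ^ 2 + ‖g n‖ ^ 2 +
      2 * ‖(wt L δ n : ℂ) * (conj (z n) * conv L z n)‖) =
      ENNReal.ofReal A * ENNReal.ofReal (‖z n‖ ^ 2) +
        ENNReal.ofReal (‖g n‖ ^ 2) + ENNReal.ofReal 2 *
          ENNReal.ofReal ‖(wt L δ n : ℂ) * (conj (z n) * conv L z n)‖ := by
    intro n
    rw [ENNReal.ofReal_add (by positivity) (by positivity),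
      ENNReal.ofReal_add (by positivity) (by positivity), ENNReal.ofReal_mul (by positivity),
      ENNReal.ofReal_mul (by positivity)]
  simp_rw [e]
  rw [ENNReal.tsum_add, ENNReal.tsum_add, ENNReal.tsum_mul_left, ENNReal.tsum_mul_left,
    ENNReal.ofReal_add (by positivity) (by positivity),
    ENNReal.ofReal_add (by positivity) (by positivity), ENNReal.ofReal_mul (by positivity),
    ENNReal.ofReal_mul (by positivity), ofReal_enst hz]
  gcongr

/-- The regularized enstrophy inequality at a fixed time. The coefficient in front of the
regularized enstrophy is controlled by the enstrophy itself, which is integrable in time. -/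
lemma tsum_enstRate_le (hL : ∀ i, 0 < L i) {ν μ δ : ℝ} (hν : 0 < ν) (hμ : 0 < μ) (hδ : 0 < δ)
    {z g : (Fin 2 → ℤ) → ℂ} {U G : ℝ} (hz : Summable fun n => ‖z n‖ ^ 2)
    (hneg : ∀ n, z (-n) = conj (z n)) (hU : 0 ≤ U)
    (hzU : ∑' n, ENNReal.ofReal (‖z n‖ ^ 2 / lam L n) ≤ ENNReal.ofReal U)
    (hg : ∑' n, ENNReal.ofReal (‖g n‖ ^ 2) ≤ ENNReal.ofReal (G ^ 2)) :
    ∑' n, enstRate L ν μ δ z g n ≤ -(ν * ∑' n, wt L δ n * lam L n * ‖z n‖ ^ 2) +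
      (1 + 2 * Ctri L + (2 * Ctri L + 4 * Ctri L ^ 2 / ν) * enst z) *
        (∑' n, wt L δ n * ‖z n‖ ^ 2) + G ^ 2 := by
  have hY := enst_nonneg z
  have hC := one_le_Ctri hL
  have hs := summable_fluxTerm hL hδ hz hU hzU
  have hgs := summable_of_tsum_ofReal_le (fun n => by positivity) hg
  have hgG := tsum_le_of_tsum_ofReal_le (fun n => by positivity) (sq_nonneg G) hg
  have hw := wt_pos (L := L) hδ
  have hw1 := wt_le_one (L := L) hδ
  have hl := lam_nonneg (L := L)
  have hwl := wt_mul_lam_le (L := L) hδ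
  have hes : Summable fun n => wt L δ n * ‖z n‖ ^ 2 :=
    hz.of_nonneg_of_le (fun n => by have := hw n; positivity) fun n => by
      have := hw1 n; exact mul_le_of_le_one_left (by positivity) this
  have hds : Summable fun n => wt L δ n * lam L n * ‖z n‖ ^ 2 :=
    (hz.mul_left δ⁻¹).of_nonneg_of_le
      (fun n => by have := hw n; have := hl n; positivity) fun n => by
      have := hwl n; gcongr
  set e := ∑' n, wt L δ n * ‖z n‖ ^ 2 with he
  set D := ∑' n, wt L δ n * lam L n * ‖z n‖ ^ 2 with hD
  set Y := enst z with hYdef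
  have he0 : 0 ≤ e := tsum_nonneg fun n => by have := hw n; positivity
  have hD0 : 0 ≤ D := tsum_nonneg fun n => by have := hw n; have := hl n; positivity
  have hsY := Real.sqrt_nonneg Y
  have hsq := Real.sq_sqrt hY
  -- With this `R` half of the dissipation absorbs the part of the flux which contains a derivative.
  set R := 1 + 2 * Ctri L * √Y / ν with hR
  have hR1 : 1 ≤ R := by
    have : 0 ≤ 2 * Ctri L * √Y / ν := by positivity
    linarith
  have hR0 : 0 < R := by linarith
  have hsqw : ∀ n, √(wt L δ n) ^ 2 = wt L δ n := fun n => Real.sq_sqrt (hw n).le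
  have htri := trilinear_le hL hR1 (a := fun n => ‖z n‖) (b := fun n => √(wt L δ n) * ‖z n‖)
    (A := √Y) (B₀ := e) (B₁ := D) (fun _ => norm_nonneg _) (fun _ => by positivity) hsY he0 hD0
    (by rw [hsq]; exact (ofReal_enst hz).le)
    (by
      simp only [mul_pow, hsqw]
      rw [he, ENNReal.ofReal_tsum_of_nonneg (fun n => by have := hw n; positivity) hes])
    (by
      simp only [mul_pow, hsqw]
      rw [hD, ENNReal.ofReal_tsum_of_nonneg
        (fun n => by have := hw n; have := hl n; positivity) hds]
      exact ENNReal.tsum_le_tsum fun n => ENNReal.ofReal_le_ofReal (by ring_nf; rfl))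
  have hfl := flux_le hδ hneg hs (T := Ctri L * √Y * (R * e + D / R)) (by positivity) htri
  have hfs : Summable fun n => wt L δ n * (conj (z n) * conv L z n).re := by
    have hn : Summable fun n => ∑' l, fluxTerm L δ z (n, l) := hs.prod
    refine hn.norm.of_norm_bounded fun n => ?_
    rw [tsum_fluxTerm, ← Complex.re_ofReal_mul]
    exact Complex.abs_re_le_norm _
  have hpt : ∀ n, enstRate L ν μ δ z g n ≤ -(2 * ν) * (wt L δ n * lam L n * ‖z n‖ ^ 2) +
      wt L δ n * ‖z n‖ ^ 2 + ‖g n‖ ^ 2 + 2 * (wt L δ n * (conj (z n) * conv L z n).re) := by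
    intro n
    have hwn := hw n
    have hln := hl n
    rw [enstRate_eq]
    have e1 : 2 * wt L δ n * (conj (z n) * g n).re ≤ wt L δ n * ‖z n‖ ^ 2 + ‖g n‖ ^ 2 := by
      have h1 := (abs_le.1 (two_mul_re_conj_mul_le (z n) (g n))).2
      calc _ = wt L δ n * (2 * (conj (z n) * g n).re) := by ring
        _ ≤ wt L δ n * (‖z n‖ ^ 2 + ‖g n‖ ^ 2) := by gcongr
        _ = wt L δ n * ‖z n‖ ^ 2 + wt L δ n * ‖g n‖ ^ 2 := by ring
        _ ≤ _ := by
          have := mul_le_of_le_one_left (sq_nonneg ‖g n‖) (hw1 n)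
          linarith
    have e2 : 0 ≤ μ * (wt L δ n * ‖z n‖ ^ 2) := by positivity
    linarith [e1, e2]
  have hsum := (((hds.mul_left (-(2 * ν))).add hes).add hgs).add (hfs.mul_left 2)
  have hrs : Summable (enstRate L ν μ δ z g) := by
    have := summable_of_tsum_ofReal_le (fun n => abs_nonneg _)
      (tsum_enstRate_norm_le hL hν hμ hδ hz hU hzU hg)
    exact this.of_abs
  refine (hrs.tsum_le_tsum hpt hsum).trans ?_
  rw [(((hds.mul_left (-(2 * ν))).add hes).add hgs).tsum_add (hfs.mul_left 2),
    ((hds.mul_left (-(2 * ν))).add hes).tsum_add hgs, (hds.mul_left (-(2 * ν))).tsum_add hes,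
    tsum_mul_left, tsum_mul_left, ← he, ← hD]
  have k1 : 2 * (Ctri L * √Y * (D / R)) ≤ ν * D := by
    have : 2 * (Ctri L * √Y) ≤ ν * R := by
      rw [hR]; field_simp; linarith
    calc _ = 2 * (Ctri L * √Y) * (D / R) := by ring
      _ ≤ ν * R * (D / R) := by gcongr
      _ = ν * D := by field_simp
  have k2 : 2 * (Ctri L * √Y * (R * e)) ≤
      (2 * Ctri L + (2 * Ctri L + 4 * Ctri L ^ 2 / ν) * Y) * e := by
    have : 2 * (Ctri L * √Y * R) ≤ 2 * Ctri L + (2 * Ctri L + 4 * Ctri L ^ 2 / ν) * Y := by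
      have h1 : √Y ≤ 1 + Y := by nlinarith [sq_nonneg (√Y - 1)]
      have h2 : 2 * (Ctri L * √Y * R) = 2 * Ctri L * √Y + 4 * Ctri L ^ 2 / ν * √Y ^ 2 := by
        rw [hR]; ring
      rw [h2, hsq]
      have : 2 * Ctri L * √Y ≤ 2 * Ctri L * (1 + Y) := by gcongr
      linarith
    calc _ = 2 * (Ctri L * √Y * R) * e := by ring
      _ ≤ _ := by gcongr
  linarith

/-! ### The infinite system of vorticity modes -/

/-- The vorticity equation on the Fourier side. The family `z t` holds the Fourier coefficients of
the vorticity at time `t` and `g t` those of the rotation of the force. -/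
structure VorticityModes (L : Plane) (ν μ T₀ G : ℝ) (z g : ℝ → (Fin 2 → ℤ) → ℂ) : Prop where
  nonneg : 0 ≤ T₀
  cont : ∀ n, Continuous fun t => z t n
  zero : ∀ t, z t 0 = 0
  neg : ∀ t n, z t (-n) = conj (z t n)
  force_int : ∀ n T, 0 ≤ T → IntervalIntegrable (fun t => g t n) volume 0 T
  rhs_int : ∀ n T, 0 ≤ T →
    IntervalIntegrable (fun t => modeRhs L ν μ (z t) (g t) n) volume 0 T
  eq : ∀ n t, 0 ≤ t → z t n = z 0 n + ∫ s in (0 : ℝ)..t, modeRhs L ν μ (z s) (g s) n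
  energy : ∀ T, ∃ U, 0 ≤ U ∧ ∀ t ∈ Icc 0 T,
    ∑' n, ENNReal.ofReal (‖z t n‖ ^ 2 / lam L n) ≤ ENNReal.ofReal U
  enst_fin : ∀ T, ∫⁻ t in Ioc 0 T, ∑' n, ENNReal.ofReal (‖z t n‖ ^ 2) ≠ ⊤
  force : ∀ᵐ t : ℝ, T₀ ≤ t → ∑' n, ENNReal.ofReal (‖g t n‖ ^ 2) ≤ ENNReal.ofReal (G ^ 2)

/-- Gronwall's inequality with a merely integrable coefficient. -/
lemma gronwall_of_integrable {A : ℝ} (hA : 0 < A) {a e : ℝ → ℝ} {t₀ T : ℝ} (hT : t₀ ≤ T)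
    (ha0 : ∀ s, 0 ≤ a s) (he0 : ∀ s, 0 ≤ e s)
    (ha : IntervalIntegrable a volume t₀ T)
    (hae : IntervalIntegrable (fun s => a s * e s) volume t₀ T)
    (h : ∀ t ∈ Icc t₀ T, e t ≤ A + ∫ s in t₀..t, a s * e s) :
    A + ∫ s in t₀..T, a s * e s ≤ A * Real.exp (∫ s in t₀..T, a s) := by
  set y : ℝ → ℝ := fun t => A + ∫ s in t₀..t, a s * e s with hy
  have hint : ∀ t ∈ Icc t₀ T, IntervalIntegrable (fun s => a s * e s) volume t₀ t := fun t ht =>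
    hae.mono_set (by rw [uIcc_of_le ht.1, uIcc_of_le hT]; exact Icc_subset_Icc le_rfl ht.2)
  have hyA : ∀ t ∈ Icc t₀ T, A ≤ y t := fun t ht => by
    have := intervalIntegral.integral_nonneg_of_forall (μ := volume) ht.1
      fun s => mul_nonneg (ha0 s) (he0 s)
    simp only [hy]; linarith
  have hyT : ∀ t ∈ Icc t₀ T, y t ≤ y T := fun t ht => by
    have h2 : IntervalIntegrable (fun s => a s * e s) volume t T :=
      hae.mono_set (by rw [uIcc_of_le ht.2, uIcc_of_le hT]; exact Icc_subset_Icc ht.1 le_rfl)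
    have h1 := intervalIntegral.integral_add_adjacent_intervals (hint t ht) h2
    have := intervalIntegral.integral_nonneg_of_forall (μ := volume) ht.2
      fun s => mul_nonneg (ha0 s) (he0 s)
    simp only [hy]; linarith
  have hy0 : y t₀ = A := by simp [hy]
  have hchain := chain_of_primitive (φ := Real.log) (φ' := fun x => x⁻¹) (s := Ioi 0)
    (fun x hx => Real.hasDerivAt_log (ne_of_gt hx))
    (continuousOn_inv₀.mono fun x hx => ne_of_gt hx) (y := y) hT hae
    (fun t _ => by rw [hy0]) (c := A) (d := y T)
    (fun x hx => lt_of_lt_of_le hA hx.1) (fun t ht => ⟨hyA t ht, hyT t ht⟩)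
  have hyc : ContinuousOn y (uIcc t₀ T) :=
    continuousOn_const.add (intervalIntegral.continuousOn_primitive_interval' hae left_mem_uIcc)
  have hle : ∫ x in t₀..T, (y x)⁻¹ * (a x * e x) ≤ ∫ x in t₀..T, a x := by
    refine intervalIntegral.integral_mono_on hT ?_ ha fun x hx => ?_
    · refine hae.continuousOn_mul (hyc.inv₀ fun x hx => ?_)
      rw [uIcc_of_le hT] at hx
      exact (lt_of_lt_of_le hA (hyA x hx)).ne'
    · have h1 := h x hx
      have h2 := lt_of_lt_of_le hA (hyA x hx)
      rw [inv_mul_le_iff₀ h2, mul_comm]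
      exact mul_le_mul_of_nonneg_right h1 (ha0 x)
  have hypos : 0 < y T := lt_of_lt_of_le hA (hyA T (right_mem_Icc.2 hT))
  rw [hy0] at hchain
  calc A + ∫ s in t₀..T, a s * e s = Real.exp (Real.log (y T)) := (Real.exp_log hypos).symm
    _ ≤ Real.exp (Real.log A + ∫ x in t₀..T, a x) := by
        rw [hchain]; exact Real.exp_le_exp.2 (by linarith)
    _ = _ := by rw [Real.exp_add, Real.exp_log hA]

namespace VorticityModes

variable {ν μ T₀ G : ℝ} {z g : ℝ → (Fin 2 → ℤ) → ℂ}

lemma rhs_int' (h : VorticityModes L ν μ T₀ G z g) (n) {a b : ℝ} (ha : 0 ≤ a) (hab : a ≤ b) :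
    IntervalIntegrable (fun t => modeRhs L ν μ (z t) (g t) n) volume a b :=
  (h.rhs_int n b (ha.trans hab)).mono_set (by
    rw [uIcc_of_le hab, uIcc_of_le (ha.trans hab)]; exact Icc_subset_Icc ha le_rfl)

lemma eq' (h : VorticityModes L ν μ T₀ G z g) (n) {a t : ℝ} (ha : 0 ≤ a) (hat : a ≤ t) :
    z t n = z a n + ∫ s in a..t, modeRhs L ν μ (z s) (g s) n := by
  rw [h.eq n t (ha.trans hat), h.eq n a ha, add_assoc,
    intervalIntegral.integral_add_adjacent_intervals (h.rhs_int n a ha) (h.rhs_int' n ha hat)]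

lemma norm_sq_eq (h : VorticityModes L ν μ T₀ G z g) (n) {a b : ℝ} (ha : 0 ≤ a) (hab : a ≤ b) :
    IntervalIntegrable (fun s => 2 * (conj (z s n) * modeRhs L ν μ (z s) (g s) n).re) volume a b ∧
    ‖z b n‖ ^ 2 = ‖z a n‖ ^ 2 +
      ∫ s in a..b, 2 * (conj (z s n) * modeRhs L ν μ (z s) (g s) n).re := by
  have hint := h.rhs_int' n ha hab
  have hre : IntervalIntegrable (fun s => (modeRhs L ν μ (z s) (g s) n).re) volume a b :=
    ⟨hint.1.re, hint.2.re⟩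
  have him : IntervalIntegrable (fun s => (modeRhs L ν μ (z s) (g s) n).im) volume a b :=
    ⟨hint.1.im, hint.2.im⟩
  obtain ⟨B, hB⟩ := (isCompact_Icc (a := a) (b := b)).exists_bound_of_continuousOn
    (h.cont n).continuousOn
  have hmain : ∀ t ∈ Icc a b, z t n = z a n + ∫ s in a..t, modeRhs L ν μ (z s) (g s) n :=
    fun t ht => h.eq' n ha ht.1
  have hint' : ∀ t ∈ Icc a b,
      IntervalIntegrable (fun s => modeRhs L ν μ (z s) (g s) n) volume a t :=
    fun t ht => h.rhs_int' n ha ht.1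
  have c1 := chain_of_primitive (φ := fun x => x ^ 2) (φ' := fun x => 2 * x) (s := univ)
    (fun x _ => by simpa using hasDerivAt_pow 2 x) (by fun_prop)
    (y := fun t => (z t n).re) hab hre
    (fun t ht => by
      rw [hmain t ht, Complex.add_re]
      congr 1
      exact (intervalIntegral.intervalIntegral_re (𝕜 := ℂ) (hint' t ht)).symm)
        (c := -B) (d := B) (subset_univ _)
    (fun t ht => abs_le.1 ((Complex.abs_re_le_norm _).trans (hB t ht)))
  have c2 := chain_of_primitive (φ := fun x => x ^ 2) (φ' := fun x => 2 * x) (s := univ)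
    (fun x _ => by simpa using hasDerivAt_pow 2 x) (by fun_prop)
    (y := fun t => (z t n).im) hab him
    (fun t ht => by
      rw [hmain t ht, Complex.add_im]
      congr 1
      exact (intervalIntegral.intervalIntegral_im (𝕜 := ℂ) (hint' t ht)).symm)
        (c := -B) (d := B) (subset_univ _)
    (fun t ht => abs_le.1 ((Complex.abs_im_le_norm _).trans (hB t ht)))
  have i1 : IntervalIntegrable (fun s => 2 * (z s n).re * (modeRhs L ν μ (z s) (g s) n).re)
      volume a b := hre.continuousOn_mul
        (continuous_const.mul (Complex.continuous_re.comp (h.cont n))).continuousOn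
  have i2 : IntervalIntegrable (fun s => 2 * (z s n).im * (modeRhs L ν μ (z s) (g s) n).im)
      volume a b := him.continuousOn_mul
        (continuous_const.mul (Complex.continuous_im.comp (h.cont n))).continuousOn
  have e : (fun s => 2 * (conj (z s n) * modeRhs L ν μ (z s) (g s) n).re) = fun s =>
      2 * (z s n).re * (modeRhs L ν μ (z s) (g s) n).re +
        2 * (z s n).im * (modeRhs L ν μ (z s) (g s) n).im := by
    ext s
    simp only [Complex.mul_re, Complex.conj_re, Complex.conj_im]
    ring
  rw [e]
  refine ⟨i1.add i2, ?_⟩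
  rw [intervalIntegral.integral_add i1 i2]
  simp only [Complex.sq_norm, Complex.normSq_apply, ← sq]
  linarith

lemma measurable_tsum (h : VorticityModes L ν μ T₀ G z g) (c : (Fin 2 → ℤ) → ℝ) :
    Measurable fun t => ∑' n, ENNReal.ofReal (c n * ‖z t n‖ ^ 2) :=
  Measurable.tsum fun n => ENNReal.measurable_ofReal.comp
    (measurable_const.mul ((h.cont n).norm.pow 2).measurable)

lemma measurable_tsum_real (h : VorticityModes L ν μ T₀ G z g) {c : (Fin 2 → ℤ) → ℝ}
    (hc : ∀ n, 0 ≤ c n) : Measurable fun t => ∑' n, c n * ‖z t n‖ ^ 2 := by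
  have : (fun t => ∑' n, c n * ‖z t n‖ ^ 2) =
      fun t => (∑' n, ENNReal.ofReal (c n * ‖z t n‖ ^ 2)).toReal := by
    ext t
    rw [ENNReal.tsum_toReal_eq (fun _ => ENNReal.ofReal_ne_top)]
    exact tsum_congr fun n => (ENNReal.toReal_ofReal (by have := hc n; positivity)).symm
  rw [this]
  exact (h.measurable_tsum c).ennreal_toReal

lemma ae_summable (h : VorticityModes L ν μ T₀ G z g) :
    ∀ᵐ t : ℝ, 0 < t → Summable fun n => ‖z t n‖ ^ 2 := by
  have hN : ∀ N : ℕ, ∀ᵐ t : ℝ, t ∈ Ioc (0 : ℝ) N → Summable fun n => ‖z t n‖ ^ 2 := by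
    intro N
    rw [← ae_restrict_iff' measurableSet_Ioc]
    have hm := h.measurable_tsum fun _ => 1
    simp only [one_mul] at hm
    filter_upwards [ae_lt_top hm (h.enst_fin N)] with t ht
    have h2 := ENNReal.summable_toReal ht.ne
    simpa [ENNReal.toReal_ofReal] using h2
  filter_upwards [ae_all_iff.2 hN] with t ht h0
  obtain ⟨N, hN⟩ := exists_nat_ge t
  exact ht N ⟨h0, hN⟩

lemma integrableOn_enst (h : VorticityModes L ν μ T₀ G z g) (T : ℝ) :
    IntegrableOn (fun t => enst (z t)) (Ioc 0 T) := by
  have hm := h.measurable_tsum fun _ => 1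
  simp only [one_mul] at hm
  have : (fun t => enst (z t)) = fun t => (∑' n, ENNReal.ofReal (‖z t n‖ ^ 2)).toReal := by
    ext t
    rw [ENNReal.tsum_toReal_eq (fun _ => ENNReal.ofReal_ne_top)]
    exact tsum_congr fun n => (ENNReal.toReal_ofReal (by positivity)).symm
  rw [this]
  exact integrable_toReal_of_lintegral_ne_top hm.aemeasurable (h.enst_fin T)

lemma intervalIntegrable_enst (h : VorticityModes L ν μ T₀ G z g) {a b : ℝ} (ha : 0 ≤ a)
    (hab : a ≤ b) : IntervalIntegrable (fun t => enst (z t)) volume a b := by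
  rw [intervalIntegrable_iff_integrableOn_Ioc_of_le hab]
  exact (h.integrableOn_enst b).mono_set (Ioc_subset_Ioc ha le_rfl)

end VorticityModes

/-! ### The vorticity is square integrable at positive times -/

/-- A series of integrable functions with an absolutely convergent double sum has an integrable
sum. -/
lemma integrable_tsum_of_lintegral {α ι : Type*} [Countable ι] [MeasurableSpace α] {m : Measure α}
    {f : ι → α → ℝ} (hf : ∀ i, AEStronglyMeasurable (f i) m)
    (h : ∫⁻ a, ∑' i, ENNReal.ofReal |f i a| ∂m ≠ ⊤) :
    Integrable (fun a => ∑' i, f i a) m ∧ Summable (fun i => ∫ a, f i a ∂m) ∧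
      ∫ a, ∑' i, f i a ∂m = ∑' i, ∫ a, f i a ∂m := by
  have hm : ∀ i, AEMeasurable (fun a => ENNReal.ofReal |f i a|) m := fun i =>
    ((hf i).aemeasurable.norm).ennreal_ofReal
  have hae : ∀ᵐ a ∂m, Summable fun i => f i a := by
    filter_upwards [ae_lt_top' (AEMeasurable.tsum hm) h] with a ha
    have h2 := ENNReal.summable_toReal ha.ne
    exact Summable.of_abs (by simpa [ENNReal.toReal_ofReal] using h2)
  have hsm : AEStronglyMeasurable (fun a => ∑' i, f i a) m := by
    refine aestronglyMeasurable_of_tendsto_ae (u := (atTop : Filter (Finset ι)))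
      (f := fun s a => ∑ i ∈ s, f i a) (fun s => ?_) ?_
    · exact Finset.aestronglyMeasurable_fun_sum s fun i _ => hf i
    · filter_upwards [hae] with a ha using ha.hasSum
  have hsum : ∑' i, ∫⁻ a, ‖f i a‖ₑ ∂m ≠ ⊤ := by
    rw [← lintegral_tsum (fun i => (hf i).enorm)]
    simpa only [Real.enorm_eq_ofReal_abs] using h
  refine ⟨⟨hsm, ?_⟩, ?_, integral_tsum hf hsum⟩
  · refine lt_of_le_of_lt (lintegral_mono fun a => ?_) h.lt_top
    simp only [← Real.enorm_eq_ofReal_abs]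
    exact enorm_tsum_le_tsum_enorm
  · have hs := ENNReal.summable_toReal hsum
    refine hs.of_norm_bounded fun i => ?_
    rw [← toReal_enorm]
    exact ENNReal.toReal_mono (ENNReal.ne_top_of_tsum_ne_top hsum i)
      (enorm_integral_le_lintegral_enorm _)

namespace VorticityModes

variable {ν μ T₀ G : ℝ} {z g : ℝ → (Fin 2 → ℤ) → ℂ}

/-- At every time the regularized enstrophy is finite, because it is dominated by the energy. -/
lemma summable_wt (hL : ∀ i, 0 < L i) (h : VorticityModes L ν μ T₀ G z g) {δ : ℝ} (hδ : 0 < δ)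
    {T U : ℝ} (hU0 : 0 ≤ U)
    (hU : ∀ t ∈ Icc 0 T, ∑' n, ENNReal.ofReal (‖z t n‖ ^ 2 / lam L n) ≤ ENNReal.ofReal U)
    {t : ℝ} (ht : t ∈ Icc 0 T) :
    Summable (fun n => wt L δ n * ‖z t n‖ ^ 2) ∧ ∑' n, wt L δ n * ‖z t n‖ ^ 2 ≤ δ⁻¹ * U := by
  have h0 : ∀ n, 0 ≤ ‖z t n‖ ^ 2 / lam L n := fun n => by
    have := lam_nonneg (L := L) n; positivity
  have hs := summable_of_tsum_ofReal_le h0 (hU t ht)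
  have hle : ∀ n, wt L δ n * ‖z t n‖ ^ 2 ≤ δ⁻¹ * (‖z t n‖ ^ 2 / lam L n) := by
    intro n
    by_cases hn : n = 0
    · subst hn; simp [h.zero]
    have hl := lam_pos hL hn
    have := wt_mul_lam_le (L := L) hδ n
    rw [← mul_div_assoc, le_div_iff₀ hl]
    calc _ = wt L δ n * lam L n * ‖z t n‖ ^ 2 := by ring
      _ ≤ _ := by gcongr
  have hs1 : Summable (fun n => wt L δ n * ‖z t n‖ ^ 2) :=
    (hs.mul_left δ⁻¹).of_nonneg_of_le (fun n => by have := wt_pos (L := L) hδ n; positivity) hle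
  refine ⟨hs1, ?_⟩
  calc _ ≤ ∑' n, δ⁻¹ * (‖z t n‖ ^ 2 / lam L n) := hs1.tsum_le_tsum hle (hs.mul_left δ⁻¹)
    _ = δ⁻¹ * ∑' n, ‖z t n‖ ^ 2 / lam L n := tsum_mul_left
    _ ≤ _ := by gcongr; exact tsum_le_of_tsum_ofReal_le h0 hU0 (hU t ht)

/-- The integrated form of the regularized enstrophy inequality. -/
lemma enst_reg (hL : ∀ i, 0 < L i) (hν : 0 < ν) (hμ : 0 < μ) (h : VorticityModes L ν μ T₀ G z g)
    {t₀ T : ℝ} (ht₀ : T₀ ≤ t₀) (hT : t₀ ≤ T) (hz : Summable fun n => ‖z t₀ n‖ ^ 2) :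
    ∃ K, 0 ≤ K ∧ ∀ δ > 0, (∀ t ∈ Icc t₀ T, ∑' n, wt L δ n * ‖z t n‖ ^ 2 ≤ K) ∧
      IntervalIntegrable (fun s => ∑' n, wt L δ n * lam L n * ‖z s n‖ ^ 2) volume t₀ T ∧
      ν * ∫ s in t₀..T, ∑' n, wt L δ n * lam L n * ‖z s n‖ ^ 2 ≤ K := by
  have h00 : 0 ≤ t₀ := h.nonneg.trans ht₀
  obtain ⟨U, hU0, hU⟩ := h.energy T
  have hC := one_le_Ctri hL
  set a : ℝ → ℝ := fun s =>
    1 + 2 * Ctri L + (2 * Ctri L + 4 * Ctri L ^ 2 / ν) * enst (z s) with ha_def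
  have ha0 : ∀ s, 0 ≤ a s := fun s => by
    have := enst_nonneg (z s); simp only [ha_def]; positivity
  have haint : IntervalIntegrable a volume t₀ T :=
    (intervalIntegrable_const).add ((h.intervalIntegrable_enst h00 hT).const_mul _)
  set A := enst (z t₀) + G ^ 2 * (T - t₀) + 1 with hA_def
  have hA : 0 < A := by
    have := enst_nonneg (z t₀)
    have : 0 ≤ G ^ 2 * (T - t₀) := mul_nonneg (sq_nonneg _) (by linarith)
    linarith
  refine ⟨A * Real.exp (∫ s in t₀..T, a s), by positivity, fun δ hδ => ?_⟩
  have hw := wt_pos (L := L) hδ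
  have hl := lam_nonneg (L := L)
  set e : ℝ → ℝ := fun s => ∑' n, wt L δ n * ‖z s n‖ ^ 2 with he_def
  set D : ℝ → ℝ := fun s => ∑' n, wt L δ n * lam L n * ‖z s n‖ ^ 2 with hD_def
  have he0 : ∀ s, 0 ≤ e s := fun s => tsum_nonneg fun n => by have := hw n; positivity
  have hD0 : ∀ s, 0 ≤ D s := fun s => tsum_nonneg fun n => by
    have := hw n; have := hl n; positivity
  have hem : Measurable e := h.measurable_tsum_real fun n => (hw n).le
  have hDm : Measurable D := h.measurable_tsum_real fun n => mul_nonneg (hw n).le (hl n)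
  have hsubset : ∀ t ∈ Icc t₀ T, t ∈ Icc 0 T := fun t ht => ⟨h00.trans ht.1, ht.2⟩
  have hgood : ∀ᵐ s : ℝ, s ∈ Ioc t₀ T → (Summable fun n => ‖z s n‖ ^ 2) ∧
      ∑' n, ENNReal.ofReal (‖g s n‖ ^ 2) ≤ ENNReal.ofReal (G ^ 2) := by
    filter_upwards [h.ae_summable, h.force] with s h1 h2 hs
    exact ⟨h1 (h00.trans_lt hs.1), h2 (ht₀.trans hs.1.le)⟩
  have hDint : IntervalIntegrable D volume t₀ T := by
    rw [intervalIntegrable_iff_integrableOn_Ioc_of_le hT]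
    have h1 := ((h.intervalIntegrable_enst h00 hT).const_mul δ⁻¹)
    rw [intervalIntegrable_iff_integrableOn_Ioc_of_le hT] at h1
    refine Integrable.mono' h1 hDm.aestronglyMeasurable ?_
    rw [ae_restrict_iff' measurableSet_Ioc]
    filter_upwards [hgood] with s hs hsm
    rw [Real.norm_of_nonneg (hD0 s), enst, ← tsum_mul_left]
    have hle : ∀ n, wt L δ n * lam L n * ‖z s n‖ ^ 2 ≤ δ⁻¹ * ‖z s n‖ ^ 2 := fun n => by
      have := wt_mul_lam_le (L := L) hδ n; gcongr
    exact Summable.tsum_le_tsum hle (((hs hsm).1.mul_left δ⁻¹).of_nonneg_of_le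
      (fun n => by have := hw n; have := hl n; positivity) hle) ((hs hsm).1.mul_left δ⁻¹)
  have haeint : IntervalIntegrable (fun s => a s * e s) volume t₀ T := by
    rw [intervalIntegrable_iff_integrableOn_Ioc_of_le hT] at haint ⊢
    refine Integrable.mono' (haint.mul_const (δ⁻¹ * U))
      (haint.aestronglyMeasurable.mul hem.aestronglyMeasurable) ?_
    rw [ae_restrict_iff' measurableSet_Ioc]
    refine ae_of_all _ fun s hs => ?_
    rw [Real.norm_of_nonneg (mul_nonneg (ha0 s) (he0 s))]
    exact mul_le_mul_of_nonneg_left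
      (h.summable_wt hL hδ hU0 hU (hsubset s (Ioc_subset_Icc_self hs))).2 (ha0 s)
  have hmain : ∀ t ∈ Icc t₀ T, e t + ν * ∫ s in t₀..t, D s ≤ A + ∫ s in t₀..t, a s * e s := by
    intro t ht
    have hsub : Ioc t₀ t ⊆ Ioc t₀ T := Ioc_subset_Ioc le_rfl ht.2
    have hmono : ∀ {f : ℝ → ℝ}, IntervalIntegrable f volume t₀ T →
        IntervalIntegrable f volume t₀ t :=
      fun hf => hf.mono_set (by
        rw [uIcc_of_le ht.1, uIcc_of_le hT]; exact Icc_subset_Icc le_rfl ht.2)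
    have hrate := fun n => h.norm_sq_eq n h00 ht.1
    have hrint : ∀ n, IntegrableOn (fun s => enstRate L ν μ δ (z s) (g s) n) (Ioc t₀ t) :=
        fun n => by
      rw [← intervalIntegrable_iff_integrableOn_Ioc_of_le ht.1]
      exact (hrate n).1.const_mul _
    have hfin : ∫⁻ s in Ioc t₀ t, ∑' n, ENNReal.ofReal |enstRate L ν μ δ (z s) (g s) n| ≠ ⊤ := by
      have hb : Integrable (fun s => (2 * (ν / δ + μ) + 1) * enst (z s) + G ^ 2 +
          2 * (δ⁻¹ * (Ctri L * ((1 + 2 * enst (z s)) * U + enst (z s)))))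
          (volume.restrict (Ioc t₀ t)) := by
        have hE := hmono (h.intervalIntegrable_enst h00 hT)
        rw [intervalIntegrable_iff_integrableOn_Ioc_of_le ht.1] at hE
        have hc : ∀ c : ℝ, Integrable (fun _ : ℝ => c) (volume.restrict (Ioc t₀ t)) := fun c =>
          integrable_const c
        have := ((hE.const_mul (2 * (ν / δ + μ) + 1)).add (hc (G ^ 2))).add
          (((((hc 1).add (hE.const_mul 2)).mul_const U).add hE).const_mul (Ctri L) |>.const_mul δ⁻¹
            |>.const_mul 2)
        exact this
      refine ne_top_of_le_ne_top (hb.lintegral_lt_top).ne (lintegral_mono_ae ?_)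
      rw [ae_restrict_iff' measurableSet_Ioc]
      filter_upwards [hgood] with s hs hsm
      obtain ⟨h1, h2⟩ := hs (hsub hsm)
      exact tsum_enstRate_norm_le hL hν hμ hδ h1 hU0
        (hU s (hsubset s (Ioc_subset_Icc_self (hsub hsm)))) h2
    obtain ⟨hI, hS, hE⟩ := integrable_tsum_of_lintegral
      (fun n => (hrint n).aestronglyMeasurable) hfin
    have hst := (h.summable_wt hL hδ hU0 hU (hsubset t₀ ⟨le_rfl, hT⟩)).1
    have heq : e t = e t₀ + ∫ s in Ioc t₀ t, ∑' n, enstRate L ν μ δ (z s) (g s) n := by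
      rw [hE]
      simp only [he_def]
      rw [← hst.tsum_add hS]
      refine tsum_congr fun n => ?_
      rw [(hrate n).2, mul_add, ← intervalIntegral.integral_const_mul,
        intervalIntegral.integral_of_le ht.1]
      rfl
    have hH : IntervalIntegrable (fun s => -(ν * D s) + a s * e s + G ^ 2) volume t₀ t :=
      (((hmono hDint).const_mul ν).neg.add (hmono haeint)).add intervalIntegrable_const
    have hle : ∫ s in Ioc t₀ t, ∑' n, enstRate L ν μ δ (z s) (g s) n ≤
        ∫ s in Ioc t₀ t, (-(ν * D s) + a s * e s + G ^ 2) := by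
      rw [intervalIntegrable_iff_integrableOn_Ioc_of_le ht.1] at hH
      refine integral_mono_ae hI hH ?_
      rw [EventuallyLE, ae_restrict_iff' measurableSet_Ioc]
      filter_upwards [hgood] with s hs hsm
      obtain ⟨h1, h2⟩ := hs (hsub hsm)
      exact tsum_enstRate_le hL hν hμ hδ h1 (h.neg s) hU0
        (hU s (hsubset s (Ioc_subset_Icc_self (hsub hsm)))) h2
    have hneg : IntervalIntegrable (fun s => -(ν * D s)) volume t₀ t :=
      ((hmono hDint).const_mul ν).neg
    have hval : ∫ s in t₀..t, (-(ν * D s) + a s * e s + G ^ 2) =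
        -(ν * ∫ s in t₀..t, D s) + (∫ s in t₀..t, a s * e s) + (t - t₀) * G ^ 2 := by
      rw [intervalIntegral.integral_add (hneg.add (hmono haeint)) intervalIntegrable_const,
        intervalIntegral.integral_add hneg (hmono haeint), intervalIntegral.integral_neg,
        intervalIntegral.integral_const_mul, intervalIntegral.integral_const, smul_eq_mul]
    rw [← intervalIntegral.integral_of_le (f := fun s => -(ν * D s) + a s * e s + G ^ 2) ht.1,
      hval] at hle
    have het₀ : e t₀ ≤ enst (z t₀) :=
      hst.tsum_le_tsum (fun n => mul_le_of_le_one_left (by positivity) (wt_le_one hδ n)) hz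
    have hG : (t - t₀) * G ^ 2 ≤ G ^ 2 * (T - t₀) := by
      rw [mul_comm]; gcongr; exact ht.2
    linarith
  have hDnn : ∀ t ∈ Icc t₀ T, 0 ≤ ν * ∫ s in t₀..t, D s := fun t ht =>
    mul_nonneg hν.le (intervalIntegral.integral_nonneg_of_forall ht.1 hD0)
  have hgr := gronwall_of_integrable hA hT ha0 he0 haint haeint fun t ht => by
    linarith [hmain t ht, hDnn t ht]
  refine ⟨fun t ht => ?_, hDint, ?_⟩
  · have h2 : IntervalIntegrable (fun s => a s * e s) volume t T :=
      haeint.mono_set (by rw [uIcc_of_le ht.2, uIcc_of_le hT]; exact Icc_subset_Icc ht.1 le_rfl)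
    have h3 : IntervalIntegrable (fun s => a s * e s) volume t₀ t :=
      haeint.mono_set (by rw [uIcc_of_le ht.1, uIcc_of_le hT]; exact Icc_subset_Icc le_rfl ht.2)
    have h1 := intervalIntegral.integral_add_adjacent_intervals h3 h2
    have := intervalIntegral.integral_nonneg_of_forall (μ := volume) ht.2
      fun s => mul_nonneg (ha0 s) (he0 s)
    have := hmain t ht
    have := hDnn t ht
    change e t ≤ _
    linarith
  · have := hmain T ⟨hT, le_rfl⟩
    have := he0 T
    linarith

lemma tendsto_wt (n : Fin 2 → ℤ) : Tendsto (fun δ => wt L δ n) (𝓝[>] 0) (𝓝 1) := by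
  have : ContinuousAt (fun δ : ℝ => (1 + δ * lam L n)⁻¹) 0 :=
    ContinuousAt.inv₀ (by fun_prop) (by simp)
  have h := this.tendsto
  simp only [zero_mul, add_zero, inv_one] at h
  exact h.mono_left nhdsWithin_le_nhds

/-- From a time at which the vorticity is square integrable on, the enstrophy stays bounded and the
dissipation is integrable. -/
theorem enstrophy_bound (hL : ∀ i, 0 < L i) (hν : 0 < ν) (hμ : 0 < μ)
    (h : VorticityModes L ν μ T₀ G z g)
    {t₀ T : ℝ} (ht₀ : T₀ ≤ t₀) (hT : t₀ ≤ T) (hz : Summable fun n => ‖z t₀ n‖ ^ 2) :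
    ∃ K, 0 ≤ K ∧ (∀ t ∈ Icc t₀ T, ∑' n, ENNReal.ofReal (‖z t n‖ ^ 2) ≤ ENNReal.ofReal K) ∧
      ∫⁻ t in Ioc t₀ T, ∑' n, ENNReal.ofReal (lam L n * ‖z t n‖ ^ 2) ≤ ENNReal.ofReal K := by
  obtain ⟨K, hK, H⟩ := h.enst_reg hL hν hμ ht₀ hT hz
  have h00 : 0 ≤ t₀ := h.nonneg.trans ht₀
  obtain ⟨U, hU0, hU⟩ := h.energy T
  have hl := lam_nonneg (L := L)
  -- The limit `δ → 0` is taken in finite partial sums.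
  refine ⟨K + K / ν, by positivity, fun t ht => ?_, ?_⟩
  · rw [ENNReal.tsum_eq_iSup_sum]
    refine iSup_le fun s => ?_
    rw [← ENNReal.ofReal_sum_of_nonneg (fun _ _ => by positivity)]
    refine ENNReal.ofReal_le_ofReal ?_
    have h1 : Tendsto (fun δ => ∑ n ∈ s, wt L δ n * ‖z t n‖ ^ 2) (𝓝[>] 0)
        (𝓝 (∑ n ∈ s, 1 * ‖z t n‖ ^ 2)) :=
      tendsto_finsetSum _ fun n _ => (tendsto_wt n).mul_const _
    simp only [one_mul] at h1
    have h2 : ∑ n ∈ s, ‖z t n‖ ^ 2 ≤ K := by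
      refine le_of_tendsto h1 ?_
      filter_upwards [self_mem_nhdsWithin] with δ hδ
      exact ((h.summable_wt hL hδ hU0 hU ⟨h00.trans ht.1, ht.2⟩).1.sum_le_tsum s
        fun n _ => by have := wt_pos (L := L) hδ n; positivity).trans ((H δ hδ).1 t ht)
    have : 0 ≤ K / ν := by positivity
    linarith
  · have hm : ∀ n, Measurable fun t => ENNReal.ofReal (lam L n * ‖z t n‖ ^ 2) := fun n =>
      ENNReal.measurable_ofReal.comp (measurable_const.mul ((h.cont n).norm.pow 2).measurable)
    rw [lintegral_tsum (fun n => (hm n).aemeasurable), ENNReal.tsum_eq_iSup_sum]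
    refine iSup_le fun s => ?_
    have hci : ∀ n, IntervalIntegrable (fun t => lam L n * ‖z t n‖ ^ 2) volume t₀ T := fun n =>
      (continuous_const.mul ((h.cont n).norm.pow 2)).intervalIntegrable _ _
    have he : ∀ n, ∫⁻ t in Ioc t₀ T, ENNReal.ofReal (lam L n * ‖z t n‖ ^ 2) =
        ENNReal.ofReal (∫ t in t₀..T, lam L n * ‖z t n‖ ^ 2) := fun n => by
      rw [intervalIntegral.integral_of_le hT, ofReal_integral_eq_lintegral_ofReal
        ((intervalIntegrable_iff_integrableOn_Ioc_of_le hT).1 (hci n))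
        (ae_of_all _ fun t => by have := hl n; positivity)]
    simp_rw [he]
    rw [← ENNReal.ofReal_sum_of_nonneg (fun n _ => intervalIntegral.integral_nonneg_of_forall hT
      fun t => by have := hl n; positivity)]
    refine ENNReal.ofReal_le_ofReal ?_
    have h1 : Tendsto (fun δ => ∑ n ∈ s, wt L δ n * ∫ t in t₀..T, lam L n * ‖z t n‖ ^ 2) (𝓝[>] 0)
        (𝓝 (∑ n ∈ s, 1 * ∫ t in t₀..T, lam L n * ‖z t n‖ ^ 2)) :=
      tendsto_finsetSum _ fun n _ => (tendsto_wt n).mul_const _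
    simp only [one_mul] at h1
    refine (le_of_tendsto h1 ?_).trans (by linarith : K / ν ≤ K + K / ν)
    filter_upwards [self_mem_nhdsWithin] with δ hδ
    have hw := wt_pos (L := L) hδ
    obtain ⟨-, hi, hb⟩ := H δ hδ
    rw [le_div_iff₀' hν]
    refine le_trans (mul_le_mul_of_nonneg_left ?_ hν.le) hb
    simp_rw [← intervalIntegral.integral_const_mul]
    rw [← intervalIntegral.integral_finsetSum fun n _ => (hci n).const_mul _]
    refine intervalIntegral.integral_mono_ae_restrict hT
      ((continuous_finsetSum s fun n _ => continuous_const.mul (continuous_const.mul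
        ((h.cont n).norm.pow 2))).intervalIntegrable _ _) hi ?_
    rw [EventuallyLE, ae_restrict_iff' measurableSet_Icc]
    have hne : ∀ᵐ t : ℝ, t ≠ t₀ := by simp [ae_iff, measure_singleton]
    filter_upwards [h.ae_summable, hne] with t h1 htne htm
    have h2 := h1 (h00.trans_lt (lt_of_le_of_ne htm.1 htne.symm))
    have h3 : Summable fun n => wt L δ n * lam L n * ‖z t n‖ ^ 2 :=
      (h2.mul_left δ⁻¹).of_nonneg_of_le (fun n => by have := hw n; have := hl n; positivity)
        fun n => by have := wt_mul_lam_le (L := L) hδ n; gcongr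
    simp only [← mul_assoc]
    exact h3.sum_le_tsum s fun n _ => by have := hw n; have := hl n; positivity

end VorticityModes

/-! ### Smoothing -/

lemma exists_le_kap (hL : ∀ i, 0 < L i) : ∃ c > 0, ∀ n : Fin 2 → ℤ, n ≠ 0 → c ≤ kap L n := by
  obtain ⟨c, hc, h⟩ := exists_mul_norm_le_kap hL
  refine ⟨c, hc, fun n hn => le_trans ?_ (h n)⟩
  obtain ⟨i, hi⟩ := Function.ne_iff.1 hn
  have h1 : (1 : ℝ) ≤ ‖n i‖ := by
    rw [Int.norm_eq_abs]; exact_mod_cast Int.one_le_abs hi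
  have := h1.trans (norm_le_pi_norm n i)
  nlinarith

/-- The transport term is bounded by the convolution of the moduli of the coefficients of the
velocity and of the gradient of the vorticity. -/
lemma enorm_conv_le (z : (Fin 2 → ℤ) → ℂ) (n : Fin 2 → ℤ) :
    ‖conv L z n‖ₑ ≤
      ∑' k, ENNReal.ofReal (‖z k‖ / kap L k) * ENNReal.ofReal (kap L (n - k) * ‖z (n - k)‖) := by
  refine enorm_tsum_le_tsum_enorm.trans (ENNReal.tsum_le_tsum fun k => ?_)
  have hk := kap_nonneg (L := L) k
  rw [← ENNReal.ofReal_mul (by positivity), ← ofReal_norm]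
  refine ENNReal.ofReal_le_ofReal ?_
  simp only [norm_mul, Complex.norm_real, Real.norm_eq_abs]
  calc _ ≤ kap L (n - k) / kap L k * (‖z k‖ * ‖z (n - k)‖) := by
        gcongr; exact abs_qc_le' k n
    _ = _ := by ring

/-- The nonlinearity has one half of a derivative less than a square integrable function when the
vorticity is in `H¹`. -/
lemma tsum_conv_sq_le (z : (Fin 2 → ℤ) → ℂ) :
    ∑' n, ENNReal.ofReal ((kap L n)⁻¹ * ‖conv L z n‖ ^ 2) ≤
      (∑' k, ENNReal.ofReal (‖z k‖ ^ 2)) * (∑' m, ENNReal.ofReal (lam L m * ‖z m‖ ^ 2)) *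
        (2 * ∑' k : Fin 2 → ℤ, ENNReal.ofReal (kap L k ^ 3)⁻¹) := by
  set S := ∑' k : Fin 2 → ℤ, ENNReal.ofReal (kap L k ^ 3)⁻¹ with hS
  have hk := kap_nonneg (L := L)
  have hl := lam_nonneg (L := L)
  have h1 : ∀ n, ENNReal.ofReal ((kap L n)⁻¹ * ‖conv L z n‖ ^ 2) ≤
      (∑' k, ENNReal.ofReal (‖z k‖ ^ 2)) * ∑' k, ENNReal.ofReal (lam L (n - k) * ‖z (n - k)‖ ^ 2) *
        ENNReal.ofReal ((kap L n)⁻¹ * (kap L k)⁻¹ ^ 2) := by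
    intro n
    have hkn := hk n
    have e : ‖conv L z n‖ₑ ≤ ∑' k, ENNReal.ofReal ‖z k‖ *
        ENNReal.ofReal (kap L (n - k) * ‖z (n - k)‖ * (kap L k)⁻¹) := by
      refine (enorm_conv_le z n).trans_eq (tsum_congr fun k => ?_)
      have := hk k
      have := hk (n - k)
      rw [← ENNReal.ofReal_mul (by positivity), ← ENNReal.ofReal_mul (by positivity)]
      congr 1; ring
    rw [ENNReal.ofReal_mul (by positivity), ENNReal.ofReal_pow (by positivity), ofReal_norm]
    calc _ ≤ ENNReal.ofReal (kap L n)⁻¹ * ((∑' k, ENNReal.ofReal ‖z k‖ ^ 2) *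
          ∑' k, ENNReal.ofReal (kap L (n - k) * ‖z (n - k)‖ * (kap L k)⁻¹) ^ 2) := by
          gcongr
          exact (pow_le_pow_left' e 2).trans (tsum_mul_sq_le _ _)
      _ = _ := by
          rw [mul_left_comm, ← ENNReal.tsum_mul_left]
          congr 1
          · exact tsum_congr fun k => (ENNReal.ofReal_pow (norm_nonneg _) 2).symm
          · refine tsum_congr fun k => ?_
            have := hk k
            have := hk (n - k)
            have := hl (n - k)
            rw [← ENNReal.ofReal_pow (by positivity), ← ENNReal.ofReal_mul (by positivity),
              ← ENNReal.ofReal_mul (by positivity), ← kap_sq]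
            congr 1; ring
  refine (ENNReal.tsum_le_tsum h1).trans ?_
  rw [ENNReal.tsum_mul_left, mul_assoc]
  gcongr
  rw [ENNReal.tsum_comm, ← ENNReal.tsum_mul_right]
  have h2 : ∀ k, ∑' n, ENNReal.ofReal (lam L (n - k) * ‖z (n - k)‖ ^ 2) *
        ENNReal.ofReal ((kap L n)⁻¹ * (kap L k)⁻¹ ^ 2) =
      ∑' m, ENNReal.ofReal (lam L m * ‖z m‖ ^ 2) *
        ENNReal.ofReal ((kap L (m + k))⁻¹ * (kap L k)⁻¹ ^ 2) := by
    intro k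
    rw [← (Equiv.addRight k).tsum_eq]
    simp
  simp_rw [h2]
  rw [ENNReal.tsum_comm]
  refine ENNReal.tsum_le_tsum fun m => ?_
  rw [ENNReal.tsum_mul_left]
  gcongr
  have h3 : ∀ k, ENNReal.ofReal ((kap L (m + k))⁻¹ * (kap L k)⁻¹ ^ 2) ≤
      ENNReal.ofReal (kap L (m + k) ^ 3)⁻¹ + ENNReal.ofReal (kap L k ^ 3)⁻¹ := by
    intro k
    have ha := inv_nonneg.2 (hk (m + k))
    have hb := inv_nonneg.2 (hk k)
    rw [← ENNReal.ofReal_add (by have := hk (m + k); positivity) (by have := hk k; positivity),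
      ← inv_pow, ← inv_pow]
    refine ENNReal.ofReal_le_ofReal ?_
    generalize (kap L (m + k))⁻¹ = a at *
    generalize (kap L k)⁻¹ = b at *
    rcases le_total a b with hab | hab
    · have : a * b ^ 2 ≤ b * b ^ 2 := by gcongr
      have : 0 ≤ a ^ 3 := by positivity
      nlinarith
    · have : a * b ^ 2 ≤ a * a ^ 2 := by gcongr
      have : 0 ≤ b ^ 3 := by positivity
      nlinarith
  refine (ENNReal.tsum_le_tsum h3).trans_eq ?_
  rw [ENNReal.tsum_add, two_mul]
  congr 1
  exact (Equiv.addLeft m).tsum_eq fun k => ENNReal.ofReal (kap L k ^ 3)⁻¹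

lemma ofReal_integral_le_lintegral {α : Type*} [MeasurableSpace α] {m : Measure α} {f : α → ℝ}
    (hf : Integrable f m) : ENNReal.ofReal (∫ a, f a ∂m) ≤ ∫⁻ a, ENNReal.ofReal (f a) ∂m := by
  have h1 : ∫ a, f a ∂m ≤ ∫ a, max (f a) 0 ∂m :=
    integral_mono hf hf.pos_part fun a => le_max_left _ _
  refine (ENNReal.ofReal_le_ofReal h1).trans ?_
  rw [ofReal_integral_eq_lintegral_ofReal hf.pos_part (ae_of_all _ fun a => le_max_right _ _)]
  refine lintegral_mono fun a => ?_
  simp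

lemma exists_mem_Ioc_of_ae {p : ℝ → Prop} {a b : ℝ} (hab : a < b)
    (h : ∀ᵐ t : ℝ, t ∈ Ioc a b → p t) : ∃ t ∈ Ioc a b, p t := by
  have : (ae (volume.restrict (Ioc a b))).NeBot := by
    rw [ae_neBot]
    intro h0
    have := Measure.restrict_eq_zero.1 h0
    simp at this
    linarith
  have h' := (ae_restrict_iff' measurableSet_Ioc).2 h
  obtain ⟨t, h1, h2⟩ := (h'.and (ae_restrict_mem measurableSet_Ioc)).exists
  exact ⟨t, h2, h1⟩

namespace VorticityModes

variable {ν μ T₀ G : ℝ} {z g : ℝ → (Fin 2 → ℤ) → ℂ}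

lemma conv_int (h : VorticityModes L ν μ T₀ G z g) (n) {a b : ℝ} (ha : 0 ≤ a) (hab : a ≤ b) :
    IntervalIntegrable (fun t => conv L (z t) n) volume a b := by
  have hg : IntervalIntegrable (fun t => g t n) volume a b :=
    (h.force_int n b (ha.trans hab)).mono_set (by
      rw [uIcc_of_le hab, uIcc_of_le (ha.trans hab)]; exact Icc_subset_Icc ha le_rfl)
  have hz : IntervalIntegrable (fun t => -((ν * lam L n + μ : ℝ) : ℂ) * z t n) volume a b :=
    (continuous_const.mul (h.cont n)).intervalIntegrable _ _
  have e : (fun t => conv L (z t) n) = fun t =>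
      modeRhs L ν μ (z t) (g t) n - -((ν * lam L n + μ : ℝ) : ℂ) * z t n - g t n := by
    ext t; simp only [modeRhs]; ring
  rw [e]
  exact ((h.rhs_int' n ha hab).sub hz).sub hg

lemma aemeasurable_force (h : VorticityModes L ν μ T₀ G z g) (n) {a b : ℝ} (ha : 0 ≤ a)
    (hab : a ≤ b) : AEMeasurable (fun t => g t n) (volume.restrict (Ioc a b)) := by
  have hg : IntervalIntegrable (fun t => g t n) volume a b :=
    (h.force_int n b (ha.trans hab)).mono_set (by
      rw [uIcc_of_le hab, uIcc_of_le (ha.trans hab)]; exact Icc_subset_Icc ha le_rfl)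
  exact hg.1.aestronglyMeasurable.aemeasurable

lemma aemeasurable_conv (h : VorticityModes L ν μ T₀ G z g) (n) {a b : ℝ} (ha : 0 ≤ a)
    (hab : a ≤ b) : AEMeasurable (fun t => conv L (z t) n) (volume.restrict (Ioc a b)) :=
  (h.conv_int n ha hab).1.aestronglyMeasurable.aemeasurable

/-- The gain of regularity in a single mode of the heat equation. -/
lemma mode_smoothing (hL : ∀ i, 0 < L i) (hν : 0 < ν) (hμ : 0 < μ)
    (h : VorticityModes L ν μ T₀ G z g) (n) {a b : ℝ} (ha : 0 ≤ a) (hab : a ≤ b) :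
    ENNReal.ofReal (kap L n * ‖z b n‖ ^ 2) +
        ENNReal.ofReal ν * ∫⁻ t in Ioc a b, ENNReal.ofReal (kap L n ^ 3 * ‖z t n‖ ^ 2) ≤
      ENNReal.ofReal (kap L n * ‖z a n‖ ^ 2) + ENNReal.ofReal (2 / ν) * ∫⁻ t in Ioc a b,
        ENNReal.ofReal ((kap L n)⁻¹ * (‖g t n‖ ^ 2 + ‖conv L (z t) n‖ ^ 2)) := by
  by_cases hn : n = 0
  · subst hn
    simp [h.zero]
  have hk := kap_pos hL hn
  obtain ⟨hi, he⟩ := h.norm_sq_eq n ha hab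
  have hi2 : IntervalIntegrable (fun t => kap L n ^ 3 * ‖z t n‖ ^ 2) volume a b :=
    (continuous_const.mul ((h.cont n).norm.pow 2)).intervalIntegrable _ _
  have hi3 := (hi.const_mul (kap L n)).add (hi2.const_mul ν)
  have hpt : ∀ t, kap L n * (2 * (conj (z t n) * modeRhs L ν μ (z t) (g t) n).re) +
      ν * (kap L n ^ 3 * ‖z t n‖ ^ 2) ≤
      2 / ν * ((kap L n)⁻¹ * (‖g t n‖ ^ 2 + ‖conv L (z t) n‖ ^ 2)) := by
    intro t
    have e1 : (conj (z t n) * modeRhs L ν μ (z t) (g t) n).re =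
        -(ν * kap L n ^ 2 + μ) * ‖z t n‖ ^ 2 + (conj (z t n) * g t n).re +
          (conj (z t n) * conv L (z t) n).re := by
      have := Complex.conj_mul' (z t n)
      rw [kap_sq]
      have e : conj (z t n) * modeRhs L ν μ (z t) (g t) n =
          ((-(ν * lam L n + μ) * ‖z t n‖ ^ 2 : ℝ) : ℂ) + conj (z t n) * g t n +
            conj (z t n) * conv L (z t) n := by
        unfold modeRhs
        push_cast
        linear_combination (-((ν : ℂ) * lam L n + μ)) * this
      rw [e, Complex.add_re, Complex.add_re, Complex.ofReal_re]
    -- A quarter of the dissipation `2ν|κₙ|²|zₙ|²` absorbs each of the force and the transport term.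
    have key : ∀ w : ℂ, 2 * (conj (z t n) * w).re ≤
        ν * kap L n ^ 2 / 2 * ‖z t n‖ ^ 2 + 2 / ν * ((kap L n ^ 2)⁻¹ * ‖w‖ ^ 2) := by
      intro w
      have h1 := Complex.re_le_norm (conj (z t n) * w)
      rw [norm_mul, RCLike.norm_conj] at h1
      have h2 : 2 * (‖z t n‖ * ‖w‖) ≤
          ν * kap L n ^ 2 / 2 * ‖z t n‖ ^ 2 + 2 / ν * ((kap L n ^ 2)⁻¹ * ‖w‖ ^ 2) := by
        have h3 := sq_nonneg (ν * kap L n ^ 2 * ‖z t n‖ - 2 * ‖w‖)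
        have h4 : ν * kap L n ^ 2 / 2 * ‖z t n‖ ^ 2 + 2 / ν * ((kap L n ^ 2)⁻¹ * ‖w‖ ^ 2) -
            2 * (‖z t n‖ * ‖w‖) = (ν * kap L n ^ 2 * ‖z t n‖ - 2 * ‖w‖) ^ 2 /
              (2 * (ν * kap L n ^ 2)) := by
          field_simp
          ring
        have : 0 ≤ (ν * kap L n ^ 2 * ‖z t n‖ - 2 * ‖w‖) ^ 2 / (2 * (ν * kap L n ^ 2)) := by
          positivity
        linarith
      linarith
    have k1 := key (g t n)
    have k2 := key (conv L (z t) n)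
    have k3 : 0 ≤ μ * ‖z t n‖ ^ 2 := by positivity
    have hsum : 2 * (conj (z t n) * modeRhs L ν μ (z t) (g t) n).re +
        ν * kap L n ^ 2 * ‖z t n‖ ^ 2 ≤
        2 / ν * ((kap L n ^ 2)⁻¹ * (‖g t n‖ ^ 2 + ‖conv L (z t) n‖ ^ 2)) := by
      rw [e1]; linarith
    calc _ = kap L n * (2 * (conj (z t n) * modeRhs L ν μ (z t) (g t) n).re +
          ν * kap L n ^ 2 * ‖z t n‖ ^ 2) := by ring
      _ ≤ kap L n * (2 / ν * ((kap L n ^ 2)⁻¹ * (‖g t n‖ ^ 2 + ‖conv L (z t) n‖ ^ 2))) := by gcongr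
      _ = _ := by field_simp
  have hreal : kap L n * ‖z b n‖ ^ 2 + ν * ∫ t in Ioc a b, kap L n ^ 3 * ‖z t n‖ ^ 2 =
      kap L n * ‖z a n‖ ^ 2 + ∫ t in Ioc a b,
        (kap L n * (2 * (conj (z t n) * modeRhs L ν μ (z t) (g t) n).re) +
          ν * (kap L n ^ 3 * ‖z t n‖ ^ 2)) := by
    rw [← intervalIntegral.integral_of_le hab, ← intervalIntegral.integral_of_le hab,
      intervalIntegral.integral_add (hi.const_mul (kap L n)) (hi2.const_mul ν), he,
      intervalIntegral.integral_const_mul (kap L n)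
        (fun t => 2 * (conj (z t n) * modeRhs L ν μ (z t) (g t) n).re),
      intervalIntegral.integral_const_mul ν (fun t => kap L n ^ 3 * ‖z t n‖ ^ 2)]
    ring
  rw [intervalIntegrable_iff_integrableOn_Ioc_of_le hab] at hi2 hi3
  have hnn : 0 ≤ ∫ t in Ioc a b, kap L n ^ 3 * ‖z t n‖ ^ 2 := integral_nonneg fun t => by positivity
  rw [← ofReal_integral_eq_lintegral_ofReal hi2 (ae_of_all _ fun t => by positivity),
    ← ENNReal.ofReal_mul hν.le, ← ENNReal.ofReal_add (by positivity) (by positivity), hreal]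
  refine ENNReal.ofReal_add_le.trans (add_le_add le_rfl ?_)
  refine (ofReal_integral_le_lintegral hi3).trans ?_
  rw [← lintegral_const_mul' _ _ ENNReal.ofReal_ne_top]
  refine lintegral_mono fun t => ?_
  rw [← ENNReal.ofReal_mul (by positivity)]
  exact ENNReal.ofReal_le_ofReal (hpt t)

lemma aemeasurable_term (h : VorticityModes L ν μ T₀ G z g) (c : ℝ) (n) (m : Measure ℝ) :
    AEMeasurable (fun t => ENNReal.ofReal (c * ‖z t n‖ ^ 2)) m :=
  (ENNReal.measurable_ofReal.comp
    (measurable_const.mul ((h.cont n).norm.pow 2).measurable)).aemeasurable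

/-- One half of a derivative is gained over the enstrophy. -/
lemma half_derivative_bound (hL : ∀ i, 0 < L i) (hν : 0 < ν) (hμ : 0 < μ)
    (h : VorticityModes L ν μ T₀ G z g)
    {t₀ T : ℝ} (ht₀ : T₀ ≤ t₀) (hT : t₀ ≤ T) (hz : Summable fun n => ‖z t₀ n‖ ^ 2)
    (hz1 : ∑' n, ENNReal.ofReal (lam L n * ‖z t₀ n‖ ^ 2) ≠ ⊤) :
    ∃ K ≠ (⊤ : ℝ≥0∞), (∀ t ∈ Icc t₀ T, ∑' n, ENNReal.ofReal (kap L n * ‖z t n‖ ^ 2) ≤ K) ∧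
      ∫⁻ t in Ioc t₀ T, ∑' n, ENNReal.ofReal (kap L n ^ 3 * ‖z t n‖ ^ 2) ≤ K := by
  have h00 : 0 ≤ t₀ := h.nonneg.trans ht₀
  obtain ⟨K, hK, hK1, hK2⟩ := h.enstrophy_bound hL hν hμ ht₀ hT hz
  obtain ⟨c, hc, hck⟩ := exists_le_kap hL
  have hkn := kap_nonneg (L := L)
  set S := ∑' k : Fin 2 → ℤ, ENNReal.ofReal (kap L k ^ 3)⁻¹ with hS
  have hSfin : S ≠ ⊤ := by
    rw [hS, ← ENNReal.ofReal_tsum_of_nonneg (fun n => by have := hkn n; positivity)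
      (summable_kap_inv_pow_three hL)]
    exact ENNReal.ofReal_ne_top
  have hstart : ∑' n, ENNReal.ofReal (kap L n * ‖z t₀ n‖ ^ 2) ≠ ⊤ := by
    have hle : ∀ n, ENNReal.ofReal (kap L n * ‖z t₀ n‖ ^ 2) ≤
        ENNReal.ofReal (‖z t₀ n‖ ^ 2) + ENNReal.ofReal (lam L n * ‖z t₀ n‖ ^ 2) := fun n => by
      have := lam_nonneg (L := L) n
      rw [← ENNReal.ofReal_add (by positivity) (by positivity)]
      refine ENNReal.ofReal_le_ofReal ?_
      rw [← kap_sq, ← one_add_mul]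
      gcongr
      nlinarith [sq_nonneg (kap L n - 1)]
    refine ne_top_of_le_ne_top ?_ (ENNReal.tsum_le_tsum hle)
    rw [ENNReal.tsum_add, ofReal_enst hz]
    exact ENNReal.add_ne_top.2 ⟨ENNReal.ofReal_ne_top, hz1⟩
  have hpt : ∀ᵐ s : ℝ, s ∈ Ioc t₀ T →
      ∑' n, ENNReal.ofReal ((kap L n)⁻¹ * (‖g s n‖ ^ 2 + ‖conv L (z s) n‖ ^ 2)) ≤
        ENNReal.ofReal c⁻¹ * ENNReal.ofReal (G ^ 2) + ENNReal.ofReal K *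
          (∑' m, ENNReal.ofReal (lam L m * ‖z s m‖ ^ 2)) * (2 * S) := by
    filter_upwards [h.force] with s hs hsm
    have e : ∀ n, ENNReal.ofReal ((kap L n)⁻¹ * (‖g s n‖ ^ 2 + ‖conv L (z s) n‖ ^ 2)) ≤
        ENNReal.ofReal c⁻¹ * ENNReal.ofReal (‖g s n‖ ^ 2) +
          ENNReal.ofReal ((kap L n)⁻¹ * ‖conv L (z s) n‖ ^ 2) := fun n => by
      have := hkn n
      rw [← ENNReal.ofReal_mul (by positivity),
        ← ENNReal.ofReal_add (by positivity) (by positivity)]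
      refine ENNReal.ofReal_le_ofReal ?_
      rw [mul_add]
      refine add_le_add (mul_le_mul_of_nonneg_right ?_ (sq_nonneg _)) le_rfl
      by_cases hn : n = 0
      · subst hn; simp [kap]; positivity
      · exact inv_anti₀ hc (hck n hn)
    refine (ENNReal.tsum_le_tsum e).trans ?_
    rw [ENNReal.tsum_add, ENNReal.tsum_mul_left]
    gcongr
    · exact hs (ht₀.trans hsm.1.le)
    · refine (tsum_conv_sq_le (z s)).trans ?_
      gcongr
      exact hK1 s (Ioc_subset_Icc_self hsm)
  have hXm : Measurable fun s => ∑' m, ENNReal.ofReal (lam L m * ‖z s m‖ ^ 2) :=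
    h.measurable_tsum (lam L)
  set J := ∫⁻ s in Ioc t₀ T,
    ∑' n, ENNReal.ofReal ((kap L n)⁻¹ * (‖g s n‖ ^ 2 + ‖conv L (z s) n‖ ^ 2)) with hJ
  have hJfin : J ≠ ⊤ := by
    refine ne_top_of_le_ne_top ?_ (lintegral_mono_ae ((ae_restrict_iff' measurableSet_Ioc).2 hpt))
    rw [lintegral_add_left measurable_const, lintegral_mul_const _ (hXm.const_mul _),
      lintegral_const_mul _ hXm, lintegral_const, Measure.restrict_apply_univ, Real.volume_Ioc]
    exact ENNReal.add_ne_top.2 ⟨ENNReal.mul_ne_top (ENNReal.mul_ne_top ENNReal.ofReal_ne_top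
      ENNReal.ofReal_ne_top) ENNReal.ofReal_ne_top, ENNReal.mul_ne_top (ENNReal.mul_ne_top
      ENNReal.ofReal_ne_top (ne_top_of_le_ne_top ENNReal.ofReal_ne_top hK2))
      (ENNReal.mul_ne_top ENNReal.ofNat_ne_top hSfin)⟩
  set M := ∑' n, ENNReal.ofReal (kap L n * ‖z t₀ n‖ ^ 2) + ENNReal.ofReal (2 / ν) * J with hM
  have hMfin : M ≠ ⊤ :=
      ENNReal.add_ne_top.2 ⟨hstart, ENNReal.mul_ne_top ENNReal.ofReal_ne_top hJfin⟩
  have hmain : ∀ t ∈ Icc t₀ T, ∑' n, ENNReal.ofReal (kap L n * ‖z t n‖ ^ 2) +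
      ENNReal.ofReal ν * ∫⁻ s in Ioc t₀ t, ∑' n, ENNReal.ofReal (kap L n ^ 3 * ‖z s n‖ ^ 2) ≤
      M := by
    intro t ht
    have h1 := ENNReal.tsum_le_tsum fun n => h.mode_smoothing hL hν hμ n h00 ht.1
    rw [ENNReal.tsum_add, ENNReal.tsum_add, ENNReal.tsum_mul_left, ENNReal.tsum_mul_left,
      ← lintegral_tsum fun n => h.aemeasurable_term _ n _, ← lintegral_tsum fun n => ?_] at h1
    · refine h1.trans ?_
      rw [hM]
      gcongr
      exact lintegral_mono_set (Ioc_subset_Ioc le_rfl ht.2)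
    · exact (((h.aemeasurable_force n h00 ht.1).norm.pow_const 2).add
        ((h.aemeasurable_conv n h00 ht.1).norm.pow_const 2)).const_mul _ |>.ennreal_ofReal
  have hν' : ENNReal.ofReal ν ≠ 0 := by simpa using hν
  refine ⟨M + M / ENNReal.ofReal ν, ENNReal.add_ne_top.2 ⟨hMfin, ENNReal.div_ne_top hMfin hν'⟩,
    fun t ht => (le_self_add.trans (hmain t ht)).trans le_self_add, le_trans ?_ le_add_self⟩
  rw [ENNReal.le_div_iff_mul_le (Or.inl hν') (Or.inl ENNReal.ofReal_ne_top), mul_comm]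
  exact le_add_self.trans (hmain T ⟨hT, le_rfl⟩)

/-- From some time on the vorticity has enough regularity for the velocity to be bounded and the
transport term to be square integrable. At that time the Fourier series of the vorticity converges
absolutely. -/
theorem exists_regular_time (hL : ∀ i, 0 < L i) (hν : 0 < ν) (hμ : 0 < μ)
    (h : VorticityModes L ν μ T₀ G z g) :
    ∃ t₂, T₀ ≤ t₂ ∧ (Summable fun n => ‖z t₂ n‖) ∧ ∀ T, t₂ ≤ T → ∃ K ≠ (⊤ : ℝ≥0∞),
      (∀ t ∈ Icc t₂ T, ∑' n, ENNReal.ofReal (‖z t n‖ ^ 2) ≤ K ∧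
        ∑' n, ENNReal.ofReal (‖z t n‖ / kap L n) ≤ K) ∧
      ∫⁻ t in Ioc t₂ T, ∑' n, ENNReal.ofReal (lam L n * ‖z t n‖ ^ 2) ≤ K := by
  have hkn := kap_nonneg (L := L)
  set S := ∑' k : Fin 2 → ℤ, ENNReal.ofReal (kap L k ^ 3)⁻¹ with hS
  have hSfin : S ≠ ⊤ := by
    rw [hS, ← ENNReal.ofReal_tsum_of_nonneg (fun n => by have := hkn n; positivity)
      (summable_kap_inv_pow_three hL)]
    exact ENNReal.ofReal_ne_top
  -- At almost every time the vorticity is in `L²`.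
  obtain ⟨t₀, ht₀, hz₀⟩ := exists_mem_Ioc_of_ae (a := T₀) (b := T₀ + 1) (by linarith)
    (h.ae_summable.mono fun t ht htm => ht (h.nonneg.trans_lt htm.1))
  have h0 : 0 ≤ t₀ := h.nonneg.trans ht₀.1.le
  obtain ⟨K₁, -, -, hK₁⟩ := h.enstrophy_bound hL hν hμ ht₀.1.le (by linarith : t₀ ≤ t₀ + 1) hz₀
  -- The dissipation is integrable after `t₀`, so that the vorticity is in `H¹` at some later time.
  obtain ⟨t₁, ht₁, hz₁, hz₁'⟩ := exists_mem_Ioc_of_ae (a := t₀) (b := t₀ + 1) (by linarith)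
    (p := fun t => (Summable fun n => ‖z t n‖ ^ 2) ∧
      ∑' n, ENNReal.ofReal (lam L n * ‖z t n‖ ^ 2) ≠ ⊤) (by
      have h2 := ae_lt_top (h.measurable_tsum (lam L))
        (hK₁.trans_lt ENNReal.ofReal_lt_top).ne
      rw [ae_restrict_iff' measurableSet_Ioc] at h2
      filter_upwards [h.ae_summable, h2] with t h3 h4 htm
      exact ⟨h3 (h0.trans_lt htm.1), (h4 htm).ne⟩)
  have hT₁ : T₀ ≤ t₁ := ht₀.1.le.trans ht₁.1.le
  have h1 : 0 ≤ t₁ := h.nonneg.trans hT₁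
  obtain ⟨K₂, hK₂, -, hK₂'⟩ :=
    h.half_derivative_bound hL hν hμ hT₁ (by linarith : t₁ ≤ t₁ + 1) hz₁ hz₁'
  -- In the same way the gain of half a derivative gives a time with vorticity in `H^{3/2}`.
  obtain ⟨t₂, ht₂, hz₂, hz₂'⟩ := exists_mem_Ioc_of_ae (a := t₁) (b := t₁ + 1) (by linarith)
    (p := fun t => (Summable fun n => ‖z t n‖ ^ 2) ∧
      ∑' n, ENNReal.ofReal (kap L n ^ 3 * ‖z t n‖ ^ 2) ≠ ⊤) (by
      have h2 := ae_lt_top (h.measurable_tsum fun n => kap L n ^ 3)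
        (ne_top_of_le_ne_top hK₂ hK₂')
      rw [ae_restrict_iff' measurableSet_Ioc] at h2
      filter_upwards [h.ae_summable, h2] with t h3 h4 htm
      exact ⟨h3 (h1.trans_lt htm.1), (h4 htm).ne⟩)
  refine ⟨t₂, hT₁.trans ht₂.1.le, ?_, fun T hT => ?_⟩
  -- `|z| ≤ |κ|³|z|² + |κ|⁻³`, and the series `∑ |κₙ|⁻³` converges in the plane.
  · have hle : ∀ n, ENNReal.ofReal ‖z t₂ n‖ ≤
        ENNReal.ofReal (kap L n ^ 3 * ‖z t₂ n‖ ^ 2) + ENNReal.ofReal (kap L n ^ 3)⁻¹ := fun n => by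
      have := hkn n
      rw [← ENNReal.ofReal_add (by positivity) (by positivity)]
      refine ENNReal.ofReal_le_ofReal ?_
      by_cases hn : n = 0
      · subst hn; simp [h.zero]; positivity
      have hp : 0 < kap L n := kap_pos hL hn
      rw [← sub_nonneg]
      have e : kap L n ^ 3 * ‖z t₂ n‖ ^ 2 + (kap L n ^ 3)⁻¹ - ‖z t₂ n‖ =
          ((kap L n ^ 3 * ‖z t₂ n‖ - 1) ^ 2 + kap L n ^ 3 * ‖z t₂ n‖) / kap L n ^ 3 := by
        field_simp
        ring
      rw [e]
      positivity
    have hfin : ∑' n, ENNReal.ofReal ‖z t₂ n‖ ≠ ⊤ := by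
      refine ne_top_of_le_ne_top ?_ (ENNReal.tsum_le_tsum hle)
      rw [ENNReal.tsum_add]
      exact ENNReal.add_ne_top.2 ⟨hz₂', hSfin⟩
    simpa [ENNReal.toReal_ofReal] using ENNReal.summable_toReal hfin
  · obtain ⟨K₃, -, hK₃, hK₃'⟩ := h.enstrophy_bound hL hν hμ hT₁ (ht₂.1.le.trans hT) hz₁
    obtain ⟨K₄, hK₄, hK₄', -⟩ :=
      h.half_derivative_bound hL hν hμ hT₁ (ht₂.1.le.trans hT) hz₁ hz₁'
    refine ⟨ENNReal.ofReal K₃ + (K₄ + S), ENNReal.add_ne_top.2 ⟨ENNReal.ofReal_ne_top,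
      ENNReal.add_ne_top.2 ⟨hK₄, hSfin⟩⟩, fun t ht => ⟨?_, ?_⟩, ?_⟩
    · exact (hK₃ t ⟨ht₂.1.le.trans ht.1, ht.2⟩).trans le_self_add
    · refine le_trans ?_ le_add_self
      have hle : ∀ n, ENNReal.ofReal (‖z t n‖ / kap L n) ≤
          ENNReal.ofReal (kap L n * ‖z t n‖ ^ 2) + ENNReal.ofReal (kap L n ^ 3)⁻¹ := fun n => by
        have := hkn n
        rw [← ENNReal.ofReal_add (by positivity) (by positivity)]
        refine ENNReal.ofReal_le_ofReal ?_
        by_cases hn : n = 0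
        · subst hn; simp [h.zero]; positivity
        have hp : 0 < kap L n := kap_pos hL hn
        rw [← sub_nonneg]
        have e : kap L n * ‖z t n‖ ^ 2 + (kap L n ^ 3)⁻¹ - ‖z t n‖ / kap L n =
            ((kap L n ^ 2 * ‖z t n‖ - 1) ^ 2 + kap L n ^ 2 * ‖z t n‖) / kap L n ^ 3 := by
          field_simp
          ring
        rw [e]
        positivity
      refine (ENNReal.tsum_le_tsum hle).trans ?_
      rw [ENNReal.tsum_add]
      gcongr
      exact hK₄' t ⟨ht₂.1.le.trans ht.1, ht.2⟩
    · exact ((lintegral_mono_set (Ioc_subset_Ioc ht₂.1.le le_rfl)).trans hK₃').trans le_self_add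

end VorticityModes

/-! ### Fourier series on the period cell -/

section Torus

attribute [local instance] instMeasureSpaceUnitAddCircle

/-- The exponential `exp (i κₙ · x)`. -/
def expo (L : Plane) (n : Fin 2 → ℤ) (x : Plane) : ℂ :=
  Complex.exp (Complex.I * ((freq L n 0 * x 0 + freq L n 1 * x 1 : ℝ) : ℂ))

/-- The Fourier coefficient of `g` on the period cell. -/
def fc (L : Plane) (g : Plane → ℂ) (n : Fin 2 → ℤ) : ℂ :=
  ((L 0 * L 1)⁻¹ : ℝ) * ∫ x in cell L, conj (expo L n x) * g x

/-- Lebesgue measure on the period cell. -/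
abbrev cellMeas (L : Plane) : Measure Plane := volume.restrict (cell L)

/-- The parametrization of the period cell by the standard torus. -/
def section₀ (L : Plane) (y : UnitAddTorus (Fin 2)) : Plane := fun i =>
  L i * ((UnitAddTorus.measurableEquivPiIoc (0 : Fin 2 → ℝ) y).1 i)

/-- The projection of the plane onto the standard torus. -/
def proj₀ (L : Plane) (x : Plane) : UnitAddTorus (Fin 2) :=
  fun i => ((x i / L i : ℝ) : UnitAddCircle)

lemma measurable_section₀ : Measurable (section₀ L) := by
  refine measurable_pi_lambda _ fun i => ?_
  refine Measurable.const_mul ?_ _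
  exact (measurable_pi_apply i).comp (measurable_subtype_coe.comp
    (UnitAddTorus.measurableEquivPiIoc (0 : Fin 2 → ℝ)).measurable)

lemma measurable_proj₀ : Measurable (proj₀ L) :=
  measurable_pi_lambda _ fun i => AddCircle.measurable_mk'.comp
    ((measurable_pi_apply i).div_const _)

lemma proj₀_section₀ (hL : ∀ i, 0 < L i) (y) : proj₀ L (section₀ L y) = y := by
  ext i
  simp only [proj₀, section₀]
  rw [mul_div_cancel_left₀ _ (hL i).ne']
  have := (UnitAddTorus.measurableEquivPiIoc (0 : Fin 2 → ℝ)).symm_apply_apply y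
  rw [UnitAddTorus.coe_symm_measurableEquivPiIoc_apply] at this
  exact congrFun this i

lemma map_scale (hL : ∀ i, 0 < L i) :
    Measure.map (fun (x : Plane) i => L i * x i)
      (volume.restrict {x : Plane | ∀ i, x i ∈ Ioc (0 : ℝ) 1}) =
      ENNReal.ofReal (L 0 * L 1)⁻¹ • cellMeas L := by
  have h0 := hL 0
  have h1 := hL 1
  have hdet : (Matrix.diagonal L).det = L 0 * L 1 := by simp [Matrix.det_diagonal]
  have hs := Real.smul_map_diagonal_volume_pi (D := L) (by rw [hdet]; positivity)
  rw [hdet, abs_of_pos (by positivity)] at hs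
  have hfun : (⇑(Matrix.toLin' (Matrix.diagonal L)) : Plane → Plane) = fun x i => L i * x i := by
    ext x i
    simp [Matrix.toLin'_apply, Matrix.mulVec_diagonal]
  rw [hfun] at hs
  have hm : Measurable fun (x : Plane) i => L i * x i := by fun_prop
  set B : Set Plane := univ.pi fun i => Ioc (0 : ℝ) (L i) with hB
  have hBm : MeasurableSet B := MeasurableSet.univ_pi fun i => measurableSet_Ioc
  have hpre : (fun (x : Plane) i => L i * x i) ⁻¹' B = {x : Plane | ∀ i, x i ∈ Ioc (0 : ℝ) 1} := by
    ext x
    simp only [hB, mem_preimage, Set.mem_pi, mem_univ, true_imp_iff, Set.mem_ofPred_eq, mem_Ioc]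
    refine forall_congr' fun i => ?_
    have := hL i
    refine and_congr ⟨fun h => (mul_pos_iff_of_pos_left this).1 h, fun h => mul_pos this h⟩ ?_
    exact ⟨fun h => le_of_mul_le_mul_left (by simpa using h) this, fun h => by nlinarith⟩
  rw [← hpre, ← Measure.restrict_map hm hBm]
  have hBcell : volume.restrict B = cellMeas L :=
    Measure.restrict_congr_set (Measure.univ_pi_Ioc_ae_eq_Icc (f := (0 : Plane)) (g := L))
  rw [← hBcell]
  conv_rhs => rw [← hs]
  rw [Measure.restrict_smul, smul_smul, ← ENNReal.ofReal_mul (by positivity),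
    inv_mul_cancel₀ (by positivity)]
  simp

/-- Up to normalization, the measure of the standard torus becomes that of the period cell. -/
lemma map_section₀ (hL : ∀ i, 0 < L i) :
    Measure.map (section₀ L) (volume : Measure (UnitAddTorus (Fin 2))) =
      ENNReal.ofReal (L 0 * L 1)⁻¹ • cellMeas L := by
  have hmp := UnitAddTorus.measurePreserving_equivPiIoc (0 : Fin 2 → ℝ)
  have hm : Measurable fun (x : Plane) i => L i * x i := by fun_prop
  have e : section₀ L = (fun (x : Plane) i => L i * x i) ∘
      (Subtype.val ∘ (UnitAddTorus.measurableEquivPiIoc (0 : Fin 2 → ℝ))) := rfl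
  rw [e, ← Measure.map_map hm (measurable_subtype_coe.comp hmp.measurable),
    ← Measure.map_map measurable_subtype_coe hmp.measurable, hmp.map_eq, ← map_scale hL]
  congr 1
  have h := map_comap_subtype_coe (MeasurableSet.univ_pi' fun i : Fin 2 =>
    measurableSet_Ioc (a := (0 : ℝ)) (b := 0 + 1)) (volume : Measure Plane)
  simp only [zero_add] at h
  rw [← h]
  simp only [Pi.zero_apply]
  rfl

lemma integral_section₀ (hL : ∀ i, 0 < L i) {G : Plane → ℂ}
    (hG : AEStronglyMeasurable G (cellMeas L)) :
    ∫ y, G (section₀ L y) = ((L 0 * L 1)⁻¹ : ℝ) * ∫ x in cell L, G x := by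
  have h0 := hL 0
  have h1 := hL 1
  have hG' : AEStronglyMeasurable G (Measure.map (section₀ L) volume) := by
    rw [map_section₀ hL]; exact hG.smul_measure _
  rw [← integral_map measurable_section₀.aemeasurable hG', map_section₀ hL, integral_smul_measure,
    ENNReal.toReal_ofReal (by positivity), Complex.real_smul]

lemma memLp_section₀ (hL : ∀ i, 0 < L i) {G : Plane → ℂ} (hG : MemLp G 2 (cellMeas L)) :
    MemLp (G ∘ section₀ L) 2 (volume : Measure (UnitAddTorus (Fin 2))) := by
  have h : MemLp G 2 (Measure.map (section₀ L) volume) := by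
    rw [map_section₀ hL]; exact hG.smul_measure ENNReal.ofReal_ne_top
  exact (memLp_map_measure_iff h.1 measurable_section₀.aemeasurable).1 h

lemma expo_section₀ (hL : ∀ i, 0 < L i) (n y) :
    expo L n (section₀ L y) = UnitAddTorus.mFourier n y := by
  have h0 := (hL 0).ne'
  have h1 := (hL 1).ne'
  conv_rhs => rw [← proj₀_section₀ hL y]
  set x := section₀ L y
  simp only [UnitAddTorus.mFourier, ContinuousMap.coe_mk, Fin.prod_univ_two, proj₀,
    fourier_coe_apply, expo, freq]
  rw [← Complex.exp_add]
  congr 1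
  push_cast
  have h0' : (L 0 : ℂ) ≠ 0 := by exact_mod_cast h0
  have h1' : (L 1 : ℂ) ≠ 0 := by exact_mod_cast h1
  field_simp

@[fun_prop] lemma continuous_expo (n) : Continuous (expo L n) := by
  unfold expo; fun_prop

@[simp] lemma norm_expo (n x) : ‖expo L n x‖ = 1 := by
  rw [expo, mul_comm, Complex.norm_exp_ofReal_mul_I]

lemma conj_expo (n x) : conj (expo L n x) = expo L (-n) x := by
  unfold expo
  rw [← Complex.exp_conj]
  congr 1
  simp only [map_mul, Complex.conj_I, Complex.conj_ofReal, freq_neg]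
  push_cast; ring

lemma expo_add (n m x) : expo L (n + m) x = expo L n x * expo L m x := by
  unfold expo
  rw [← Complex.exp_add]
  congr 1
  simp only [freq_add]
  push_cast; ring

@[simp] lemma expo_zero (x) : expo L 0 x = 1 := by simp [expo]

instance : IsFiniteMeasure (cellMeas L) := by
  unfold cellMeas cell
  exact ⟨by rw [Measure.restrict_apply_univ]; exact isCompact_Icc.measure_lt_top⟩

lemma mFourierCoeff_section₀ (hL : ∀ i, 0 < L i) {G : Plane → ℂ} (hG : MemLp G 2 (cellMeas L)) (n) :
    UnitAddTorus.mFourierCoeff ((memLp_section₀ hL hG).toLp (G ∘ section₀ L)) n = fc L G n := by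
  rw [UnitAddTorus.mFourierCoeff, fc,
    ← integral_section₀ hL (G := fun x => conj (expo L n x) * G x)]
  · refine integral_congr_ae ?_
    filter_upwards [(memLp_section₀ hL hG).coeFn_toLp] with y hy
    rw [hy, UnitAddTorus.mFourier_neg, expo_section₀ hL]
    rfl
  · exact ((continuous_expo n).star.aestronglyMeasurable).mul hG.1

/-- Parseval's identity on the period cell. -/
theorem hasSum_conj_fc_mul_fc (hL : ∀ i, 0 < L i) {g h : Plane → ℂ} (hg : MemLp g 2 (cellMeas L))
    (hh : MemLp h 2 (cellMeas L)) :
    HasSum (fun n => conj (fc L g n) * fc L h n)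
      (((L 0 * L 1)⁻¹ : ℝ) * ∫ x in cell L, conj (g x) * h x) := by
  have := UnitAddTorus.hasSum_prod_mFourierCoeff ((memLp_section₀ hL hg).toLp (g ∘ section₀ L))
    ((memLp_section₀ hL hh).toLp (h ∘ section₀ L))
  have e : (fun n => conj (fc L g n) * fc L h n) = fun n =>
      conj (UnitAddTorus.mFourierCoeff ((memLp_section₀ hL hg).toLp (g ∘ section₀ L)) n) *
        UnitAddTorus.mFourierCoeff ((memLp_section₀ hL hh).toLp (h ∘ section₀ L)) n := by
    ext n
    rw [mFourierCoeff_section₀ hL hg, mFourierCoeff_section₀ hL hh]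
  rw [e]
  convert this using 1
  rw [← integral_section₀ hL (G := fun x => conj (g x) * h x)
    ((Complex.continuous_conj.comp_aestronglyMeasurable hg.1).mul hh.1)]
  refine integral_congr_ae ?_
  filter_upwards [(memLp_section₀ hL hg).coeFn_toLp, (memLp_section₀ hL hh).coeFn_toLp] with y h1 h2
  rw [h1, h2]
  rfl

/-- The Riesz-Fischer theorem on the period cell. -/
theorem exists_fc_eq (hL : ∀ i, 0 < L i) {c : (Fin 2 → ℤ) → ℂ} (hc : Summable fun n => ‖c n‖ ^ 2) :
    ∃ g : Plane → ℂ, MemLp g 2 (cellMeas L) ∧ ∀ n, fc L g n = c n := by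
  have h0 := hL 0
  have h1 := hL 1
  have hmem : Memℓp c 2 := memℓp_gen (by simpa using hc)
  set G := (UnitAddTorus.mFourierBasis (d := Fin 2)).repr.symm ⟨c, hmem⟩ with hG
  have hcoef : ∀ n, UnitAddTorus.mFourierCoeff G n = c n := by
    intro n
    rw [← UnitAddTorus.mFourierBasis_repr, hG, LinearIsometryEquiv.apply_symm_apply]
  have hGm : StronglyMeasurable (G : UnitAddTorus (Fin 2) → ℂ) := Lp.stronglyMeasurable G
  set g : Plane → ℂ := fun x => G (proj₀ L x) with hg
  have hgm : StronglyMeasurable g := hGm.comp_measurable measurable_proj₀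
  have hgs : g ∘ section₀ L = G := by
    ext y; simp only [hg, Function.comp, proj₀_section₀ hL]
  have hgL : MemLp g 2 (cellMeas L) := by
    have h2 : MemLp g 2 (Measure.map (section₀ L) volume) := by
      rw [memLp_map_measure_iff hgm.aestronglyMeasurable measurable_section₀.aemeasurable, hgs]
      exact Lp.memLp G
    rw [map_section₀ hL] at h2
    have h3 := h2.smul_measure (c := ENNReal.ofReal (L 0 * L 1)) ENNReal.ofReal_ne_top
    rw [smul_smul, ← ENNReal.ofReal_mul (by positivity), mul_inv_cancel₀ (by positivity)] at h3
    simpa using h3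
  refine ⟨g, hgL, fun n => ?_⟩
  rw [← mFourierCoeff_section₀ hL hgL, ← hcoef n, UnitAddTorus.mFourierCoeff,
    UnitAddTorus.mFourierCoeff]
  refine integral_congr_ae ?_
  filter_upwards [(memLp_section₀ hL hgL).coeFn_toLp] with y hy
  rw [hy, hgs]

end Torus

/-! ### Integration by parts on the period cell -/

/-- The integral over the period cell of a derivative of a periodic function vanishes. -/
lemma integral_pd_eq_zero (hL : ∀ i, 0 < L i) {G : Plane → ℝ} (hG : ContDiff ℝ 1 G)
    (hp : IsPeriodic L G) (i : Fin 2) : ∫ x in cell L, pd i G x = 0 := by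
  have hd : ∀ x, HasFDerivAt G (fderiv ℝ G x) x := fun x =>
    (hG.differentiable (by norm_num)).differentiableAt.hasFDerivAt
  have hfd : Continuous (fderiv ℝ G) := hG.continuous_fderiv (by norm_num)
  set f : Plane → Fin 2 → ℝ := fun x j => if j = i then G x else 0 with hf
  set f' : Plane → Plane →L[ℝ] (Fin 2 → ℝ) := fun x =>
    ContinuousLinearMap.pi fun j => if j = i then fderiv ℝ G x else 0 with hf'
  have hsum : ∀ x, ∑ j, (f' x) (Pi.single j 1) j = pd i G x := by
    intro x
    simp only [hf', ContinuousLinearMap.coe_pi', pd]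
    rw [Finset.sum_eq_single i]
    · simp
    · intro j _ hj; simp [hj]
    · simp
  have hdiv := integral_divergence_of_hasFDerivAt_off_countable (n := 1) (0 : Plane) L
    (fun j => (hL j).le) f f' ∅ countable_empty
    (by
      refine (continuous_pi fun j => ?_).continuousOn
      by_cases h : j = i
      · simp only [hf, h, if_true]; exact hG.continuous
      · simp only [hf, h, if_false]; exact continuous_const)
    (fun x _ => by
      rw [hasFDerivAt_pi']
      intro j
      by_cases h : j = i
      · have e1 : (fun y => f y j) = G := by ext y; simp [hf, h]
        have e2 : (ContinuousLinearMap.proj j).comp (f' x) = fderiv ℝ G x := by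
          ext y; simp [hf', h]
        rw [e1, e2]; exact hd x
      · have e1 : (fun y => f y j) = fun _ => (0 : ℝ) := by ext y; simp [hf, h]
        have e2 : (ContinuousLinearMap.proj j).comp (f' x) = (0 : Plane →L[ℝ] ℝ) := by
          ext y; simp [hf', h]
        rw [e1, e2]; exact hasFDerivAt_const _ _)
    (by
      simp only [hsum]
      exact (hfd.clm_apply continuous_const).continuousOn.integrableOn_compact isCompact_Icc)
  simp only [hsum] at hdiv
  rw [cell, hdiv]
  refine Finset.sum_eq_zero fun j _ => ?_
  rw [sub_eq_zero]
  congr 1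
  ext x
  by_cases h : j = i
  · subst h
    simp only [hf, if_true]
    rw [← hp j (j.insertNth ((0 : Plane) j) x)]
    congr 1
    ext k
    refine Fin.succAboveCases j ?_ (fun k => ?_) k
    · simp
    · simp
  · simp [hf, h]

/-! ### Weak derivatives on the Fourier side -/

/-- The phase `κₙ · x`. -/
def phase (L : Plane) (n : Fin 2 → ℤ) (x : Plane) : ℝ := freq L n 0 * x 0 + freq L n 1 * x 1

lemma contDiff_phase (n) {k : WithTop ℕ∞} : ContDiff ℝ k (phase L n) := by
  unfold phase; fun_prop

lemma phase_add_single (hL : ∀ i, 0 < L i) (n : Fin 2 → ℤ) (i x) :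
    phase L n (x + Pi.single i (L i)) = phase L n x + n i * (2 * Real.pi) := by
  have hi := (hL i).ne'
  unfold phase freq
  fin_cases i
  · simp at hi ⊢; field_simp; ring
  · simp at hi ⊢; field_simp; ring

lemma hasFDerivAt_phase (n) (x : Plane) :
    HasFDerivAt (phase L n) (freq L n 0 • (ContinuousLinearMap.proj 0 : Plane →L[ℝ] ℝ) +
      freq L n 1 • (ContinuousLinearMap.proj 1 : Plane →L[ℝ] ℝ)) x := by
  have h0 : HasFDerivAt (fun x : Plane => x 0) (ContinuousLinearMap.proj 0 : Plane →L[ℝ] ℝ) x :=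
    hasFDerivAt_apply 0 x
  have h1 : HasFDerivAt (fun x : Plane => x 1) (ContinuousLinearMap.proj 1 : Plane →L[ℝ] ℝ) x :=
    hasFDerivAt_apply 1 x
  exact (h0.const_mul _).add (h1.const_mul _)

lemma pd_comp_phase (n i) {φ φ' : ℝ → ℝ} (hφ : ∀ s, HasDerivAt φ (φ' s) s) (x : Plane) :
    pd i (fun x => φ (phase L n x)) x = freq L n i * φ' (phase L n x) := by
  have := (hφ (phase L n x)).comp_hasFDerivAt x (hasFDerivAt_phase n x)
  change fderiv ℝ (φ ∘ phase L n) x _ = _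
  rw [this.fderiv]
  fin_cases i <;> simp <;> ring

lemma isTest_cos (hL : ∀ i, 0 < L i) (n) : IsTest L fun x => Real.cos (phase L n x) where
  smooth := Real.contDiff_cos.comp (contDiff_phase n)
  periodic := fun i x => by
    beta_reduce
    rw [phase_add_single hL, Real.cos_add_int_mul_two_pi]

lemma isTest_sin (hL : ∀ i, 0 < L i) (n) : IsTest L fun x => Real.sin (phase L n x) where
  smooth := Real.contDiff_sin.comp (contDiff_phase n)
  periodic := fun i x => by
    beta_reduce
    rw [phase_add_single hL, Real.sin_add_int_mul_two_pi]

lemma pd_cos (n i x) : pd i (fun x => Real.cos (phase L n x)) x =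
    -(freq L n i * Real.sin (phase L n x)) := by
  rw [pd_comp_phase n i Real.hasDerivAt_cos]; ring

lemma pd_sin (n i x) : pd i (fun x => Real.sin (phase L n x)) x =
    freq L n i * Real.cos (phase L n x) :=
  pd_comp_phase n i Real.hasDerivAt_sin x

lemma expo_eq (n x) : expo L n x =
    (Real.cos (phase L n x) : ℂ) + Complex.I * (Real.sin (phase L n x) : ℂ) := by
  rw [expo, mul_comm, Complex.exp_mul_I, Complex.ofReal_cos, Complex.ofReal_sin, phase]
  ring

lemma integrable_mul_of_bounded {h b : Plane → ℝ} (hh : Integrable h (cellMeas L))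
    (hb : Continuous b) (C : ℝ) (hC : ∀ x, |b x| ≤ C) :
    Integrable (fun x => h x * b x) (cellMeas L) := by
  exact hh.mul_bdd hb.aestronglyMeasurable (ae_of_all _ hC)

lemma integrable_mul_cos {h : Plane → ℝ} (hh : Integrable h (cellMeas L)) (n) :
    Integrable (fun x => h x * Real.cos (phase L n x)) (cellMeas L) :=
  integrable_mul_of_bounded hh (Real.continuous_cos.comp (contDiff_phase (k := 0) n).continuous) 1
    fun _ => Real.abs_cos_le_one _

lemma integrable_mul_sin {h : Plane → ℝ} (hh : Integrable h (cellMeas L)) (n) :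
    Integrable (fun x => h x * Real.sin (phase L n x)) (cellMeas L) :=
  integrable_mul_of_bounded hh (Real.continuous_sin.comp (contDiff_phase (k := 0) n).continuous) 1
    fun _ => Real.abs_sin_le_one _

/-- The Fourier coefficient of a real function. -/
abbrev fcr (L : Plane) (h : Plane → ℝ) (n : Fin 2 → ℤ) : ℂ := fc L (fun x => (h x : ℂ)) n

lemma fcr_eq {h : Plane → ℝ} (hh : Integrable h (cellMeas L)) (n) :
    fcr L h n = ((L 0 * L 1)⁻¹ : ℝ) * (((∫ x in cell L, h x * Real.cos (phase L n x) : ℝ) : ℂ) -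
      Complex.I * ((∫ x in cell L, h x * Real.sin (phase L n x) : ℝ) : ℂ)) := by
  rw [fcr, fc]
  congr 1
  have e : ∀ x, conj (expo L n x) * (h x : ℂ) = ((h x * Real.cos (phase L n x) : ℝ) : ℂ) -
      Complex.I * ((h x * Real.sin (phase L n x) : ℝ) : ℂ) := by
    intro x
    rw [expo_eq, map_add, map_mul, Complex.conj_ofReal, Complex.conj_ofReal, Complex.conj_I]
    push_cast; ring
  simp_rw [e]
  rw [integral_sub (integrable_mul_cos hh n).ofReal
    ((integrable_mul_sin hh n).ofReal.const_mul _), integral_const_mul,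
    integral_complex_ofReal, integral_complex_ofReal]

lemma fcr_neg {h : Plane → ℝ} (hh : Integrable h (cellMeas L)) (n) :
    fcr L h (-n) = conj (fcr L h n) := by
  have hp : ∀ x, phase L (-n) x = -phase L n x := fun x => by simp [phase]; ring
  rw [fcr_eq hh, fcr_eq hh]
  simp only [hp, Real.cos_neg, Real.sin_neg, mul_neg, integral_neg, map_mul, map_sub,
    Complex.conj_ofReal, Complex.conj_I]
  push_cast; ring

/-- A first order relation in the weak sense reads off on the Fourier side. -/
lemma fcr_of_weak (hL : ∀ i, 0 < L i) {a₀ a₁ w : Plane → ℝ} (h₀ : Integrable a₀ (cellMeas L))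
    (h₁ : Integrable a₁ (cellMeas L)) (hw : Integrable w (cellMeas L))
    (h : ∀ η, IsTest L η →
      ∫ x in cell L, (a₀ x * pd 0 η x + a₁ x * pd 1 η x) = -∫ x in cell L, w x * η x) (n) :
    fcr L w n = Complex.I * freq L n 0 * fcr L a₀ n + Complex.I * freq L n 1 * fcr L a₁ n := by
  have hc := h _ (isTest_cos hL n)
  have hs := h _ (isTest_sin hL n)
  simp only [pd_cos] at hc
  simp only [pd_sin] at hs
  have ec : ∫ x in cell L, (a₀ x * -(freq L n 0 * Real.sin (phase L n x)) +
      a₁ x * -(freq L n 1 * Real.sin (phase L n x))) =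
      -(freq L n 0 * ∫ x in cell L, a₀ x * Real.sin (phase L n x)) -
        freq L n 1 * ∫ x in cell L, a₁ x * Real.sin (phase L n x) := by
    rw [← integral_const_mul, ← integral_const_mul, ← neg_add', ← integral_add
      ((integrable_mul_sin h₀ n).const_mul _) ((integrable_mul_sin h₁ n).const_mul _),
      ← integral_neg]
    congr 1; ext x; ring
  have es : ∫ x in cell L, (a₀ x * (freq L n 0 * Real.cos (phase L n x)) +
      a₁ x * (freq L n 1 * Real.cos (phase L n x))) =
      (freq L n 0 * ∫ x in cell L, a₀ x * Real.cos (phase L n x)) +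
        freq L n 1 * ∫ x in cell L, a₁ x * Real.cos (phase L n x) := by
    rw [← integral_const_mul, ← integral_const_mul, ← integral_add
      ((integrable_mul_cos h₀ n).const_mul _) ((integrable_mul_cos h₁ n).const_mul _)]
    congr 1; ext x; ring
  rw [ec] at hc
  rw [es] at hs
  rw [fcr_eq h₀, fcr_eq h₁, fcr_eq hw]
  set A := ∫ x in cell L, a₀ x * Real.cos (phase L n x)
  set B := ∫ x in cell L, a₀ x * Real.sin (phase L n x)
  set C := ∫ x in cell L, a₁ x * Real.cos (phase L n x)
  set D := ∫ x in cell L, a₁ x * Real.sin (phase L n x)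
  set E := ∫ x in cell L, w x * Real.cos (phase L n x)
  set F := ∫ x in cell L, w x * Real.sin (phase L n x)
  have hE : E = freq L n 0 * B + freq L n 1 * D := by linarith
  have hF : F = -(freq L n 0 * A + freq L n 1 * C) := by linarith
  rw [hE, hF]
  push_cast
  linear_combination ((((L 0 : ℂ) * L 1)⁻¹) * (freq L n 0 * B + freq L n 1 * D)) * Complex.I_sq

lemma memLp_ofReal {h : Plane → ℝ} (hh : MemLp h 2 (cellMeas L)) :
    MemLp (fun x => (h x : ℂ)) 2 (cellMeas L) := hh.ofReal

lemma memLp_two_of_continuous {h : Plane → ℝ} (hh : Continuous h) : MemLp h 2 (cellMeas L) := by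
  obtain ⟨C, hC⟩ := (isCompact_Icc (a := (0 : Plane)) (b := L)).exists_bound_of_continuousOn
    hh.continuousOn
  refine MemLp.of_bound hh.aestronglyMeasurable C ?_
  exact (ae_restrict_iff' measurableSet_Icc).2 (ae_of_all _ hC)

lemma pd_mul {f g : Plane → ℝ} (hf : ContDiff ℝ 1 f) (hg : ContDiff ℝ 1 g) (i x) :
    pd i (fun x => f x * g x) x = f x * pd i g x + pd i f x * g x := by
  have h := ((hf.differentiable (by norm_num)) x).hasFDerivAt.mul
    ((hg.differentiable (by norm_num)) x).hasFDerivAt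
  change fderiv ℝ (f * g) x _ = _
  rw [h.fderiv, pd, pd]
  simp; ring

lemma continuous_pd {f : Plane → ℝ} (hf : ContDiff ℝ 1 f) (i) : Continuous (pd i f) :=
  (hf.continuous_fderiv (by norm_num)).clm_apply continuous_const

lemma integral_mul_pd (hL : ∀ i, 0 < L i) {f g : Plane → ℝ} (hf : ContDiff ℝ 1 f)
    (hg : ContDiff ℝ 1 g) (hfp : IsPeriodic L f) (hgp : IsPeriodic L g) (i) :
    ∫ x in cell L, f x * pd i g x = -∫ x in cell L, pd i f x * g x := by
  have h := integral_pd_eq_zero hL (hf.mul hg) (fun j x => by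
    show f _ * g _ = f _ * g _; rw [hfp j x, hgp j x]) i
  have e : ∀ x, pd i (fun x => f x * g x) x = f x * pd i g x + pd i f x * g x := pd_mul hf hg i
  change ∫ x in cell L, pd i (fun x => f x * g x) x = 0 at h
  simp_rw [e] at h
  rw [integral_add] at h
  · linarith
  · exact (hf.continuous.mul (continuous_pd hg i)).continuousOn.integrableOn_compact isCompact_Icc
  · exact ((continuous_pd hf i).mul hg.continuous).continuousOn.integrableOn_compact isCompact_Icc

lemma fcr_pd (hL : ∀ i, 0 < L i) {η : Plane → ℝ} (hη : IsTest L η) (i n) :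
    fcr L (pd i η) n = Complex.I * freq L n i * fcr L η n := by
  have h1 : ContDiff ℝ 1 η := hη.smooth.of_le (by exact_mod_cast le_top)
  have hi : Integrable η (cellMeas L) :=
      (memLp_two_of_continuous h1.continuous).integrable (by norm_num)
  have hd : Integrable (pd i η) (cellMeas L) :=
    (memLp_two_of_continuous (continuous_pd h1 i)).integrable (by norm_num)
  have hz : Integrable (fun _ => (0 : ℝ)) (cellMeas L) := integrable_zero _ _ _
  have hfc0 : fcr L (fun _ => (0 : ℝ)) n = 0 := by simp [fcr, fc]
  fin_cases i
  · have := fcr_of_weak hL hi hz hd (fun ζ hζ => by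
      simpa using integral_mul_pd hL h1 (hζ.smooth.of_le (by exact_mod_cast le_top)) hη.periodic
        hζ.periodic 0) n
    simpa [hfc0] using this
  · have := fcr_of_weak hL hz hi hd (fun ζ hζ => by
      simpa using integral_mul_pd hL h1 (hζ.smooth.of_le (by exact_mod_cast le_top)) hη.periodic
        hζ.periodic 1) n
    simpa [hfc0] using this

/-- Parseval's identity for real functions. -/
lemma hasSum_parseval_real (hL : ∀ i, 0 < L i) {g h : Plane → ℝ} (hg : MemLp g 2 (cellMeas L))
    (hh : MemLp h 2 (cellMeas L)) :
    HasSum (fun n => conj (fcr L g n) * fcr L h n)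
      (((L 0 * L 1)⁻¹ * ∫ x in cell L, g x * h x : ℝ) : ℂ) := by
  have := hasSum_conj_fc_mul_fc hL (memLp_ofReal hg) (memLp_ofReal hh)
  convert this using 1
  rw [Complex.ofReal_mul, ← integral_complex_ofReal]
  congr 2
  ext x
  simp

/-- The converse of `fcr_of_weak` for square integrable functions. -/
lemma weak_of_fcr (hL : ∀ i, 0 < L i) {a₀ a₁ w : Plane → ℝ} (h₀ : MemLp a₀ 2 (cellMeas L))
    (h₁ : MemLp a₁ 2 (cellMeas L)) (hw : MemLp w 2 (cellMeas L))
    (h : ∀ n, fcr L w n =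
      Complex.I * freq L n 0 * fcr L a₀ n + Complex.I * freq L n 1 * fcr L a₁ n)
    {η : Plane → ℝ} (hη : IsTest L η) :
    ∫ x in cell L, (a₀ x * pd 0 η x + a₁ x * pd 1 η x) = -∫ x in cell L, w x * η x := by
  have hη1 : ContDiff ℝ 1 η := hη.smooth.of_le (by exact_mod_cast le_top)
  have m := memLp_two_of_continuous (L := L) hη1.continuous
  have m0 := memLp_two_of_continuous (L := L) (continuous_pd hη1 0)
  have m1 := memLp_two_of_continuous (L := L) (continuous_pd hη1 1)
  have s0 := hasSum_parseval_real hL h₀ m0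
  have s1 := hasSum_parseval_real hL h₁ m1
  have s := hasSum_parseval_real hL hw m
  have hsum := (s0.add s1).add s
  have hz : ∀ n, conj (fcr L a₀ n) * fcr L (pd 0 η) n + conj (fcr L a₁ n) * fcr L (pd 1 η) n +
      conj (fcr L w n) * fcr L η n = 0 := by
    intro n
    rw [fcr_pd hL hη, fcr_pd hL hη, h n]
    simp only [map_add, map_mul, Complex.conj_I, Complex.conj_ofReal]
    ring
  simp only [hz] at hsum
  have h2 := hsum.unique hasSum_zero
  have h3 : (L 0 * L 1)⁻¹ * (∫ x in cell L, a₀ x * pd 0 η x) +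
      (L 0 * L 1)⁻¹ * (∫ x in cell L, a₁ x * pd 1 η x) +
      (L 0 * L 1)⁻¹ * (∫ x in cell L, w x * η x) = 0 := by exact_mod_cast h2
  have hV : (L 0 * L 1)⁻¹ ≠ 0 := by have := hL 0; have := hL 1; positivity
  have i0 : Integrable (fun x => a₀ x * pd 0 η x) (cellMeas L) := h₀.integrable_mul m0
  have i1 : Integrable (fun x => a₁ x * pd 1 η x) (cellMeas L) := h₁.integrable_mul m1
  rw [integral_add i0 i1]
  have h4 : (L 0 * L 1)⁻¹ * ((∫ x in cell L, a₀ x * pd 0 η x) +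
      (∫ x in cell L, a₁ x * pd 1 η x) + ∫ x in cell L, w x * η x) = 0 := by linarith
  have := (mul_eq_zero.1 h4).resolve_left hV
  linarith

/-- Orthonormality of the exponentials. -/
lemma fc_expo (hL : ∀ i, 0 < L i) (m n : Fin 2 → ℤ) :
    fc L (expo L m) n = if n = m then 1 else 0 := by
  have h0 := hL 0
  have h1 := hL 1
  have hshift : fc L (expo L m) n = fcr L (fun _ => 1) (n - m) := by
    rw [fcr, fc, fc]
    congr 2
    ext x
    rw [conj_expo, conj_expo, ← expo_add]
    simp [sub_eq_add_neg, add_comm]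
  have hone : Integrable (fun _ => (1 : ℝ)) (cellMeas L) := integrable_const _
  rw [hshift]
  split_ifs with h
  · rw [h, sub_self, fcr, fc]
    have hv : (volume (cell L)).toReal = L 0 * L 1 := by
      rw [cell, Real.volume_Icc_pi]
      simp [ENNReal.toReal_ofReal, h0.le, h1.le]
    have : ((volume (cell L)).toReal : ℂ) = (L 0 * L 1 : ℝ) := by rw [hv]
    simp only [expo_zero, map_one, Complex.ofReal_one, mul_one, integral_const, Measure.real,
      Measure.restrict_apply_univ, Complex.real_smul]
    rw [this, ← Complex.ofReal_mul, inv_mul_cancel₀ (by positivity), Complex.ofReal_one]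
  · have hk : n - m ≠ 0 := sub_ne_zero.2 h
    have hlam := lam_pos hL hk
    have key : ∀ i, Complex.I * freq L (n - m) i * fcr L (fun _ => 1) (n - m) = 0 := by
      intro i
      have hz : Integrable (fun _ => (0 : ℝ)) (cellMeas L) := integrable_zero _ _ _
      have hfc0 : fcr L (fun _ => (0 : ℝ)) (n - m) = 0 := by simp [fcr, fc]
      fin_cases i
      · have := fcr_of_weak hL hone hz hz (fun ζ hζ => by
          simpa using integral_pd_eq_zero hL (hζ.smooth.of_le (by exact_mod_cast le_top))
            hζ.periodic 0) (n - m)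
        simpa [hfc0] using this
      · have := fcr_of_weak hL hz hone hz (fun ζ hζ => by
          simpa using integral_pd_eq_zero hL (hζ.smooth.of_le (by exact_mod_cast le_top))
            hζ.periodic 1) (n - m)
        simpa [hfc0] using this
    by_contra hne
    have hf : ∀ i, freq L (n - m) i = 0 := fun i => by
      have := key i
      simpa [hne] using this
    simp [lam, hf] at hlam

/-! ### The truncated vorticity and its maximum principle -/

/-- A smooth convex approximation of the positive part: the primitive of a smooth step. -/
def posPart (s : ℝ) : ℝ := ∫ r in (0 : ℝ)..s, Real.smoothTransition r

lemma hasDerivAt_posPart (s : ℝ) : HasDerivAt posPart (Real.smoothTransition s) s :=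
  intervalIntegral.integral_hasDerivAt_right
    (Real.smoothTransition.continuous.intervalIntegrable _ _)
    (Real.smoothTransition.continuous.stronglyMeasurableAtFilter _ _)
    Real.smoothTransition.continuousAt

lemma contDiff_posPart : ContDiff ℝ ∞ posPart := by
  rw [contDiff_infty_iff_deriv]
  refine ⟨fun s => (hasDerivAt_posPart s).differentiableAt, ?_⟩
  rw [show deriv posPart = Real.smoothTransition from funext fun s => (hasDerivAt_posPart s).deriv]
  exact Real.smoothTransition.contDiff

lemma posPart_of_nonpos {s : ℝ} (hs : s ≤ 0) : posPart s = 0 := by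
  rw [posPart, intervalIntegral.integral_congr (g := fun _ => 0)]
  · simp
  · intro r hr
    rw [uIcc_of_ge hs] at hr
    exact Real.smoothTransition.zero_of_nonpos hr.2

lemma posPart_pos {s : ℝ} (hs : 0 < s) : 0 < posPart s :=
  intervalIntegral.intervalIntegral_pos_of_pos_on
    (Real.smoothTransition.continuous.intervalIntegrable _ _)
    (fun _ hr => Real.smoothTransition.pos_of_pos hr.1) hs

lemma posPart_nonneg (s : ℝ) : 0 ≤ posPart s := by
  rcases le_or_gt s 0 with h | h
  · exact (posPart_of_nonpos h).ge
  · exact (posPart_pos h).le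

lemma posPart_sub_le (a b : ℝ) : posPart a - posPart b ≤ |a - b| := by
  have h1 : posPart a - posPart b = ∫ r in b..a, Real.smoothTransition r := by
    have hi : ∀ c d, IntervalIntegrable Real.smoothTransition volume c d := fun c d =>
      Real.smoothTransition.continuous.intervalIntegrable _ _
    have := intervalIntegral.integral_add_adjacent_intervals (hi 0 b) (hi b a)
    rw [posPart, posPart]; linarith
  rw [h1]
  have := intervalIntegral.norm_integral_le_of_norm_le_const (a := b) (b := a) (C := 1)
    (f := Real.smoothTransition) fun r _ => by
      rw [Real.norm_eq_abs, abs_of_nonneg (Real.smoothTransition.nonneg r)]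
      exact Real.smoothTransition.le_one r
  rw [one_mul] at this
  exact (le_abs_self _).trans this

/-- The complex trigonometric polynomial with frequencies in `S` and coefficients `c`. -/
def trigC (L : Plane) (S : Finset (Fin 2 → ℤ)) (c : (Fin 2 → ℤ) → ℂ) (x : Plane) : ℂ :=
  ∑ n ∈ S, c n * expo L n x

/-- The real part of a trigonometric polynomial, in terms of sines and cosines. -/
def trig (L : Plane) (S : Finset (Fin 2 → ℤ)) (c : (Fin 2 → ℤ) → ℂ) (x : Plane) : ℝ :=
  ∑ n ∈ S, ((c n).re * Real.cos (phase L n x) - (c n).im * Real.sin (phase L n x))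

lemma re_trigC (S c) (x : Plane) : (trigC L S c x).re = trig L S c x := by
  rw [trigC, trig, Complex.re_sum]
  refine Finset.sum_congr rfl fun n _ => ?_
  rw [expo_eq]
  simp [-Complex.ofReal_cos, -Complex.ofReal_sin]

lemma trig_add (S c d) (x : Plane) :
    trig L S (fun n => c n + d n) x = trig L S c x + trig L S d x := by
  rw [trig, trig, trig, ← Finset.sum_add_distrib]
  refine Finset.sum_congr rfl fun n _ => ?_
  simp only [Complex.add_re, Complex.add_im]; ring

lemma trig_smul (S) (r : ℝ) (c) (x : Plane) :
    trig L S (fun n => (r : ℂ) * c n) x = r * trig L S c x := by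
  rw [trig, trig, Finset.mul_sum]
  refine Finset.sum_congr rfl fun n _ => ?_
  simp only [Complex.re_ofReal_mul, Complex.im_ofReal_mul]; ring

lemma contDiff_trig (S c) {k : WithTop ℕ∞} : ContDiff ℝ k (trig L S c) := by
  unfold trig
  refine ContDiff.sum fun n _ => ?_
  have h := contDiff_phase (L := L) n (k := k)
  exact (contDiff_const.mul h.cos).sub (contDiff_const.mul h.sin)

lemma isPeriodic_trig (hL : ∀ i, 0 < L i) (S c) : IsPeriodic L (trig L S c) := by
  intro i x
  simp only [trig, phase_add_single hL, Real.cos_add_int_mul_two_pi, Real.sin_add_int_mul_two_pi]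

lemma pd_trig (S c i) (x : Plane) :
    pd i (trig L S c) x = trig L S (fun n => Complex.I * freq L n i * c n) x := by
  have hd : ∀ n ∈ S, HasFDerivAt
      (fun x => (c n).re * Real.cos (phase L n x) - (c n).im * Real.sin (phase L n x))
      (fderiv ℝ (fun x => (c n).re * Real.cos (phase L n x) - (c n).im * Real.sin (phase L n x)) x)
      x := fun n _ => by
    have h := contDiff_phase (L := L) n (k := 1)
    exact (((contDiff_const.mul h.cos).sub (contDiff_const.mul h.sin)).differentiable
      (by norm_num) x).hasFDerivAt
  have h := HasFDerivAt.fun_sum hd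
  rw [pd, show trig L S c = fun x => ∑ n ∈ S, ((c n).re * Real.cos (phase L n x) -
    (c n).im * Real.sin (phase L n x)) from rfl, h.fderiv, trig, sum_apply]
  refine Finset.sum_congr rfl fun n _ => ?_
  have h1 := pd_comp_phase (L := L) n i
    (φ := fun s => (c n).re * Real.cos s - (c n).im * Real.sin s)
    (φ' := fun s => (c n).re * -Real.sin s - (c n).im * Real.cos s)
    (fun s => ((Real.hasDerivAt_cos s).const_mul _).sub ((Real.hasDerivAt_sin s).const_mul _)) x
  rw [pd] at h1
  rw [h1]
  simp
  ring

lemma pd_comp_sub {f f' : ℝ → ℝ} (hf : ∀ s, HasDerivAt f (f' s) s) {w : Plane → ℝ}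
    (hw : ContDiff ℝ 1 w) (k : ℝ) (i) (x : Plane) :
    pd i (fun x => f (w x - k)) x = f' (w x - k) * pd i w x := by
  have h1 := ((hw.differentiable (by norm_num)) x).hasFDerivAt.sub_const k
  have := (hf (w x - k)).comp_hasFDerivAt x h1
  change fderiv ℝ (f ∘ fun x => w x - k) x _ = _
  rw [this.fderiv, pd]
  simp

/-- The diffusion does not increase the positive part. -/
lemma integral_step_mul_laplacian_nonpos (hL : ∀ i, 0 < L i) (S c) (k : ℝ) (i) :
    ∫ x in cell L, Real.smoothTransition (trig L S c x - k) * pd i (pd i (trig L S c)) x ≤ 0 := by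
  set w := trig L S c with hw
  have hw1 : ContDiff ℝ 1 w := contDiff_trig S c
  have hpd : pd i w = trig L S (fun n => Complex.I * freq L n i * c n) := funext (pd_trig S c i)
  have hst : ContDiff ℝ 1 (fun x => Real.smoothTransition (w x - k)) :=
    (Real.smoothTransition.contDiff (n := 1)).comp (hw1.sub contDiff_const)
  have hd : ∀ s, HasDerivAt Real.smoothTransition (deriv Real.smoothTransition s) s := fun s =>
    ((Real.smoothTransition.contDiff (n := 1)).differentiable (by norm_num) s).hasDerivAt
  rw [integral_mul_pd hL hst (by rw [hpd]; exact contDiff_trig _ _)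
    (fun j x => by rw [hw, isPeriodic_trig hL S c j x])
    (by rw [hpd]; exact isPeriodic_trig hL _ _), neg_nonpos]
  refine integral_nonneg fun x => ?_
  rw [pd_comp_sub hd hw1]
  have := Real.smoothTransition.monotone.deriv_nonneg (x := w x - k)
  rw [Pi.zero_apply, mul_assoc]
  exact mul_nonneg this (mul_self_nonneg _)

/-- Transport by a solenoidal field preserves the integral of the positive part. -/
lemma integral_step_mul_transport (hL : ∀ i, 0 < L i) {v : Plane → Plane} (hv : MemH L v) (S c)
    (k : ℝ) : ∫ x in cell L, Real.smoothTransition (trig L S c x - k) *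
      (v x 0 * pd 0 (trig L S c) x + v x 1 * pd 1 (trig L S c) x) = 0 := by
  have hw1 : ContDiff ℝ 1 (trig L S c) := contDiff_trig S c
  have := hv.div_eq_zero (fun x => posPart (trig L S c x - k))
    ⟨contDiff_posPart.comp ((contDiff_trig S c).sub contDiff_const),
      fun j x => by rw [isPeriodic_trig hL S c j x]⟩
  rw [← this]
  congr 1
  ext x
  rw [Fin.sum_univ_two, pd_comp_sub hasDerivAt_posPart hw1, pd_comp_sub hasDerivAt_posPart hw1]
  ring

/-- The error in the vorticity equation of the truncated vorticity: the transport term of the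
truncation, minus the truncation of `b`, plus the full rotation of the force. -/
def defect (L : Plane) (S : Finset (Fin 2 → ℤ)) (v : Plane → Plane) (c b : (Fin 2 → ℤ) → ℂ)
    (w : Plane → ℝ) (x : Plane) : ℂ :=
  trigC L S (fun n => Complex.I * (freq L n 0 * v x 0 + freq L n 1 * v x 1) * c n) x +
    trigC L S b x - w x

lemma memLp_mul_cont {v : Plane → ℝ} (hv : MemLp v 2 (cellMeas L)) {b : Plane → ℂ}
    (hb : Continuous b) : MemLp (fun x => b x * (v x : ℂ)) 2 (cellMeas L) := by
  obtain ⟨C, hC⟩ := (isCompact_Icc (a := (0 : Plane)) (b := L)).exists_bound_of_continuousOn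
    hb.continuousOn
  refine (memLp_ofReal hv).of_le_mul (c := C)
    (hb.aestronglyMeasurable.mul (memLp_ofReal hv).aestronglyMeasurable) ?_
  refine (ae_restrict_iff' measurableSet_Icc).2 (ae_of_all _ fun x hx => ?_)
  rw [norm_mul]
  exact mul_le_mul_of_nonneg_right (hC x hx) (norm_nonneg _)

lemma continuous_trigC (S c) : Continuous (trigC L S c) := by
  unfold trigC
  exact continuous_finsetSum _ fun n _ => continuous_const.mul (continuous_expo n)

lemma defect_eq (S v c b w) (x : Plane) : defect L S v c b w x =
    trigC L S (fun n => Complex.I * freq L n 0 * c n) x * (v x 0 : ℂ) +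
    trigC L S (fun n => Complex.I * freq L n 1 * c n) x * (v x 1 : ℂ) +
    trigC L S b x - w x := by
  have h : ∀ i, trigC L S (fun n => Complex.I * freq L n i * c n) x * (v x i : ℂ) =
      ∑ n ∈ S, Complex.I * freq L n i * c n * expo L n x * (v x i : ℂ) := fun i => Finset.sum_mul ..
  rw [defect, h, h, ← Finset.sum_add_distrib]
  congr 2
  refine Finset.sum_congr rfl fun n _ => ?_
  ring

lemma memLp_two_of_continuous' {h : Plane → ℂ} (hh : Continuous h) : MemLp h 2 (cellMeas L) := by
  obtain ⟨C, hC⟩ := (isCompact_Icc (a := (0 : Plane)) (b := L)).exists_bound_of_continuousOn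
    hh.continuousOn
  refine MemLp.of_bound hh.aestronglyMeasurable C ?_
  exact (ae_restrict_iff' measurableSet_Icc).2 (ae_of_all _ hC)

lemma memLp_defect (S) {v : Plane → Plane} (hv : ∀ i, MemLp (fun x => v x i) 2 (cellMeas L)) (c b)
    {w : Plane → ℝ} (hw : MemLp w 2 (cellMeas L)) : MemLp (defect L S v c b w) 2 (cellMeas L) := by
  rw [funext (defect_eq S v c b w)]
  exact (((memLp_mul_cont (hv 0) (continuous_trigC _ _)).add
    (memLp_mul_cont (hv 1) (continuous_trigC _ _))).add
    (memLp_two_of_continuous' (continuous_trigC _ _))).sub (memLp_ofReal hw)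

/-- The rate of change of the positive part of the truncated vorticity above the level `k` is
controlled by the defect alone. -/
lemma integral_step_mul_rate_le (hL : ∀ i, 0 < L i) {ν μ ε A k M : ℝ} (hν : 0 ≤ ν) (hμ : 0 ≤ μ)
    (hε : 0 < ε) {v : Plane → Plane} (hv : MemH L v) (S c b) {w : Plane → ℝ}
    (hw : MemLp w 2 (cellMeas L)) (hwA : ∀ᵐ x ∂cellMeas L, w x ≤ A) (hM : μ * M = A + ε) :
    ∫ x in cell L, Real.smoothTransition (trig L S c x - k) *
      (trig L S (fun n => -((ν * lam L n + μ : ℝ) : ℂ) * c n + b n) x + μ * (k - M)) ≤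
    (4 * ε)⁻¹ * ∫ x in cell L, ‖defect L S v c b w x‖ ^ 2 := by
  set ψ := Real.smoothTransition
  set W := trig L S c with hW
  have hWc : Continuous W := (contDiff_trig S c (k := 0)).continuous
  have hψc : Continuous fun x => ψ (W x - k) :=
    Real.smoothTransition.continuous.comp (hWc.sub continuous_const)
  have hpd : ∀ i, pd i W = trig L S (fun n => Complex.I * freq L n i * c n) :=
    fun i => funext (pd_trig S c i)
  have hpdc : ∀ i, Continuous (pd i W) := fun i => by
    rw [hpd]; exact (contDiff_trig S _ (k := 0)).continuous
  have hpd2 : ∀ i, pd i (pd i W) = trig L S (fun n => ((-(freq L n i) ^ 2 : ℝ) : ℂ) * c n) := by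
    intro i
    rw [hpd, funext (pd_trig _ _ i)]
    congr 1; ext n
    push_cast
    linear_combination (freq L n i : ℂ) ^ 2 * c n * Complex.I_sq
  have hpd2c : ∀ i, Continuous (pd i (pd i W)) := fun i => by
    rw [hpd2]; exact (contDiff_trig S _ (k := 0)).continuous
  have hrate : ∀ x, trig L S (fun n => -((ν * lam L n + μ : ℝ) : ℂ) * c n + b n) x =
      ν * (pd 0 (pd 0 W) x + pd 1 (pd 1 W) x) - μ * W x + trig L S b x := by
    intro x
    rw [hpd2, hpd2, ← trig_add, ← trig_smul, hW, sub_eq_add_neg, ← neg_mul, ← trig_smul, ← trig_add,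
      ← trig_add]
    congr 1; ext n
    rw [lam]; push_cast; ring
  have hdef : ∀ x, (defect L S v c b w x).re =
      (v x 0 * pd 0 W x + v x 1 * pd 1 W x) + trig L S b x - w x := by
    intro x
    rw [defect_eq, hpd, hpd]
    simp only [Complex.sub_re, Complex.add_re, Complex.re_mul_ofReal, re_trigC, Complex.ofReal_re]
    ring
  have hD := memLp_defect S hv.memLp c b hw
  have iD : Integrable (fun x => ‖defect L S v c b w x‖ ^ 2) (cellMeas L) :=
      hD.integrable_norm_pow' (p := 2)
  have hlap : ∀ i, Integrable (fun x => ψ (W x - k) * pd i (pd i W) x) (cellMeas L) := fun i =>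
    (hψc.mul (hpd2c i)).continuousOn.integrableOn_compact isCompact_Icc
  have htr : Integrable (fun x => ψ (W x - k) * (v x 0 * pd 0 W x + v x 1 * pd 1 W x))
      (cellMeas L) := by
    have h0 : Integrable (fun x => v x 0 * (ψ (W x - k) * pd 0 W x)) (cellMeas L) :=
      (hv.memLp 0).integrable_mul (memLp_two_of_continuous (hψc.mul (hpdc 0)))
    have h1 : Integrable (fun x => v x 1 * (ψ (W x - k) * pd 1 W x)) (cellMeas L) :=
      (hv.memLp 1).integrable_mul (memLp_two_of_continuous (hψc.mul (hpdc 1)))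
    refine (h0.add h1).congr (ae_of_all _ fun x => ?_)
    simp only [Pi.add_apply]; ring
  have hbound : ∀ᵐ x ∂cellMeas L, ψ (W x - k) *
      (trig L S (fun n => -((ν * lam L n + μ : ℝ) : ℂ) * c n + b n) x + μ * (k - M)) ≤
      ν * (ψ (W x - k) * pd 0 (pd 0 W) x) + ν * (ψ (W x - k) * pd 1 (pd 1 W) x) -
        ψ (W x - k) * (v x 0 * pd 0 W x + v x 1 * pd 1 W x) +
        (4 * ε)⁻¹ * ‖defect L S v c b w x‖ ^ 2 := by
    filter_upwards [hwA] with x hx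
    have hψ0 : 0 ≤ ψ (W x - k) := Real.smoothTransition.nonneg _
    have hψ1 : ψ (W x - k) ≤ 1 := Real.smoothTransition.le_one _
    have hmono : 0 ≤ ψ (W x - k) * (W x - k) := by
      rcases le_or_gt (W x - k) 0 with h | h
      · rw [show ψ (W x - k) = 0 from Real.smoothTransition.zero_of_nonpos h, zero_mul]
      · positivity
    have hre := (Complex.re_le_norm (defect L S v c b w x))
    -- The margin `ε` leaves of the defect only its square: `a ≤ ε + a² / (4ε)`.
    have hsq : (defect L S v c b w x).re - ε ≤ (4 * ε)⁻¹ * ‖defect L S v c b w x‖ ^ 2 := by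
      rw [inv_mul_eq_div, le_div_iff₀ (by positivity)]
      nlinarith [sq_nonneg (‖defect L S v c b w x‖ - 2 * ε)]
    have hnn : 0 ≤ (4 * ε)⁻¹ * ‖defect L S v c b w x‖ ^ 2 := by positivity
    have h1 : ψ (W x - k) * ((defect L S v c b w x).re - ε) ≤
        (4 * ε)⁻¹ * ‖defect L S v c b w x‖ ^ 2 := by nlinarith
    have h2 : ψ (W x - k) * (w x - A) ≤ 0 := by nlinarith
    have h3 : 0 ≤ μ * (ψ (W x - k) * (W x - k)) := by positivity
    rw [hrate]
    rw [hdef] at h1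
    have h4 : ψ (W x - k) * (μ * M) = ψ (W x - k) * (A + ε) := by rw [hM]
    nlinarith
  have iright : Integrable (fun x => ν * (ψ (W x - k) * pd 0 (pd 0 W) x) +
      ν * (ψ (W x - k) * pd 1 (pd 1 W) x) -
        ψ (W x - k) * (v x 0 * pd 0 W x + v x 1 * pd 1 W x) +
        (4 * ε)⁻¹ * ‖defect L S v c b w x‖ ^ 2) (cellMeas L) :=
    ((((hlap 0).const_mul ν).add ((hlap 1).const_mul ν)).sub htr).add (iD.const_mul _)
  have ileft : Integrable (fun x => ψ (W x - k) *
      (trig L S (fun n => -((ν * lam L n + μ : ℝ) : ℂ) * c n + b n) x + μ * (k - M)))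
      (cellMeas L) :=
    (hψc.mul ((contDiff_trig S _ (k := 0)).continuous.add
      continuous_const)).continuousOn.integrableOn_compact isCompact_Icc
  refine (integral_mono_ae ileft iright hbound).trans ?_
  rw [integral_add (f := fun x => ν * (ψ (W x - k) * pd 0 (pd 0 W) x) +
      ν * (ψ (W x - k) * pd 1 (pd 1 W) x) -
        ψ (W x - k) * (v x 0 * pd 0 W x + v x 1 * pd 1 W x))
      ((((hlap 0).const_mul ν).add ((hlap 1).const_mul ν)).sub htr) (iD.const_mul _),
    integral_sub (f := fun x => ν * (ψ (W x - k) * pd 0 (pd 0 W) x) +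
      ν * (ψ (W x - k) * pd 1 (pd 1 W) x)) (((hlap 0).const_mul ν).add ((hlap 1).const_mul ν)) htr,
    integral_add ((hlap 0).const_mul ν) ((hlap 1).const_mul ν),
    integral_step_mul_transport hL hv S c k, integral_const_mul, integral_const_mul,
    integral_const_mul]
  have h0 := integral_step_mul_laplacian_nonpos hL S c k 0
  have h1 := integral_step_mul_laplacian_nonpos hL S c k 1
  have h0' := mul_nonpos_of_nonneg_of_nonpos hν h0
  have h1' := mul_nonpos_of_nonneg_of_nonpos hν h1
  linarith

lemma abs_cos_term_le (c : ℂ) (s : ℝ) : |c.re * Real.cos s - c.im * Real.sin s| ≤ ‖c‖ := by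
  rw [Complex.norm_eq_sqrt_sq_add_sq]
  refine Real.abs_le_sqrt ?_
  nlinarith [sq_nonneg (c.re * Real.sin s + c.im * Real.cos s), Real.sin_sq_add_cos_sq s]

lemma trig_primitive {S : Finset (Fin 2 → ℤ)} {y r : ℝ → (Fin 2 → ℤ) → ℂ} {a t : ℝ}
    (hr : ∀ n, IntervalIntegrable (fun s => r s n) volume a t)
    (hyr : ∀ n, y t n = y a n + ∫ s in a..t, r s n) (x : Plane) :
    IntervalIntegrable (fun s => trig L S (r s) x) volume a t ∧
    trig L S (y t) x = trig L S (y a) x + ∫ s in a..t, trig L S (r s) x := by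
  have hre : ∀ n, IntervalIntegrable (fun s => (r s n).re) volume a t := fun n =>
    ⟨(hr n).1.re, (hr n).2.re⟩
  have him : ∀ n, IntervalIntegrable (fun s => (r s n).im) volume a t := fun n =>
    ⟨(hr n).1.im, (hr n).2.im⟩
  have hterm : ∀ n ∈ S, IntervalIntegrable (fun s => (r s n).re * Real.cos (phase L n x) -
      (r s n).im * Real.sin (phase L n x)) volume a t := fun n _ =>
    ((hre n).mul_const _).sub ((him n).mul_const _)
  constructor
  · exact (IntervalIntegrable.sum S hterm).congr (by
      intro s _; simp [trig, Finset.sum_apply])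
  · simp only [trig]
    rw [intervalIntegral.integral_finsetSum hterm, ← Finset.sum_add_distrib]
    refine Finset.sum_congr rfl fun n _ => ?_
    rw [intervalIntegral.integral_sub ((hre n).mul_const _) ((him n).mul_const _),
      intervalIntegral.integral_mul_const, intervalIntegral.integral_mul_const, hyr n,
      Complex.add_re, Complex.add_im]
    have e1 : (∫ s in a..t, r s n).re = ∫ s in a..t, (r s n).re :=
      (intervalIntegral.intervalIntegral_re (𝕜 := ℂ) (hr n)).symm
    have e2 : (∫ s in a..t, r s n).im = ∫ s in a..t, (r s n).im :=
      (intervalIntegral.intervalIntegral_im (𝕜 := ℂ) (hr n)).symm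
    rw [e1, e2]; ring

/-- The time evolution of the integral of the positive part of a trigonometric polynomial above a
time dependent level. -/
lemma integral_posPart_eq {S : Finset (Fin 2 → ℤ)} {y r : ℝ → (Fin 2 → ℤ) → ℂ} {a b : ℝ}
    (hab : a ≤ b) (hy : ∀ n, Continuous fun s => y s n)
    (hr : ∀ n, IntervalIntegrable (fun s => r s n) volume a b)
    (hyr : ∀ n, ∀ t ∈ Icc a b, y t n = y a n + ∫ s in a..t, r s n) {k k' : ℝ → ℝ}
    (hk : ∀ s, HasDerivAt k (k' s) s) (hk' : Continuous k') :
    Integrable (fun s => ∫ x in cell L, Real.smoothTransition (trig L S (y s) x - k s) *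
      (trig L S (r s) x - k' s)) (volume.restrict (Ioc a b)) ∧
    ∫ x in cell L, posPart (trig L S (y b) x - k b) =
      (∫ x in cell L, posPart (trig L S (y a) x - k a)) +
      ∫ s in Ioc a b, ∫ x in cell L, Real.smoothTransition (trig L S (y s) x - k s) *
        (trig L S (r s) x - k' s) := by
  have hkc : Continuous k := continuous_iff_continuousAt.2 fun s => (hk s).continuousAt
  have hyc : Continuous fun p : Plane × ℝ => trig L S (y p.2) p.1 := by
    unfold trig
    refine continuous_finsetSum _ fun n _ => ?_
    have h1 := (contDiff_phase (L := L) n (k := 0)).continuous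
    have h2 := hy n
    fun_prop
  have hr' : ∀ n, Integrable (fun p : Plane × ℝ => r p.2 n)
      ((cellMeas L).prod (volume.restrict (Ioc a b))) := fun n => (hr n).1.comp_snd _
  have hprod : Integrable (Function.uncurry fun (x : Plane) (s : ℝ) =>
      Real.smoothTransition (trig L S (y s) x - k s) * (trig L S (r s) x - k' s))
      ((cellMeas L).prod (volume.restrict (Ioc a b))) := by
    have h1 : Integrable (fun p : Plane × ℝ => trig L S (r p.2) p.1 - k' p.2)
        ((cellMeas L).prod (volume.restrict (Ioc a b))) := by
      refine Integrable.sub ?_ ?_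
      · unfold trig
        refine integrable_finsetSum _ fun n _ => ?_
        have h1 := (contDiff_phase (L := L) n (k := 0)).continuous
        refine Integrable.sub ?_ ?_
        · refine (hr' n).re.mul_bdd (c := 1) ?_ (ae_of_all _ fun p => ?_)
          · exact (by fun_prop : Continuous fun p : Plane × ℝ =>
              Real.cos (phase L n p.1)).aestronglyMeasurable
          · exact Real.abs_cos_le_one _
        · refine (hr' n).im.mul_bdd (c := 1) ?_ (ae_of_all _ fun p => ?_)
          · exact (by fun_prop : Continuous fun p : Plane × ℝ =>
              Real.sin (phase L n p.1)).aestronglyMeasurable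
          · exact Real.abs_sin_le_one _
      · have : Integrable k' (volume.restrict (Ioc a b)) :=
          (hk'.intervalIntegrable a b).1
        exact this.comp_snd _
    refine (h1.mul_bdd (c := 1) (g := fun p : Plane × ℝ =>
      Real.smoothTransition (trig L S (y p.2) p.1 - k p.2)) ?_ (ae_of_all _ fun p => ?_)).congr
      (ae_of_all _ fun p => mul_comm _ _)
    · exact (Real.smoothTransition.continuous.comp
        (hyc.sub (hkc.comp continuous_snd))).aestronglyMeasurable
    · rw [Real.norm_eq_abs, abs_of_nonneg (Real.smoothTransition.nonneg _)]
      exact Real.smoothTransition.le_one _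
  refine ⟨hprod.integral_prod_right, ?_⟩
  have hpoint : ∀ x, posPart (trig L S (y b) x - k b) = posPart (trig L S (y a) x - k a) +
      ∫ s in Ioc a b, Real.smoothTransition (trig L S (y s) x - k s) *
        (trig L S (r s) x - k' s) := by
    intro x
    have hcx : Continuous fun s => trig L S (y s) x - k s :=
      (hyc.comp (continuous_const.prodMk continuous_id)).sub hkc
    obtain ⟨B, hB⟩ := (isCompact_Icc (a := a) (b := b)).exists_bound_of_continuousOn
      hcx.continuousOn
    rw [← intervalIntegral.integral_of_le hab]
    refine chain_of_primitive (s := univ) (fun s _ => hasDerivAt_posPart s)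
      Real.smoothTransition.continuous.continuousOn (y := fun s => trig L S (y s) x - k s) hab
      ((trig_primitive hr (fun n => hyr n b (right_mem_Icc.2 hab)) x).1.sub
        (hk'.intervalIntegrable a b)) (fun t ht => ?_) (c := -B) (d := B) (subset_univ _)
      (fun t ht => abs_le.1 (hB t ht))
    have hrt : ∀ n, IntervalIntegrable (fun s => r s n) volume a t := fun n =>
      (hr n).mono_set (by
        rw [uIcc_of_le hab, uIcc_of_le ht.1]; exact Icc_subset_Icc le_rfl ht.2)
    obtain ⟨h1, h2⟩ := trig_primitive (L := L) (S := S) hrt (fun n => hyr n t ht) x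
    rw [intervalIntegral.integral_sub h1 (hk'.intervalIntegrable a t), h2,
      intervalIntegral.integral_eq_sub_of_hasDerivAt (fun s _ => hk s)
        (hk'.intervalIntegrable a t)]
    ring
  have hcont : ∀ s, Continuous fun x => posPart (trig L S (y s) x - k s) := fun s =>
    contDiff_posPart.continuous.comp (((contDiff_trig S _ (k := 0)).continuous).sub
      continuous_const)
  simp_rw [hpoint]
  have h0 : Integrable (fun x => posPart (trig L S (y a) x - k a)) (cellMeas L) :=
    (hcont a).continuousOn.integrableOn_compact isCompact_Icc
  have h1 : Integrable (fun x => ∫ s in Ioc a b, Real.smoothTransition (trig L S (y s) x - k s) *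
      (trig L S (r s) x - k' s)) (cellMeas L) := hprod.integral_prod_left
  rw [integral_add h0 h1, integral_integral_swap hprod]

/-! ### Fourier coefficients of the defect -/

/-- Young's inequality for the convolution of a summable and a square summable family. -/
lemma young_tsum (a b : (Fin 2 → ℤ) → ℝ≥0∞) :
    ∑' n, (∑' k, a k * b (n - k)) ^ 2 ≤ (∑' k, a k) ^ 2 * ∑' k, b k ^ 2 := by
  have hs : ∀ t : ℝ≥0∞, (t ^ (1 / 2 : ℝ)) ^ 2 = t := fun t => by
    rw [← ENNReal.rpow_natCast, ← ENNReal.rpow_mul]; norm_num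
  have h1 : ∀ n, (∑' k, a k * b (n - k)) ^ 2 ≤ (∑' k, a k) * ∑' k, a k * b (n - k) ^ 2 := by
    intro n
    have := tsum_mul_sq_le (fun k => (a k) ^ (1 / 2 : ℝ)) fun k => (a k) ^ (1 / 2 : ℝ) * b (n - k)
    simp only [mul_pow, hs, ← mul_assoc, ← sq] at this
    exact this
  refine (ENNReal.tsum_le_tsum h1).trans_eq ?_
  rw [ENNReal.tsum_mul_left, ENNReal.tsum_comm, sq, mul_assoc]
  congr 1
  rw [← ENNReal.tsum_mul_right]
  refine tsum_congr fun k => ?_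
  rw [ENNReal.tsum_mul_left]
  congr 1
  exact (Equiv.subRight k).tsum_eq fun m => b m ^ 2

/-- The velocity with the vorticity coefficients `z`, on the Fourier side. -/
def HasVorticity (L : Plane) (v : Plane → Plane) (z : (Fin 2 → ℤ) → ℂ) : Prop :=
  ∀ k, fcr L (fun x => v x 0) k = Complex.I * freq L k 1 * z k / lam L k ∧
    fcr L (fun x => v x 1) k = -(Complex.I * freq L k 0 * z k / lam L k)

lemma fc_add {f g : Plane → ℂ} (hf : Integrable f (cellMeas L)) (hg : Integrable g (cellMeas L))
    (n) : fc L (fun x => f x + g x) n = fc L f n + fc L g n := by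
  have hb : ∀ h : Plane → ℂ, Integrable h (cellMeas L) →
      Integrable (fun x => conj (expo L n x) * h x) (cellMeas L) := fun h hh =>
    hh.bdd_mul (c := 1) (Complex.continuous_conj.comp (continuous_expo n)).aestronglyMeasurable
      (ae_of_all _ fun x => by simp [norm_expo])
  simp only [fc, mul_add]
  rw [integral_add (hb f hf) (hb g hg), mul_add]

lemma fc_const_mul (c : ℂ) (f : Plane → ℂ) (n) : fc L (fun x => c * f x) n = c * fc L f n := by
  simp only [fc, mul_left_comm _ c, integral_const_mul]

lemma fc_sum {ι : Type*} (S : Finset ι) {f : ι → Plane → ℂ}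
    (hf : ∀ i ∈ S, Integrable (f i) (cellMeas L)) (n) :
    fc L (fun x => ∑ i ∈ S, f i x) n = ∑ i ∈ S, fc L (f i) n := by
  classical
  induction S using Finset.induction_on with
  | empty => simp [fc]
  | insert i S hi ih =>
    simp only [Finset.sum_insert hi]
    rw [fc_add (hf i (by simp)) (integrable_finsetSum _ fun j hj => hf j (by simp [hj])),
      ih fun j hj => hf j (by simp [hj])]

lemma fc_expo_mul (f : Plane → ℂ) (l n) : fc L (fun x => expo L l x * f x) n = fc L f (n - l) := by
  simp only [fc]
  congr 2
  ext x
  rw [← mul_assoc, conj_expo, conj_expo, ← expo_add]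
  congr 2
  abel

lemma fc_trigC_mul (S c) {f : Plane → ℂ} (hf : Integrable f (cellMeas L)) (n) :
    fc L (fun x => trigC L S c x * f x) n = ∑ l ∈ S, c l * fc L f (n - l) := by
  have hb : ∀ l, Integrable (fun x => expo L l x * f x) (cellMeas L) := fun l =>
    hf.bdd_mul (c := 1) (continuous_expo l).aestronglyMeasurable
      (ae_of_all _ fun x => by simp [norm_expo])
  simp only [trigC, Finset.sum_mul, mul_assoc]
  rw [fc_sum S fun l _ => (hb l).const_mul (c l)]
  refine Finset.sum_congr rfl fun l _ => ?_
  rw [fc_const_mul, fc_expo_mul]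

lemma fc_trigC (hL : ∀ i, 0 < L i) (S : Finset (Fin 2 → ℤ)) (c n) :
    fc L (trigC L S c) n = (S : Set (Fin 2 → ℤ)).indicator c n := by
  classical
  unfold trigC
  have hi : ∀ l ∈ S, Integrable (fun x => c l * expo L l x) (cellMeas L) := fun l _ =>
    (continuous_const.mul (continuous_expo l)).continuousOn.integrableOn_compact isCompact_Icc
  rw [fc_sum S hi]
  simp only [fc_const_mul, fc_expo hL, mul_ite, mul_one, mul_zero, Finset.sum_ite_eq,
    indicator_apply, Finset.mem_coe]

/-- By the Biot-Savart law the advection of a trigonometric polynomial with frequencies in `S` has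
the coefficients of `conv`, with the interactions restricted to `l ∈ S`. -/
lemma fc_defect (hL : ∀ i, 0 < L i) (S : Finset (Fin 2 → ℤ)) {v : Plane → Plane}
    (hv : ∀ i, MemLp (fun x => v x i) 2 (cellMeas L)) {z : (Fin 2 → ℤ) → ℂ}
    (hvz : HasVorticity L v z) (c b) {w : Plane → ℝ} (hw : MemLp w 2 (cellMeas L)) (n) :
    fc L (defect L S v c b w) n = (S : Set (Fin 2 → ℤ)).indicator b n -
      ∑ l ∈ S, (qc L (n - l) n : ℂ) * (z (n - l) * c l) - fcr L w n := by
  have hi : ∀ i, Integrable (fun x => (v x i : ℂ)) (cellMeas L) := fun i =>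
    (memLp_ofReal (hv i)).integrable (by norm_num)
  have m : ∀ i c, Integrable (fun x => trigC L S c x * (v x i : ℂ)) (cellMeas L) := fun i c =>
    (memLp_mul_cont (hv i) (continuous_trigC _ _)).integrable (by norm_num)
  have mb : Integrable (trigC L S b) (cellMeas L) :=
    (continuous_trigC S b).continuousOn.integrableOn_compact isCompact_Icc
  have mw : Integrable (fun x => (w x : ℂ)) (cellMeas L) :=
    (memLp_ofReal hw).integrable (by norm_num)
  have e : defect L S v c b w = fun x =>
      ((trigC L S (fun n => Complex.I * freq L n 0 * c n) x * (v x 0 : ℂ) +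
      trigC L S (fun n => Complex.I * freq L n 1 * c n) x * (v x 1 : ℂ)) +
      trigC L S b x) + (-1 : ℂ) * w x := by
    ext x; rw [defect_eq]; ring
  have m01 :
      Integrable (fun x => trigC L S (fun n => Complex.I * freq L n 0 * c n) x * (v x 0 : ℂ) +
      trigC L S (fun n => Complex.I * freq L n 1 * c n) x * (v x 1 : ℂ)) (cellMeas L) :=
    (m 0 _).add (m 1 _)
  have m01b : Integrable (fun x => trigC L S (fun n => Complex.I * freq L n 0 * c n) x *
      (v x 0 : ℂ) + trigC L S (fun n => Complex.I * freq L n 1 * c n) x * (v x 1 : ℂ) +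
      trigC L S b x) (cellMeas L) := m01.add mb
  rw [e, fc_add m01b (mw.const_mul _), fc_add m01 mb,
    fc_add (m 0 _) (m 1 _), fc_const_mul, fc_trigC hL, fc_trigC_mul _ _ (hi 0),
    fc_trigC_mul _ _ (hi 1), ← Finset.sum_add_distrib]
  have : ∑ l ∈ S, (Complex.I * freq L l 0 * c l * fc L (fun x => (v x 0 : ℂ)) (n - l) +
      Complex.I * freq L l 1 * c l * fc L (fun x => (v x 1 : ℂ)) (n - l)) =
      -∑ l ∈ S, (qc L (n - l) n : ℂ) * (z (n - l) * c l) := by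
    rw [← Finset.sum_neg_distrib]
    refine Finset.sum_congr rfl fun l _ => ?_
    have h0 : fc L (fun x => (v x 0 : ℂ)) (n - l) = _ := (hvz (n - l)).1
    have h1 : fc L (fun x => (v x 1 : ℂ)) (n - l) = _ := (hvz (n - l)).2
    rw [h0, h1, qc, cross_sub, sub_sub_cancel]
    push_cast
    simp only [div_eq_mul_inv]
    linear_combination (freq L l 0 * freq L (n - l) 1 - freq L l 1 * freq L (n - l) 0 : ℂ) *
      c l * z (n - l) * (lam L (n - l) : ℂ)⁻¹ * Complex.I_sq
  rw [this]
  ring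

/-- Parseval's identity for the `L²` norm. -/
lemma tsum_enorm_fc_sq (hL : ∀ i, 0 < L i) {h : Plane → ℂ} (hh : MemLp h 2 (cellMeas L)) :
    ∑' n, ‖fc L h n‖ₑ ^ 2 = ENNReal.ofReal ((L 0 * L 1)⁻¹ * ∫ x in cell L, ‖h x‖ ^ 2) := by
  have h1 := hasSum_conj_fc_mul_fc hL hh hh
  have e1 : ∀ c : ℂ, conj c * c = ((‖c‖ ^ 2 : ℝ) : ℂ) := fun c => by
    rw [Complex.conj_mul']; norm_cast
  simp only [e1] at h1
  rw [integral_complex_ofReal, ← Complex.ofReal_mul] at h1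
  have h2 := Complex.hasSum_ofReal.1 h1
  rw [← h2.tsum_eq, ENNReal.ofReal_tsum_of_nonneg (fun n => by positivity) h2.summable]
  refine tsum_congr fun n => ?_
  rw [ENNReal.ofReal_pow (norm_nonneg _), ofReal_norm]

lemma ofReal_integral_norm_sq (hL : ∀ i, 0 < L i) {h : Plane → ℂ} (hh : MemLp h 2 (cellMeas L)) :
    ENNReal.ofReal (∫ x in cell L, ‖h x‖ ^ 2) =
      ENNReal.ofReal (L 0 * L 1) * ∑' n, ‖fc L h n‖ₑ ^ 2 := by
  have h0 := hL 0
  have h1 := hL 1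
  rw [tsum_enorm_fc_sq hL hh, ← ENNReal.ofReal_mul (by positivity), ← mul_assoc,
    mul_inv_cancel₀ (by positivity), one_mul]

lemma add_add_sq_le (a b c : ℝ≥0∞) : (a + b + c) ^ 2 ≤ 3 * (a ^ 2 + b ^ 2 + c ^ 2) := by
  have := tsum_mul_sq_le ![a, b, c] fun _ => 1
  simp only [tsum_fintype, Fin.sum_univ_three, mul_one, one_pow] at this
  refine this.trans_eq ?_
  rw [mul_comm]
  simp only [Matrix.cons_val_zero, Matrix.cons_val_one, Matrix.cons_val]
  congr 1
  norm_num

/-- The sum of a family over the frequencies outside `S`. -/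
def tail (S : Finset (Fin 2 → ℤ)) (f : (Fin 2 → ℤ) → ℝ≥0∞) : ℝ≥0∞ :=
  ∑' n, (S : Set (Fin 2 → ℤ))ᶜ.indicator f n

/-- The tail of a family of functions with integrable sum tends to zero in `L¹`. -/
lemma tendsto_lintegral_tail {m : Measure ℝ} {h : (Fin 2 → ℤ) → ℝ → ℝ≥0∞}
    (hm : ∀ n, AEMeasurable (h n) m) (hfin : ∫⁻ t, ∑' n, h n t ∂m ≠ ⊤) :
    Tendsto (fun S => ∫⁻ t, tail S (fun n => h n t) ∂m) atTop (𝓝 0) := by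
  rw [lintegral_tsum hm] at hfin
  refine (ENNReal.tendsto_tsum_compl_atTop_zero hfin).congr fun S => ?_
  have e : ∀ t, tail S (fun n => h n t) = ∑' n : {n // n ∉ S}, h n t := fun t =>
    (tsum_subtype (S : Set (Fin 2 → ℤ))ᶜ fun n => h n t).symm
  simp only [e]
  exact (lintegral_tsum fun n : {n // n ∉ S} => hm n).symm

lemma tendsto_tail {f : (Fin 2 → ℤ) → ℝ≥0∞} (hf : ∑' n, f n ≠ ⊤) :
    Tendsto (fun S => tail S f) atTop (𝓝 0) :=
  (ENNReal.tendsto_tsum_compl_atTop_zero hf).congr fun S =>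
    tsum_subtype (S : Set (Fin 2 → ℤ))ᶜ f

lemma enorm_interaction_le (z : (Fin 2 → ℤ) → ℂ) (n l : Fin 2 → ℤ) :
    ‖(qc L (n - l) n : ℂ) * (z (n - l) * z l)‖ₑ ≤
      ENNReal.ofReal (‖z (n - l)‖ / kap L (n - l)) * ENNReal.ofReal (kap L l * ‖z l‖) := by
  have h1 := kap_nonneg (L := L) (n - l)
  have h2 := kap_nonneg (L := L) l
  rw [← ENNReal.ofReal_mul (by positivity), ← ofReal_norm]
  refine ENNReal.ofReal_le_ofReal ?_
  simp only [norm_mul, Complex.norm_real, Real.norm_eq_abs]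
  have := abs_qc_le' (L := L) (n - l) n
  rw [sub_sub_cancel] at this
  calc _ ≤ kap L l / kap L (n - l) * (‖z (n - l)‖ * ‖z l‖) := by gcongr
    _ = _ := by ring

lemma tsum_kap_norm_sq (z : (Fin 2 → ℤ) → ℂ) (s : Set (Fin 2 → ℤ)) :
    ∑' k, (s.indicator (fun l => ENNReal.ofReal (kap L l * ‖z l‖)) k) ^ 2 =
      ∑' k, s.indicator (fun l => ENNReal.ofReal (lam L l * ‖z l‖ ^ 2)) k := by
  refine tsum_congr fun k => ?_
  by_cases hk : k ∈ s
  · have := kap_nonneg (L := L) k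
    rw [indicator_of_mem hk, indicator_of_mem hk, ← ENNReal.ofReal_pow (by positivity), mul_pow,
      kap_sq]
  · simp [hk]

/-- The transport term is square integrable as soon as the velocity has an absolutely convergent
Fourier series and the vorticity is in `H¹`. -/
lemma tsum_enorm_conv_sq_le (z : (Fin 2 → ℤ) → ℂ) :
    ∑' n, ‖conv L z n‖ₑ ^ 2 ≤ (∑' n, ENNReal.ofReal (‖z n‖ / kap L n)) ^ 2 *
      ∑' n, ENNReal.ofReal (lam L n * ‖z n‖ ^ 2) := by
  have h := young_tsum (fun k => ENNReal.ofReal (‖z k‖ / kap L k))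
    fun l => ENNReal.ofReal (kap L l * ‖z l‖)
  have e := tsum_kap_norm_sq (L := L) z univ
  simp only [indicator_univ] at e
  rw [e] at h
  refine le_trans (ENNReal.tsum_le_tsum fun n => ?_) h
  gcongr
  exact enorm_conv_le z n

/-- The `L²` norm of the defect is controlled by the high frequencies. -/
lemma tsum_fc_defect_le (hL : ∀ i, 0 < L i) (S : Finset (Fin 2 → ℤ)) {v : Plane → Plane}
    (hv : ∀ i, MemLp (fun x => v x i) 2 (cellMeas L)) {z g : (Fin 2 → ℤ) → ℂ}
    (hvz : HasVorticity L v z) {σ : ℝ} (hσ : |σ| = 1) {w : Plane → ℝ}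
    (hw : MemLp w 2 (cellMeas L)) (hwg : ∀ n, fcr L w n = σ * g n)
    (hP : ∑' n, ENNReal.ofReal (‖z n‖ / kap L n) ≠ ⊤)
    (hE : ∑' n, ENNReal.ofReal (lam L n * ‖z n‖ ^ 2) ≠ ⊤) :
    ∑' n, ‖fc L (defect L S v (fun n => σ * z n) (fun n => σ * (g n + conv L z n)) w) n‖ₑ ^ 2 ≤
      3 * tail S fun n => (∑' n, ENNReal.ofReal (‖z n‖ / kap L n)) ^ 2 *
        ENNReal.ofReal (lam L n * ‖z n‖ ^ 2) + ‖conv L z n‖ₑ ^ 2 + ‖g n‖ₑ ^ 2 := by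
  classical
  set P := ∑' n, ENNReal.ofReal (‖z n‖ / kap L n)
  set a : (Fin 2 → ℤ) → ℝ≥0∞ := fun k => ENNReal.ofReal (‖z k‖ / kap L k) with ha
  set b : (Fin 2 → ℤ) → ℝ≥0∞ := fun l => ENNReal.ofReal (kap L l * ‖z l‖) with hb
  set Sc := (S : Set (Fin 2 → ℤ))ᶜ with hSc
  set q : (Fin 2 → ℤ) → (Fin 2 → ℤ) → ℂ := fun n l => (qc L (n - l) n : ℂ) * (z (n - l) * z l)
  have hswap : ∀ n (b : (Fin 2 → ℤ) → ℝ≥0∞), ∑' l, a (n - l) * b l = ∑' k, a k * b (n - k) := by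
    intro n b
    rw [← (Equiv.subLeft n).tsum_eq fun l => a (n - l) * b l]
    simp
  have hfin : ∀ n, ∑' l, a (n - l) * b l ≠ ⊤ := by
    intro n htop
    have h := young_tsum a b
    have e := tsum_kap_norm_sq (L := L) z univ
    simp only [indicator_univ] at e
    have h3 : ∑' n, (∑' k, a k * b (n - k)) ^ 2 ≠ ⊤ :=
      (h.trans_lt (by rw [e]; exact ENNReal.mul_lt_top (ENNReal.pow_lt_top hP.lt_top) hE.lt_top)).ne
    have h4 := ENNReal.ne_top_of_tsum_ne_top h3 n
    rw [← hswap, htop] at h4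
    simp at h4
  have hsum : ∀ n, Summable (q n) := by
    intro n
    have h1 : ∑' l, ‖q n l‖ₑ ≠ ⊤ := ne_top_of_le_ne_top (hfin n)
      (ENNReal.tsum_le_tsum fun l => enorm_interaction_le z n l)
    have h2 := ENNReal.summable_toReal h1
    simp only [toReal_enorm] at h2
    exact h2.of_norm
  have hconv : ∀ n, conv L z n = ∑ l ∈ S, q n l + ∑' l : Sc, q n l := by
    intro n
    rw [(hsum n).sum_add_tsum_compl, conv, ← (Equiv.subLeft n).tsum_eq]
    refine tsum_congr fun l => ?_
    simp [q]
  set T : (Fin 2 → ℤ) → ℝ≥0∞ := fun n => ∑' l, a (n - l) * Sc.indicator b l with hT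
  have htail : ∀ n, ‖∑' l : Sc, q n l‖ₑ ≤ T n := by
    intro n
    refine enorm_tsum_le_tsum_enorm.trans ?_
    rw [tsum_subtype Sc fun l => ‖q n l‖ₑ]
    refine ENNReal.tsum_le_tsum fun l => ?_
    by_cases hl : l ∈ Sc
    · rw [indicator_of_mem hl, indicator_of_mem hl]
      exact enorm_interaction_le z n l
    · simp [hl]
  have hσe : ‖(σ : ℂ)‖ₑ = 1 := by
    rw [← ofReal_norm, Complex.norm_real, Real.norm_eq_abs, hσ, ENNReal.ofReal_one]
  have hpt : ∀ n, ‖fc L (defect L S v (fun n => σ * z n) (fun n => σ * (g n + conv L z n)) w) n‖ₑ ≤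
      T n + Sc.indicator (fun n => ‖conv L z n‖ₑ) n + Sc.indicator (fun n => ‖g n‖ₑ) n := by
    intro n
    rw [fc_defect hL S hv hvz _ _ hw, hwg]
    have e : ∑ l ∈ S, (qc L (n - l) n : ℂ) * (z (n - l) * (σ * z l)) = σ * ∑ l ∈ S, q n l := by
      rw [Finset.mul_sum]
      exact Finset.sum_congr rfl fun l _ => by ring
    rw [e]
    by_cases hn : n ∈ S
    · have hn' : n ∉ Sc := by simpa [hSc] using hn
      rw [indicator_of_mem (by simpa using hn), indicator_of_notMem hn', indicator_of_notMem hn',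
        add_zero, add_zero]
      have : (σ : ℂ) * (g n + conv L z n) - σ * ∑ l ∈ S, q n l - σ * g n =
          σ * ∑' l : Sc, q n l := by rw [hconv]; ring
      rw [this, enorm_mul, hσe, one_mul]
      exact htail n
    · have hn' : n ∈ Sc := by simpa [hSc] using hn
      rw [indicator_of_notMem (by simpa using hn), indicator_of_mem hn', indicator_of_mem hn']
      have : 0 - (σ : ℂ) * ∑ l ∈ S, q n l - σ * g n =
          σ * (∑' l : Sc, q n l + -conv L z n + -g n) := by rw [hconv]; ring
      rw [this, enorm_mul, hσe, one_mul]
      refine (enorm_add_le _ _).trans ?_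
      rw [enorm_neg]
      gcongr
      refine (enorm_add_le _ _).trans ?_
      rw [enorm_neg]
      gcongr
      exact htail n
  have hYoung : ∑' n, T n ^ 2 ≤
      P ^ 2 * ∑' n, Sc.indicator (fun l => ENNReal.ofReal (lam L l * ‖z l‖ ^ 2)) n := by
    rw [← tsum_kap_norm_sq]
    refine le_trans (le_of_eq (tsum_congr fun n => ?_)) (young_tsum a (Sc.indicator b))
    rw [hT, ← hswap]
  calc _ ≤ ∑' n, 3 * (T n ^ 2 + (Sc.indicator (fun n => ‖conv L z n‖ₑ) n) ^ 2 +
          (Sc.indicator (fun n => ‖g n‖ₑ) n) ^ 2) :=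
        ENNReal.tsum_le_tsum fun n => (pow_le_pow_left' (hpt n) 2).trans (add_add_sq_le _ _ _)
    _ = 3 * (∑' n, T n ^ 2 + ∑' n, (Sc.indicator (fun n => ‖conv L z n‖ₑ) n) ^ 2 +
          ∑' n, (Sc.indicator (fun n => ‖g n‖ₑ) n) ^ 2) := by
        rw [ENNReal.tsum_mul_left, ENNReal.tsum_add, ENNReal.tsum_add]
    _ ≤ 3 * (P ^ 2 * ∑' n, Sc.indicator (fun l => ENNReal.ofReal (lam L l * ‖z l‖ ^ 2)) n +
          ∑' n, (Sc.indicator (fun n => ‖conv L z n‖ₑ) n) ^ 2 +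
          ∑' n, (Sc.indicator (fun n => ‖g n‖ₑ) n) ^ 2) := by gcongr
    _ = _ := by
        rw [← ENNReal.tsum_mul_left, ← ENNReal.tsum_add, ← ENNReal.tsum_add, tail, ← hSc]
        congr 1
        refine tsum_congr fun n => ?_
        by_cases hn : n ∈ Sc <;> simp [hn]

lemma fcr_const_mul (σ : ℝ) (w : Plane → ℝ) (n) : fcr L (fun x => σ * w x) n = σ * fcr L w n := by
  rw [fcr, ← fc_const_mul]
  simp

lemma enorm_sq_eq_ofReal (c : ℂ) : ‖c‖ₑ ^ 2 = ENNReal.ofReal (‖c‖ ^ 2) := by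
  rw [ENNReal.ofReal_pow (norm_nonneg _), ofReal_norm]

lemma trig_le_tsum (S) {c : (Fin 2 → ℤ) → ℂ} (hc : Summable fun n => ‖c n‖) (x : Plane) :
    trig L S c x ≤ ∑' n, ‖c n‖ :=
  (Finset.sum_le_sum fun n _ => (le_abs_self _).trans (abs_cos_term_le (c n) _)).trans
    (hc.sum_le_tsum S fun _ _ => norm_nonneg _)

/-- The positive part of a square integrable function above a level, compared with that of a
truncation of its Fourier series. -/
lemma lintegral_posPart_le (hL : ∀ i, 0 < L i) (S) {c : (Fin 2 → ℤ) → ℂ} {w : Plane → ℝ}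
    (hw : MemLp w 2 (cellMeas L)) (hwc : ∀ n, fcr L w n = c n) (k : ℝ) {η : ℝ} (hη : 0 < η) :
    ∫⁻ x in cell L, ENNReal.ofReal (posPart (w x - k)) ≤
      ENNReal.ofReal (∫ x in cell L, posPart (trig L S c x - k)) +
        ENNReal.ofReal η * volume (cell L) +
        ENNReal.ofReal ((4 * η)⁻¹ * (L 0 * L 1)) * tail S fun n => ENNReal.ofReal (‖c n‖ ^ 2) := by
  classical
  have h0 := hL 0
  have h1 := hL 1
  set D : Plane → ℂ := fun x => trigC L S c x + (-1 : ℂ) * (w x : ℂ) with hD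
  have hDm : MemLp D 2 (cellMeas L) :=
    (memLp_two_of_continuous' (continuous_trigC S c)).add ((memLp_ofReal hw).const_mul _)
  have hpt : ∀ x, ENNReal.ofReal (posPart (w x - k)) ≤
      ENNReal.ofReal (posPart (trig L S c x - k)) + ENNReal.ofReal η +
        ENNReal.ofReal (4 * η)⁻¹ * ENNReal.ofReal (‖D x‖ ^ 2) := by
    intro x
    have hp := posPart_nonneg (trig L S c x - k)
    rw [← ENNReal.ofReal_mul (by positivity), ← ENNReal.ofReal_add hp hη.le,
      ← ENNReal.ofReal_add (by positivity) (by positivity)]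
    refine ENNReal.ofReal_le_ofReal ?_
    have h1 := posPart_sub_le (w x - k) (trig L S c x - k)
    have h2 : |w x - k - (trig L S c x - k)| ≤ ‖D x‖ := by
      have : w x - k - (trig L S c x - k) = -(D x).re := by
        rw [← re_trigC]; simp [hD]; ring
      rw [this, abs_neg]
      exact Complex.abs_re_le_norm _
    -- The volume of the cell is finite, so that a constant `η` trades the `L¹` norm of the
    -- truncation error for its squared `L²` norm, which Parseval's identity computes.
    have h3 : ‖D x‖ ≤ η + (4 * η)⁻¹ * ‖D x‖ ^ 2 := by
      rw [← sub_le_iff_le_add', inv_mul_eq_div, le_div_iff₀ (by positivity)]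
      nlinarith [sq_nonneg (‖D x‖ - 2 * η)]
    linarith
  have hfcD : ∀ n, ‖fc L D n‖ₑ ^ 2 =
      (S : Set (Fin 2 → ℤ))ᶜ.indicator (fun n => ENNReal.ofReal (‖c n‖ ^ 2)) n := by
    intro n
    have hc : fc L (fun x => (w x : ℂ)) n = c n := hwc n
    have hi : Integrable (trigC L S c) (cellMeas L) :=
      (continuous_trigC S c).continuousOn.integrableOn_compact isCompact_Icc
    rw [hD, fc_add hi
      (((memLp_ofReal hw).integrable (by norm_num)).const_mul _), fc_const_mul, fc_trigC hL, hc]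
    by_cases hn : n ∈ (S : Set (Fin 2 → ℤ))
    · rw [indicator_of_mem hn, indicator_of_notMem (by simpa using hn), neg_one_mul,
        add_neg_cancel, enorm_zero, zero_pow two_ne_zero]
    · rw [indicator_of_notMem hn, indicator_of_mem (mem_compl hn), zero_add, neg_one_mul,
        enorm_neg, enorm_sq_eq_ofReal]
  have hcont : Continuous fun x => posPart (trig L S c x - k) :=
    contDiff_posPart.continuous.comp (((contDiff_trig S c (k := 0)).continuous).sub
      continuous_const)
  have hci : Integrable (fun x => posPart (trig L S c x - k)) (cellMeas L) :=
    hcont.continuousOn.integrableOn_compact isCompact_Icc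
  have hm : Measurable fun x => ENNReal.ofReal (posPart (trig L S c x - k)) + ENNReal.ofReal η :=
    hcont.measurable.ennreal_ofReal.add measurable_const
  refine (lintegral_mono hpt).trans_eq ?_
  rw [lintegral_add_left hm, lintegral_add_right _ measurable_const, lintegral_const,
    lintegral_const_mul' _ _ ENNReal.ofReal_ne_top, Measure.restrict_apply_univ,
    ← ofReal_integral_eq_lintegral_ofReal hci (ae_of_all _ fun x => posPart_nonneg _),
    ← ofReal_integral_eq_lintegral_ofReal (hDm.integrable_norm_pow' (p := 2))
      (ae_of_all _ fun x => by positivity), ofReal_integral_norm_sq hL hDm, ← mul_assoc,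
    ← ENNReal.ofReal_mul (by positivity)]
  simp only [hfcD, tail]

namespace VorticityModes

variable {ν μ T₀ G : ℝ} {z g : ℝ → (Fin 2 → ℤ) → ℂ}

/-- The high frequencies which enter the defect tend to zero in the mean over time. -/
lemma tendsto_lintegral_tail_defect (h : VorticityModes L ν μ T₀ G z g) {t₂ t : ℝ} (h₂ : T₀ ≤ t₂)
    (ht : t₂ ≤ t) {K : ℝ≥0∞} (hK : K ≠ ⊤)
    (hP : ∀ s ∈ Icc t₂ t, ∑' n, ENNReal.ofReal (‖z s n‖ / kap L n) ≤ K)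
    (hE : ∫⁻ s in Ioc t₂ t, ∑' n, ENNReal.ofReal (lam L n * ‖z s n‖ ^ 2) ≤ K) :
    Tendsto (fun S => ∫⁻ s in Ioc t₂ t, tail S fun n =>
      K ^ 2 * ENNReal.ofReal (lam L n * ‖z s n‖ ^ 2) + ‖conv L (z s) n‖ₑ ^ 2 + ‖g s n‖ₑ ^ 2)
      atTop (𝓝 0) := by
  have h0 : 0 ≤ t₂ := h.nonneg.trans h₂
  refine tendsto_lintegral_tail (fun n => ?_) ?_
  · exact (((h.aemeasurable_term _ n _).const_mul _).add
      ((h.aemeasurable_conv n h0 ht).enorm.pow_const 2)).add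
      ((h.aemeasurable_force n h0 ht).enorm.pow_const 2)
  · have hle : ∀ᵐ s ∂(volume.restrict (Ioc t₂ t)), ∑' n,
        (K ^ 2 * ENNReal.ofReal (lam L n * ‖z s n‖ ^ 2) + ‖conv L (z s) n‖ₑ ^ 2 + ‖g s n‖ₑ ^ 2) ≤
        2 * K ^ 2 * (∑' n, ENNReal.ofReal (lam L n * ‖z s n‖ ^ 2)) + ENNReal.ofReal (G ^ 2) := by
      refine (ae_restrict_iff' measurableSet_Ioc).2 ?_
      filter_upwards [h.force] with s hs hsm
      rw [ENNReal.tsum_add, ENNReal.tsum_add, ENNReal.tsum_mul_left, two_mul, add_mul]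
      refine add_le_add (add_le_add le_rfl ?_) ?_
      · refine (tsum_enorm_conv_sq_le _).trans ?_
        gcongr
        exact hP s ⟨hsm.1.le, hsm.2⟩
      · simp only [enorm_sq_eq_ofReal]
        exact hs (h₂.trans hsm.1.le)
    refine ne_top_of_le_ne_top ?_ (lintegral_mono_ae hle)
    rw [lintegral_add_right _ measurable_const, lintegral_const,
      lintegral_const_mul' _ _ (by finiteness)]
    refine ENNReal.add_ne_top.2 ⟨ENNReal.mul_ne_top (by finiteness)
      (ne_top_of_le_ne_top hK hE), ENNReal.mul_ne_top ENNReal.ofReal_ne_top ?_⟩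
    simp

/-- The maximum principle for the vorticity: the level `M + C e^{-μ (t - t₂)}` with
`μ M > ‖rot f‖_∞`, which solves the ordinary differential equation obtained by dropping diffusion
and transport, is never exceeded. The sign `σ` gives the bound from both sides. -/
theorem vorticity_le (hL : ∀ i, 0 < L i) (hν : 0 < ν) (hμ : 0 < μ)
    (h : VorticityModes L ν μ T₀ G z g) {t₂ t : ℝ} (h₂ : T₀ ≤ t₂) (ht : t₂ ≤ t)
    (hsum : Summable fun n => ‖z t₂ n‖) {K : ℝ≥0∞} (hK : K ≠ ⊤)
    (hP : ∀ s ∈ Icc t₂ t, ∑' n, ENNReal.ofReal (‖z s n‖ / kap L n) ≤ K)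
    (hE : ∫⁻ s in Ioc t₂ t, ∑' n, ENNReal.ofReal (lam L n * ‖z s n‖ ^ 2) ≤ K)
    {v : ℝ → Plane → Plane}
    (hv : ∀ᵐ s : ℝ, t₂ < s → MemH L (v s) ∧ HasVorticity L (v s) (z s)) {A : ℝ} (hA : 0 ≤ A)
    (hw : ∀ᵐ s : ℝ, t₂ < s → ∃ w : Plane → ℝ, MemLp w 2 (cellMeas L) ∧
      (∀ n, fcr L w n = g s n) ∧ ∀ᵐ x ∂cellMeas L, |w x| ≤ A)
    {ε M : ℝ} (hε : 0 < ε) (hM : μ * M = A + ε) {σ : ℝ} (hσ : |σ| = 1) {W : Plane → ℝ}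
    (hW : MemLp W 2 (cellMeas L)) (hWz : ∀ n, fcr L W n = z t n) :
    ∀ᵐ x ∂cellMeas L, σ * W x ≤ M + (∑' n, ‖z t₂ n‖) * Real.exp (-μ * (t - t₂)) := by
  have hL0 := hL 0
  have hL1 := hL 1
  have h0 : 0 ≤ t₂ := h.nonneg.trans h₂
  have hM0 : 0 ≤ M := by
    by_contra hneg
    nlinarith
  set C := ∑' n, ‖z t₂ n‖ with hC
  set k : ℝ → ℝ := fun s => M + C * Real.exp (-μ * (s - t₂)) with hk
  have hkd : ∀ s, HasDerivAt k (-(μ * (k s - M))) s := by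
    intro s
    have h1 : HasDerivAt (fun s => -μ * (s - t₂)) (-μ * 1) s :=
      ((hasDerivAt_id s).sub_const t₂).const_mul _
    convert! (h1.exp.const_mul C).const_add M using 1
    simp only [hk]; ring
  have hkc : Continuous k := continuous_iff_continuousAt.2 fun s => (hkd s).continuousAt
  set y : ℝ → (Fin 2 → ℤ) → ℂ := fun s n => σ * z s n with hy
  set b : ℝ → (Fin 2 → ℤ) → ℂ := fun s n => σ * (g s n + conv L (z s) n) with hb
  set r : ℝ → (Fin 2 → ℤ) → ℂ := fun s n => -((ν * lam L n + μ : ℝ) : ℂ) * y s n + b s n with hr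
  have hr_eq : ∀ n s, r s n = σ * modeRhs L ν μ (z s) (g s) n := fun n s => by
    simp only [hr, hy, hb, modeRhs]; ring
  have hrate : ∀ S, ENNReal.ofReal (∫ x in cell L, posPart (trig L S (y t) x - k t)) ≤
      ENNReal.ofReal ((4 * ε)⁻¹ * (L 0 * L 1)) * 3 * ∫⁻ s in Ioc t₂ t, tail S fun n =>
        K ^ 2 * ENNReal.ofReal (lam L n * ‖z s n‖ ^ 2) + ‖conv L (z s) n‖ₑ ^ 2 + ‖g s n‖ₑ ^ 2 := by
    intro S
    obtain ⟨hint, heq⟩ := integral_posPart_eq (L := L) (S := S) (y := y) (r := r) ht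
      (fun n => continuous_const.mul (h.cont n))
      (fun n => ((h.rhs_int' n h0 ht).const_mul (σ : ℂ)).congr fun s _ => (hr_eq n s).symm)
      (fun n s hs => by
        simp only [hr_eq, hy]
        rw [intervalIntegral.integral_const_mul, ← mul_add, ← h.eq' n h0 hs.1])
      hkd (by fun_prop)
    -- The initial level dominates every truncation, by absolute convergence at `t₂`.
    have hstart : ∫ x in cell L, posPart (trig L S (y t₂) x - k t₂) = 0 := by
      refine integral_eq_zero_of_ae (ae_of_all _ fun x => posPart_of_nonpos ?_)
      have hny : ∀ n, ‖y t₂ n‖ = ‖z t₂ n‖ := fun n => by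
        simp only [hy, norm_mul, Complex.norm_real, Real.norm_eq_abs, hσ, one_mul]
      have h1 := trig_le_tsum (L := L) S (c := y t₂) (by simpa only [hny] using hsum) x
      simp only [hny] at h1
      simp only [hk, sub_self, mul_zero, Real.exp_zero, mul_one]
      linarith
    rw [heq, hstart, zero_add]
    refine (ofReal_integral_le_lintegral hint).trans ?_
    rw [mul_assoc, ← lintegral_const_mul' _ _ (by finiteness),
      ← lintegral_const_mul' _ _ (by finiteness)]
    refine lintegral_mono_ae ?_
    have hEfin := ae_lt_top (h.measurable_tsum (lam L)) (ne_top_of_le_ne_top hK hE)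
    have hv' := ae_restrict_of_ae (s := Ioc t₂ t) hv
    have hw' := ae_restrict_of_ae (s := Ioc t₂ t) hw
    filter_upwards [hEfin, hv', hw', ae_restrict_mem measurableSet_Ioc] with s hsE hsv hsw hsm
    obtain ⟨hvH, hvz⟩ := hsv hsm.1
    obtain ⟨w, hw2, hwg, hwA⟩ := hsw hsm.1
    have hσw : MemLp (fun x => σ * w x) 2 (cellMeas L) := hw2.const_mul σ
    have hσwA : ∀ᵐ x ∂cellMeas L, σ * w x ≤ A := by
      filter_upwards [hwA] with x hx
      refine (le_abs_self _).trans ?_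
      rw [abs_mul, hσ, one_mul]
      exact hx
    have h1 := integral_step_mul_rate_le hL (k := k s) hν.le hμ.le hε hvH S (y s) (b s) hσw hσwA hM
    have hPs := hP s ⟨hsm.1.le, hsm.2⟩
    have h2 := tsum_fc_defect_le hL S hvH.memLp hvz hσ hσw
      (fun n => by rw [fcr_const_mul, hwg]) (ne_top_of_le_ne_top hK hPs) hsE.ne
    have hD := memLp_defect S hvH.memLp (y s) (b s) hσw
    simp only [sub_neg_eq_add]
    refine (ENNReal.ofReal_le_ofReal h1).trans ?_
    rw [ENNReal.ofReal_mul (by positivity), ofReal_integral_norm_sq hL hD, ← mul_assoc,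
      ← ENNReal.ofReal_mul (by positivity)]
    gcongr
    refine h2.trans ?_
    gcongr
    rw [tail, tail]
    refine ENNReal.tsum_le_tsum fun n => indicator_le_indicator ?_
    gcongr
  have htail := h.tendsto_lintegral_tail_defect h₂ ht hK hP hE
  have hσW : MemLp (fun x => σ * W x) 2 (cellMeas L) := hW.const_mul σ
  have hσz : ∀ n, fcr L (fun x => σ * W x) n = y t n := fun n => by
    rw [fcr_const_mul, hWz]
  have hsq : ∑' n, ENNReal.ofReal (‖y t n‖ ^ 2) ≠ ⊤ := by
    have h1 := tsum_enorm_fc_sq hL (memLp_ofReal hσW)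
    have h2 : ∀ n, fc L (fun x => ((σ * W x : ℝ) : ℂ)) n = y t n := hσz
    simp only [h2, enorm_sq_eq_ofReal] at h1
    rw [h1]; exact ENNReal.ofReal_ne_top
  -- The limit over the finite sets `S` of frequencies comes first, then `η → 0`.
  have hη : ∀ η > 0, ∫⁻ x in cell L, ENNReal.ofReal (posPart (σ * W x - k t)) ≤
      ENNReal.ofReal η * volume (cell L) := by
    intro η hη
    have hlim : Tendsto (fun S => ENNReal.ofReal ((4 * ε)⁻¹ * (L 0 * L 1)) * 3 *
        (∫⁻ s in Ioc t₂ t, tail S fun n => K ^ 2 * ENNReal.ofReal (lam L n * ‖z s n‖ ^ 2) +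
          ‖conv L (z s) n‖ₑ ^ 2 + ‖g s n‖ₑ ^ 2) + ENNReal.ofReal η * volume (cell L) +
        ENNReal.ofReal ((4 * η)⁻¹ * (L 0 * L 1)) * tail S fun n => ENNReal.ofReal (‖y t n‖ ^ 2))
        atTop (𝓝 (ENNReal.ofReal ((4 * ε)⁻¹ * (L 0 * L 1)) * 3 * 0 +
          ENNReal.ofReal η * volume (cell L) +
          ENNReal.ofReal ((4 * η)⁻¹ * (L 0 * L 1)) * 0)) :=
      ((ENNReal.Tendsto.const_mul htail (Or.inr (by finiteness))).add tendsto_const_nhds).add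
        (ENNReal.Tendsto.const_mul (tendsto_tail hsq) (Or.inr (by finiteness)))
    rw [mul_zero, mul_zero, zero_add, add_zero] at hlim
    refine ge_of_tendsto' hlim fun S => ?_
    refine (lintegral_posPart_le hL S hσW hσz (k t) hη).trans ?_
    gcongr
    exact hrate S
  have hzero : ∫⁻ x in cell L, ENNReal.ofReal (posPart (σ * W x - k t)) = 0 := by
    have hvol : volume (cell L) ≠ ⊤ := isCompact_Icc.measure_ne_top
    have hlim : Tendsto (fun η : ℝ => ENNReal.ofReal η * volume (cell L)) (𝓝[>] 0)
        (𝓝 (ENNReal.ofReal 0 * volume (cell L))) :=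
      ENNReal.Tendsto.mul_const ((ENNReal.continuous_ofReal.tendsto 0).mono_left
        nhdsWithin_le_nhds) (Or.inr hvol)
    rw [ENNReal.ofReal_zero, zero_mul] at hlim
    exact le_antisymm (ge_of_tendsto hlim (eventually_mem_nhdsWithin.mono hη)) bot_le
  have hm : AEMeasurable (fun x => ENNReal.ofReal (posPart (σ * W x - k t))) (cellMeas L) :=
    (contDiff_posPart.continuous.measurable.comp_aemeasurable
      (hσW.aestronglyMeasurable.aemeasurable.sub_const _)).ennreal_ofReal
  filter_upwards [(lintegral_eq_zero_iff' hm).1 hzero] with x hx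
  by_contra hlt
  push Not at hlt
  have := posPart_pos (sub_pos.2 hlt)
  simp only [Pi.zero_apply, ENNReal.ofReal_eq_zero] at hx
  linarith

end VorticityModes

/-! ### The vorticity coefficients of a vector field -/

/-- The Fourier coefficients of the rotation of a vector field. -/
def rotc (L : Plane) (v : Plane → Plane) (n : Fin 2 → ℤ) : ℂ :=
  Complex.I * freq L n 0 * fcr L (fun x => v x 1) n -
    Complex.I * freq L n 1 * fcr L (fun x => v x 0) n

lemma rotc_zero (v : Plane → Plane) : rotc L v 0 = 0 := by
  simp [rotc, freq_zero]

lemma MemL2Dot.integrable {v : Plane → Plane} (hv : MemL2Dot L v) (i) :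
    Integrable (fun x => v x i) (cellMeas L) := (hv.memLp i).integrable (by norm_num)

lemma rotc_neg {v : Plane → Plane} (hv : MemL2Dot L v) (n) : rotc L v (-n) = conj (rotc L v n) := by
  rw [rotc, rotc, fcr_neg (hv.integrable 1), fcr_neg (hv.integrable 0), freq_neg, freq_neg]
  simp only [map_sub, map_mul, Complex.conj_I, Complex.conj_ofReal]
  push_cast; ring

lemma fcr_neg_fun (w : Plane → ℝ) (n) : fcr L (fun x => -w x) n = -fcr L w n := by
  have := fcr_const_mul (L := L) (-1) w n
  simpa using this

lemma IsWeakRot.fcr_eq (hL : ∀ i, 0 < L i) {v : Plane → Plane} (hv : MemL2Dot L v) {w : Plane → ℝ}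
    (hw : IsWeakRot L v w) (n) : fcr L w n = rotc L v n := by
  have := fcr_of_weak hL (hv.integrable 1) (hv.integrable 0).neg hw.1 (fun η hη => by
    rw [← hw.2 η hη]
    congr 1; ext x
    simp only [Pi.neg_apply]; ring) n
  rw [this, rotc]
  have e : fcr L (-fun x => v x 0) n = -fcr L (fun x => v x 0) n := fcr_neg_fun _ n
  rw [e]; ring

lemma isWeakRot_of_fcr (hL : ∀ i, 0 < L i) {v : Plane → Plane} (hv : MemL2Dot L v) {w : Plane → ℝ}
    (hw : MemLp w 2 (cellMeas L)) (h : ∀ n, fcr L w n = rotc L v n) : IsWeakRot L v w := by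
  refine ⟨hw.integrable (by norm_num), fun η hη => ?_⟩
  have := weak_of_fcr hL (hv.memLp 1) (hv.memLp 0).neg hw (fun n => by
    have e : fcr L (-fun x => v x 0) n = -fcr L (fun x => v x 0) n := fcr_neg_fun _ n
    rw [h, rotc, e]; ring) hη
  rw [← this]
  congr 1; ext x
  simp only [Pi.neg_apply]; ring

/-- The Biot-Savart law on the Fourier side. -/
lemma MemH.hasVorticity (hL : ∀ i, 0 < L i) {v : Plane → Plane} (hv : MemH L v) :
    HasVorticity L v (rotc L v) := by
  intro k
  have hdiv := fcr_of_weak hL (hv.integrable 0) (hv.integrable 1) (integrable_zero _ _ _)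
    (fun η hη => by
      have := hv.div_eq_zero η hη
      simp only [Fin.sum_univ_two] at this
      simpa using this) k
  have hz : fcr L (0 : Plane → ℝ) k = 0 := by simp [fcr, fc]
  rw [hz] at hdiv
  rcases eq_or_ne k 0 with rfl | hk
  · have h0 : ∀ i, fcr L (fun x => v x i) 0 = 0 := fun i => by
      rw [PeriodicNS.fcr_eq (hv.integrable i)]
      simp [phase, freq_zero, hv.mean_eq_zero i]
    rw [h0, h0]
    simp [freq_zero]
  · have hlam : (lam L k : ℂ) ≠ 0 := by exact_mod_cast (lam_pos hL hk).ne'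
    have hl : (lam L k : ℂ) = (freq L k 0 : ℂ) ^ 2 + (freq L k 1 : ℂ) ^ 2 := by
      rw [lam]; push_cast; ring
    have hd : (freq L k 0 : ℂ) * fcr L (fun x => v x 0) k + freq L k 1 * fcr L (fun x => v x 1) k =
        0 := by
      have := congrArg (fun c => -Complex.I * c) hdiv
      simp only [mul_zero] at this
      linear_combination (-1 : ℂ) * this + ((freq L k 0 : ℂ) * fcr L (fun x => v x 0) k +
        freq L k 1 * fcr L (fun x => v x 1) k) * Complex.I_sq
    constructor
    · rw [eq_div_iff hlam, rotc, hl]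
      linear_combination (freq L k 0 : ℂ) * hd +
        ((freq L k 1 : ℂ) ^ 2 * fcr L (fun x => v x 0) k -
          (freq L k 0 : ℂ) * freq L k 1 * fcr L (fun x => v x 1) k) * Complex.I_sq
    · rw [← neg_div, eq_div_iff hlam, rotc, hl]
      linear_combination (freq L k 1 : ℂ) * hd +
        ((freq L k 0 : ℂ) ^ 2 * fcr L (fun x => v x 1) k -
          (freq L k 0 : ℂ) * freq L k 1 * fcr L (fun x => v x 0) k) * Complex.I_sq

lemma HasVorticity.norm_sq_div (hL : ∀ i, 0 < L i) {v : Plane → Plane} {z : (Fin 2 → ℤ) → ℂ}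
    (h : HasVorticity L v z) (n) : ‖z n‖ ^ 2 / lam L n =
      ‖fcr L (fun x => v x 0) n‖ ^ 2 + ‖fcr L (fun x => v x 1) n‖ ^ 2 := by
  rw [(h n).1, (h n).2]
  rcases eq_or_ne n 0 with rfl | hn
  · simp [lam_zero]
  have hl := lam_pos hL hn
  simp only [norm_neg, norm_div, norm_mul, Complex.norm_I, one_mul, Complex.norm_real,
    Real.norm_eq_abs, div_pow, mul_pow, sq_abs, ← add_div, ← add_mul]
  rw [show freq L n 1 ^ 2 + freq L n 0 ^ 2 = lam L n by rw [lam]; ring]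
  field_simp

/-- Parseval's identity in terms of the lower Lebesgue integral. -/
lemma tsum_enorm_fcr_sq (hL : ∀ i, 0 < L i) {w : Plane → ℝ} (hw : MemLp w 2 (cellMeas L)) :
    ∑' n, ‖fcr L w n‖ₑ ^ 2 = ENNReal.ofReal (L 0 * L 1)⁻¹ * ∫⁻ x in cell L, ‖w x‖ₑ ^ 2 := by
  have h0 := hL 0
  have h1 := hL 1
  rw [tsum_enorm_fc_sq hL (memLp_ofReal hw), ENNReal.ofReal_mul (by positivity),
    ofReal_integral_eq_lintegral_ofReal ((memLp_ofReal hw).integrable_norm_pow' (p := 2))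
      (ae_of_all _ fun x => by positivity)]
  congr 1
  refine lintegral_congr fun x => ?_
  rw [Complex.norm_real, ENNReal.ofReal_pow (norm_nonneg _), ofReal_norm]

lemma MemH.tsum_div_lam_le (hL : ∀ i, 0 < L i) {v : Plane → Plane} (hv : MemH L v) {C : ℝ}
    (hC : ∀ i, ∫ x in cell L, v x i ^ 2 ≤ C) :
    ∑' n, ENNReal.ofReal (‖rotc L v n‖ ^ 2 / lam L n) ≤
      ENNReal.ofReal ((L 0 * L 1)⁻¹ * (C + C)) := by
  have h0 := hL 0
  have h1 := hL 1
  have hC0 : 0 ≤ C := (integral_nonneg fun x => sq_nonneg _).trans (hC 0)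
  have hi : ∀ i, ∫⁻ x in cell L, ‖v x i‖ₑ ^ 2 ≤ ENNReal.ofReal C := by
    intro i
    refine le_trans (le_of_eq ?_) (ENNReal.ofReal_le_ofReal (hC i))
    rw [ofReal_integral_eq_lintegral_ofReal (hv.memLp i).integrable_sq
      (ae_of_all _ fun x => sq_nonneg _)]
    refine lintegral_congr fun x => ?_
    rw [← sq_abs, ← Real.norm_eq_abs, ENNReal.ofReal_pow (norm_nonneg _), ofReal_norm]
  have e : ∀ n, ENNReal.ofReal (‖rotc L v n‖ ^ 2 / lam L n) =
      ‖fcr L (fun x => v x 0) n‖ₑ ^ 2 + ‖fcr L (fun x => v x 1) n‖ₑ ^ 2 := fun n => by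
    rw [(hv.hasVorticity hL).norm_sq_div hL, ENNReal.ofReal_add (by positivity) (by positivity),
      enorm_sq_eq_ofReal, enorm_sq_eq_ofReal]
  simp only [e]
  rw [ENNReal.tsum_add, tsum_enorm_fcr_sq hL (hv.memLp 0), tsum_enorm_fcr_sq hL (hv.memLp 1),
    ← mul_add, ENNReal.ofReal_mul (by positivity), ENNReal.ofReal_add hC0 hC0]
  gcongr
  · exact hi 0
  · exact hi 1

/-- The Fourier coefficients of a product of square integrable functions. -/
lemma hasSum_fcr_mul (hL : ∀ i, 0 < L i) {a b : Plane → ℝ} (ha : MemLp a 2 (cellMeas L))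
    (hb : MemLp b 2 (cellMeas L)) (n) :
    HasSum (fun k => fcr L a (n - k) * fcr L b k) (fcr L (fun x => a x * b x) n) := by
  have h := hasSum_conj_fc_mul_fc hL
      (memLp_mul_cont ha (continuous_expo (L := L) n)) (memLp_ofReal hb)
  have e1 : ∀ k, conj (fc L (fun x => expo L n x * (a x : ℂ)) k) = fcr L a (n - k) := fun k => by
    rw [fc_expo_mul, ← neg_sub k n, fcr_neg (ha.integrable (by norm_num))]
  simp only [e1] at h
  convert h using 1
  rw [fcr, fc]
  congr 2
  ext x
  rw [map_mul, Complex.conj_ofReal]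
  push_cast; ring

/-- The part of the transport term which is antisymmetric under the exchange of the two interacting
modes drops out. -/
lemma tsum_antisymm_eq_zero (z : (Fin 2 → ℤ) → ℂ) (n) :
    ∑' k, (((freq L (n - k) 1 * freq L k 0 - freq L (n - k) 0 * freq L k 1) *
      (freq L (n - k) 0 * freq L k 0 + freq L (n - k) 1 * freq L k 1) /
      (lam L (n - k) * lam L k) : ℝ) : ℂ) * (z (n - k) * z k) = 0 := by
  set d : (Fin 2 → ℤ) → ℂ := fun k =>
    (((freq L (n - k) 1 * freq L k 0 - freq L (n - k) 0 * freq L k 1) *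
      (freq L (n - k) 0 * freq L k 0 + freq L (n - k) 1 * freq L k 1) /
      (lam L (n - k) * lam L k) : ℝ) : ℂ) * (z (n - k) * z k)
  have h : ∑' k, d k = -∑' k, d k := by
    rw [← tsum_neg, ← (Equiv.subLeft n).tsum_eq]
    refine tsum_congr fun k => ?_
    simp only [d, Equiv.subLeft_apply, sub_sub_cancel]
    push_cast
    simp only [div_eq_mul_inv, mul_inv]
    ring
  exact self_eq_neg.1 h

lemma summable_antisymm {z : (Fin 2 → ℤ) → ℂ} (hz : Summable fun n => ‖z n‖ ^ 2) (n) :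
    Summable fun k => (((freq L (n - k) 1 * freq L k 0 - freq L (n - k) 0 * freq L k 1) *
      (freq L (n - k) 0 * freq L k 0 + freq L (n - k) 1 * freq L k 1) /
      (lam L (n - k) * lam L k) : ℝ) : ℂ) * (z (n - k) * z k) := by
  have h1 : Summable fun k => ‖z (n - k)‖ ^ 2 := (Equiv.subLeft n).summable_iff.2 hz
  refine Summable.of_norm_bounded (h1.add hz) fun k => ?_
  rw [norm_mul, norm_mul, Complex.norm_real, Real.norm_eq_abs]
  have hl1 := lam_nonneg (L := L) (n - k)
  have hl2 := lam_nonneg (L := L) k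
  have hb : |(freq L (n - k) 1 * freq L k 0 - freq L (n - k) 0 * freq L k 1) *
      (freq L (n - k) 0 * freq L k 0 + freq L (n - k) 1 * freq L k 1) /
      (lam L (n - k) * lam L k)| ≤ 1 := by
    rw [abs_div, abs_of_nonneg (mul_nonneg hl1 hl2)]
    refine div_le_one_of_le₀ ?_ (mul_nonneg hl1 hl2)
    rw [abs_le]
    unfold lam
    generalize freq L (n - k) 0 = a
    generalize freq L (n - k) 1 = b
    generalize freq L k 0 = c
    generalize freq L k 1 = d
    constructor <;>
      nlinarith [sq_nonneg ((b * c - a * d) + (a * c + b * d)),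
        sq_nonneg ((b * c - a * d) - (a * c + b * d)), sq_nonneg (b * c - a * d),
        sq_nonneg (a * c + b * d)]
  have h3 := norm_nonneg (z (n - k))
  have h4 := norm_nonneg (z k)
  calc _ ≤ 1 * (‖z (n - k)‖ * ‖z k‖) := by gcongr
    _ ≤ _ := by nlinarith [sq_nonneg (‖z (n - k)‖ - ‖z k‖)]

/-- The transport term of the momentum equation, tested with a solenoidal mode, is the transport
term of the vorticity equation. -/
lemma fcr_momentum_flux_eq_conv (hL : ∀ i, 0 < L i) {v : Plane → Plane} (hv : MemH L v)
    (hz : Summable fun n => ‖rotc L v n‖ ^ 2) (n) :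
    (freq L n 0 : ℂ) * freq L n 0 * fcr L (fun x => v x 0 * v x 1) n
      - freq L n 0 * freq L n 1 * fcr L (fun x => v x 0 * v x 0) n
      + freq L n 1 * freq L n 0 * fcr L (fun x => v x 1 * v x 1) n
      - freq L n 1 * freq L n 1 * fcr L (fun x => v x 1 * v x 0) n = conv L (rotc L v) n := by
  have hvz := hv.hasVorticity hL
  set z := rotc L v with hzdef
  have hz0 : z 0 = 0 := rotc_zero v
  have s : ∀ i j, HasSum (fun k => fcr L (fun x => v x i) (n - k) * fcr L (fun x => v x j) k)
    (fcr L (fun x => v x i * v x j) n) := fun i j => hasSum_fcr_mul hL (hv.memLp i) (hv.memLp j) n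
  have htot := ((((s 0 1).mul_left ((freq L n 0 : ℂ) * freq L n 0)).sub
    ((s 0 0).mul_left ((freq L n 0 : ℂ) * freq L n 1))).add
    ((s 1 1).mul_left ((freq L n 1 : ℂ) * freq L n 0))).sub
    ((s 1 0).mul_left ((freq L n 1 : ℂ) * freq L n 1))
  have hdiff := htot.sub (summable_antisymm (L := L) hz n).hasSum
  rw [tsum_antisymm_eq_zero, sub_zero] at hdiff
  rw [← hdiff.tsum_eq, conv,
    ← (Equiv.subLeft n).tsum_eq fun k => (qc L k n : ℂ) * (z k * z (n - k))]
  refine tsum_congr fun k => ?_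
  simp only [Equiv.subLeft_apply, sub_sub_cancel]
  rw [(hvz (n - k)).1, (hvz (n - k)).2, (hvz k).1, (hvz k).2, qc]
  rcases eq_or_ne k 0 with rfl | hk
  · simp [hz0]
  have hlk : (lam L k : ℂ) ≠ 0 := by exact_mod_cast (lam_pos hL hk).ne'
  have hn : ∀ i, freq L n i = freq L (n - k) i + freq L k i := fun i => by
    rw [← freq_add, sub_add_cancel]
  rw [hn 0, hn 1]
  have hl : (lam L k : ℂ) = (freq L k 0 : ℂ) ^ 2 + (freq L k 1 : ℂ) ^ 2 := by
    rw [lam]; push_cast; ring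
  push_cast
  generalize (freq L (n - k) 0 : ℂ) = a
  generalize (freq L (n - k) 1 : ℂ) = b
  rcases eq_or_ne (n - k) 0 with h0 | hm
  · simp [h0, hz0]
  have hlm : (lam L (n - k) : ℂ) ≠ 0 := by exact_mod_cast (lam_pos hL hm).ne'
  generalize (lam L (n - k) : ℂ) = m at *
  generalize (freq L k 0 : ℂ) = c at *
  generalize (freq L k 1 : ℂ) = d at *
  generalize (lam L k : ℂ) = l at *
  generalize z (n - k) = p
  generalize z k = q
  have key : (b * (a + c) - a * (b + d)) / m =
      (b * (a + c) - a * (b + d)) * (c ^ 2 + d ^ 2) / (m * l) := by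
    rw [← hl]; field_simp
  rw [key]
  linear_combination ((-(a + c) ^ 2 * b * c - (a + c) * (b + d) * b * d +
    (a + c) * (b + d) * a * c + (b + d) ^ 2 * a * d) / (m * l) * (p * q)) * Complex.I_sq

/-! ### The vorticity equation of a weak solution -/

/-- Fubini for square integrable functions on the space-time cylinder. -/
lemma MemLp.cylinder_slice {T : ℝ} {F : ℝ × Plane → ℝ} (hF : MemLp F 2 (cylinder L T)) :
    (∀ᵐ t ∂(volume.restrict (Ioc 0 T)), MemLp (fun x => F (t, x)) 2 (cellMeas L)) ∧
      ∫⁻ t in Ioc 0 T, ∫⁻ x in cell L, ‖F (t, x)‖ₑ ^ 2 ≠ ⊤ := by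
  have hm : AEMeasurable (fun p => ‖F p‖ₑ ^ 2) ((volume.restrict (Ioc 0 T)).prod (cellMeas L)) :=
    hF.1.enorm.pow_const 2
  have hnorm : ∀ {α : Type} [MeasurableSpace α] (m : Measure α) (g : α → ℝ),
      eLpNorm g 2 m < ⊤ ↔ ∫⁻ a, ‖g a‖ₑ ^ 2 ∂m < ⊤ := by
    intro α _ m g
    rw [eLpNorm_lt_top_iff_lintegral_rpow_enorm_lt_top two_ne_zero ENNReal.ofNat_ne_top]
    norm_num
  have hfin : ∫⁻ p, ‖F p‖ₑ ^ 2 ∂((volume.restrict (Ioc 0 T)).prod (cellMeas L)) < ⊤ :=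
    (hnorm _ F).1 hF.2
  rw [lintegral_prod _ hm] at hfin
  refine ⟨?_, hfin.ne⟩
  have h1 : AEStronglyMeasurable F ((volume.restrict (Ioc 0 T)).prod (cellMeas L)) := hF.1
  filter_upwards [h1.prodMk_left, ae_lt_top' hm.lintegral_prod_right' hfin.ne] with t ha hb
  exact ⟨ha, (hnorm _ _).2 hb⟩

lemma Integrable.fcr_cylinder {T : ℝ} {F : ℝ × Plane → ℝ} (hF : Integrable F (cylinder L T)) (n) :
    Integrable (fun t => fcr L (fun x => F (t, x)) n) (volume.restrict (Ioc 0 T)) := by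
  have h1 : Integrable (fun p : ℝ × Plane => conj (expo L n p.2) * (F p : ℂ))
      ((volume.restrict (Ioc 0 T)).prod (cellMeas L)) := by
    refine Integrable.bdd_mul (c := 1) hF.ofReal ?_ (ae_of_all _ fun p => by simp [norm_expo])
    exact (Complex.continuous_conj.comp
      ((continuous_expo n).comp continuous_snd)).aestronglyMeasurable
  exact h1.integral_prod_left.const_mul _

lemma fcr_add {a b : Plane → ℝ} (ha : Integrable a (cellMeas L)) (hb : Integrable b (cellMeas L))
    (n) : fcr L (fun x => a x + b x) n = fcr L a n + fcr L b n := by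
  have h := fc_add (f := fun x => (a x : ℂ)) (g := fun x => (b x : ℂ)) ha.ofReal hb.ofReal n
  rw [fcr, fcr, fcr, ← h]
  simp

lemma fcr_sub {a b : Plane → ℝ} (ha : Integrable a (cellMeas L)) (hb : Integrable b (cellMeas L))
    (n) : fcr L (fun x => a x - b x) n = fcr L a n - fcr L b n := by
  have hb' : Integrable (fun x => -b x) (cellMeas L) := hb.neg
  simp only [sub_eq_add_neg]
  rw [fcr_add ha hb', fcr_neg_fun]

/-- The transport term of the momentum equation, tested with the solenoidal mode `n`. -/
def modeFlux (L : Plane) (n : Fin 2 → ℤ) (v : Plane → Plane) (x : Plane) : ℝ :=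
  freq L n 0 * freq L n 0 * (v x 0 * v x 1) - freq L n 0 * freq L n 1 * (v x 0 * v x 0) +
    freq L n 1 * freq L n 0 * (v x 1 * v x 1) - freq L n 1 * freq L n 1 * (v x 1 * v x 0)

/-- The linear terms of the momentum equation, tested with the solenoidal mode `n`. -/
def modeForce (L : Plane) (ν μ : ℝ) (n : Fin 2 → ℤ) (v F : Plane → Plane) (x : Plane) : ℝ :=
  -(ν * lam L n + μ) * (freq L n 0 * v x 1 - freq L n 1 * v x 0) +
    (freq L n 0 * F x 1 - freq L n 1 * F x 0)

lemma fcr_modeFlux (hL : ∀ i, 0 < L i) {v : Plane → Plane} (hv : MemH L v)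
    (hz : Summable fun n => ‖rotc L v n‖ ^ 2) (n) :
    fcr L (modeFlux L n v) n = conv L (rotc L v) n := by
  have m : ∀ i j, Integrable (fun x => v x i * v x j) (cellMeas L) := fun i j =>
    (hv.memLp i).integrable_mul (hv.memLp j)
  have e : modeFlux L n v = fun x =>
      freq L n 0 * freq L n 0 * (v x 0 * v x 1) - freq L n 0 * freq L n 1 * (v x 0 * v x 0) +
      freq L n 1 * freq L n 0 * (v x 1 * v x 1) - freq L n 1 * freq L n 1 * (v x 1 * v x 0) := rfl
  have m1 : Integrable (fun x => freq L n 0 * freq L n 0 * (v x 0 * v x 1) -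
      freq L n 0 * freq L n 1 * (v x 0 * v x 0)) (cellMeas L) :=
    ((m 0 1).const_mul _).sub ((m 0 0).const_mul _)
  have m2 : Integrable (fun x => freq L n 0 * freq L n 0 * (v x 0 * v x 1) -
      freq L n 0 * freq L n 1 * (v x 0 * v x 0) + freq L n 1 * freq L n 0 * (v x 1 * v x 1))
      (cellMeas L) := m1.add ((m 1 1).const_mul _)
  rw [← fcr_momentum_flux_eq_conv hL hv hz, e, fcr_sub m2 ((m 1 0).const_mul _),
    fcr_add m1 ((m 1 1).const_mul _), fcr_sub ((m 0 1).const_mul _) ((m 0 0).const_mul _),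
    fcr_const_mul, fcr_const_mul, fcr_const_mul, fcr_const_mul]
  push_cast; ring

lemma I_mul_fcr_modeForce (ν μ : ℝ) {v F : Plane → Plane} (hv : MemL2Dot L v) (hF : MemL2Dot L F)
    (n) : Complex.I * fcr L (modeForce L ν μ n v F) n =
      -((ν * lam L n + μ : ℝ) : ℂ) * rotc L v n + rotc L F n := by
  have c : ∀ {v : Plane → Plane}, MemL2Dot L v →
      Integrable (fun x => freq L n 0 * v x 1 - freq L n 1 * v x 0) (cellMeas L) := fun hv =>
    ((hv.integrable 1).const_mul _).sub ((hv.integrable 0).const_mul _)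
  have k : ∀ {v : Plane → Plane}, MemL2Dot L v →
      fcr L (fun x => freq L n 0 * v x 1 - freq L n 1 * v x 0) n =
        freq L n 0 * fcr L (fun x => v x 1) n
          - freq L n 1 * fcr L (fun x => v x 0) n := fun hv => by
    rw [fcr_sub ((hv.integrable 1).const_mul _) ((hv.integrable 0).const_mul _), fcr_const_mul,
      fcr_const_mul]
  have e : modeForce L ν μ n v F = fun x =>
    -(ν * lam L n + μ) * (freq L n 0 * v x 1 - freq L n 1 * v x 0) +
    (freq L n 0 * F x 1 - freq L n 1 * F x 0) := rfl
  rw [e, fcr_add ((c hv).const_mul _) (c hF), fcr_const_mul, k hv, k hF, rotc, rotc]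
  push_cast; ring

namespace IsWeakSolution

variable {ν μ : ℝ} {f : ℝ → Plane → Plane} {u₀ : Plane → Plane} {u : ℝ → Plane → Plane}

lemma integrable_modeFlux (hu : IsWeakSolution L ν μ f u₀ u) (n) (T : ℝ) :
    Integrable (fun p : ℝ × Plane => modeFlux L n (u p.1) p.2) (cylinder L T) := by
  have m : ∀ i j, Integrable (fun p : ℝ × Plane => u p.1 p.2 i * u p.1 p.2 j) (cylinder L T) :=
    fun i j => (hu.memLp T i).integrable_mul (hu.memLp T j)
  exact ((((m 0 1).const_mul _).sub ((m 0 0).const_mul _)).add ((m 1 1).const_mul _)).sub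
    ((m 1 0).const_mul _)

lemma integrable_modeForce (hu : IsWeakSolution L ν μ f u₀ u) (hf : IsForce L f) (n) (T : ℝ) :
    Integrable (fun p : ℝ × Plane => modeForce L ν μ n (u p.1) (f p.1) p.2) (cylinder L T) := by
  have : IsFiniteMeasure (cylinder L T) := by unfold cylinder; infer_instance
  have m : ∀ i, Integrable (fun p : ℝ × Plane => u p.1 p.2 i) (cylinder L T) :=
    fun i => (hu.memLp T i).integrable (by norm_num)
  have mf : ∀ i, Integrable (fun p : ℝ × Plane => f p.1 p.2 i) (cylinder L T) :=
    fun i => (hf.memLp T i).integrable (by norm_num)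
  exact ((((m 1).const_mul _).sub ((m 0).const_mul _)).const_mul _).add
    (((mf 1).const_mul _).sub ((mf 0).const_mul _))

/-- The weak formulation tested with a plane wave `θ (κₙ · x)` in the direction orthogonal to `κₙ`,
which is solenoidal. -/
lemma equation_wave (hu : IsWeakSolution L ν μ f u₀ u) (n) {θ θ' : ℝ → ℝ}
    (hθ : ∀ s, HasDerivAt θ (θ' s) s) (hθ' : ∀ s, HasDerivAt θ' (-θ s) s)
    (ht : IsTest L fun x => θ (phase L n x)) {t : ℝ} (h0 : 0 ≤ t) :
    ∫ x in cell L, (freq L n 0 * u t x 1 - freq L n 1 * u t x 0) * θ (phase L n x) =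
      (∫ x in cell L, (freq L n 0 * u₀ x 1 - freq L n 1 * u₀ x 0) * θ (phase L n x)) +
      ∫ s in (0 : ℝ)..t, ∫ x in cell L, (modeFlux L n (u s) x * θ' (phase L n x) +
        modeForce L ν μ n (u s) (f s) x * θ (phase L n x)) := by
  set c : Plane := ![-freq L n 1, freq L n 0] with hc
  have c0 : c 0 = -freq L n 1 := rfl
  have c1 : c 1 = freq L n 0 := rfl
  set v : Plane → Plane := fun x j => c j * θ (phase L n x) with hv
  have hpd : ∀ i j, pd i (fun y => v y j) = fun x => freq L n i * (c j * θ' (phase L n x)) :=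
    fun i j => funext fun x => pd_comp_phase n i (fun s => (hθ s).const_mul (c j)) x
  have hpd2 : ∀ i j, pd i (pd i (fun y => v y j)) = fun x =>
      freq L n i * (freq L n i * (c j * -θ (phase L n x))) := fun i j => by
    rw [hpd]
    exact funext fun x => pd_comp_phase (φ := fun s => freq L n i * (c j * θ' s)) n i
      (fun s => ((hθ' s).const_mul (c j)).const_mul (freq L n i)) x
  have htest : IsSolenoidalTest L v := by
    refine ⟨fun j => ⟨contDiff_const.mul ht.smooth, fun i x => ?_⟩, fun x => ?_⟩
    · exact congrArg (c j * ·) (ht.periodic i x)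
    · simp only [hpd, Fin.sum_univ_two, c0, c1]; ring
  have h := hu.equation v htest t h0
  simp only [hpd2] at h
  simp only [hpd, Fin.sum_univ_two] at h
  simp only [hv, c0, c1] at h
  convert h using 1
  · congr 1; ext x; ring
  · congr 1
    · congr 1; ext x; ring
    · refine intervalIntegral.integral_congr fun s _ => ?_
      refine integral_congr_ae (ae_of_all _ fun x => ?_)
      simp only [modeFlux, modeForce, lam]; ring

/-- The vorticity coefficients in terms of integrals against the two real plane waves of the weak
formulation. -/
lemma rotc_eq_integral {v : Plane → Plane} (hv : MemL2Dot L v) (n) :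
    rotc L v n = ((L 0 * L 1)⁻¹ : ℝ) * (Complex.I *
      ((∫ x in cell L, (freq L n 0 * v x 1 - freq L n 1 * v x 0) *
          Real.cos (phase L n x) : ℝ) : ℂ) +
      ((∫ x in cell L, (freq L n 0 * v x 1 - freq L n 1 * v x 0) * Real.sin (phase L n x) : ℝ) :
        ℂ)) := by
  have hi : Integrable (fun x => freq L n 0 * v x 1 - freq L n 1 * v x 0) (cellMeas L) :=
    ((hv.integrable 1).const_mul _).sub ((hv.integrable 0).const_mul _)
  have h1 := fcr_eq hi n
  rw [fcr_sub ((hv.integrable 1).const_mul _) ((hv.integrable 0).const_mul _), fcr_const_mul,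
    fcr_const_mul] at h1
  rw [rotc]
  set X := ((∫ x in cell L, (freq L n 0 * v x 1 - freq L n 1 * v x 0) *
    Real.cos (phase L n x) : ℝ) : ℂ)
  set Y := ((∫ x in cell L, (freq L n 0 * v x 1 - freq L n 1 * v x 0) *
    Real.sin (phase L n x) : ℝ) : ℂ)
  linear_combination Complex.I * h1 - (((L 0 * L 1)⁻¹ : ℝ) : ℂ) * Y * Complex.I_sq

lemma integrable_wave {T : ℝ} {P R : ℝ → Plane → ℝ}
    (hP : Integrable (fun p : ℝ × Plane => P p.1 p.2) (cylinder L T))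
    (hR : Integrable (fun p : ℝ × Plane => R p.1 p.2) (cylinder L T)) (n) {θ θ' : ℝ → ℝ}
    (hθ : Continuous θ) (hθ' : Continuous θ') (h1 : ∀ s, |θ s| ≤ 1) (h1' : ∀ s, |θ' s| ≤ 1) :
    Integrable (fun s => ∫ x in cell L, (P s x * θ' (phase L n x) + R s x * θ (phase L n x)))
      (volume.restrict (Ioc 0 T)) := by
  have hc : Continuous fun p : ℝ × Plane => phase L n p.2 :=
    (contDiff_phase (k := 0) n).continuous.comp continuous_snd
  have h : Integrable (fun p : ℝ × Plane => P p.1 p.2 * θ' (phase L n p.2) +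
      R p.1 p.2 * θ (phase L n p.2)) ((volume.restrict (Ioc 0 T)).prod (cellMeas L)) :=
    Integrable.add
      (hP.mul_bdd (c := 1) (hθ'.comp hc).aestronglyMeasurable (ae_of_all _ fun p => h1' _))
      (hR.mul_bdd (c := 1) (hθ.comp hc).aestronglyMeasurable (ae_of_all _ fun p => h1 _))
  exact h.integral_prod_left

/-- The vorticity equation in a single mode. -/
lemma rotc_eq (hL : ∀ i, 0 < L i) (hu : IsWeakSolution L ν μ f u₀ u) (hf : IsForce L f)
    (n) {t : ℝ} (h0 : 0 ≤ t) :
    rotc L (u t) n = rotc L u₀ n + ∫ s in (0 : ℝ)..t,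
      (fcr L (modeFlux L n (u s)) n + Complex.I * fcr L (modeForce L ν μ n (u s) (f s)) n) := by
  have hP := hu.integrable_modeFlux n t
  have hR := hu.integrable_modeForce hf n t
  have hcos := hu.equation_wave n Real.hasDerivAt_cos (θ' := fun s => -Real.sin s)
    (fun s => (Real.hasDerivAt_sin s).neg) (isTest_cos hL n) h0
  have hsin := hu.equation_wave n Real.hasDerivAt_sin (θ' := Real.cos)
    (fun s => Real.hasDerivAt_cos s) (isTest_sin hL n) h0
  have ic := integrable_wave (P := fun s => modeFlux L n (u s))
    (R := fun s => modeForce L ν μ n (u s) (f s)) hP hR n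
      (θ := Real.cos) (θ' := fun s => -Real.sin s)
    Real.continuous_cos Real.continuous_sin.neg Real.abs_cos_le_one
    (fun s => by rw [abs_neg]; exact Real.abs_sin_le_one s)
  have is := integrable_wave (P := fun s => modeFlux L n (u s))
    (R := fun s => modeForce L ν μ n (u s) (f s)) hP hR n (θ := Real.sin) (θ' := Real.cos)
    Real.continuous_sin Real.continuous_cos Real.abs_sin_le_one Real.abs_cos_le_one
  rw [rotc_eq_integral (hu.memH t h0).toMemL2Dot, rotc_eq_integral hu.init_memH.toMemL2Dot, hcos,
    hsin, intervalIntegral.integral_of_le h0, intervalIntegral.integral_of_le h0,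
    intervalIntegral.integral_of_le h0]
  have key : ∀ᵐ s ∂(volume.restrict (Ioc 0 t)),
      fcr L (modeFlux L n (u s)) n + Complex.I * fcr L (modeForce L ν μ n (u s) (f s)) n =
      ((L 0 * L 1)⁻¹ : ℝ) * (Complex.I *
        ((∫ x in cell L, (modeFlux L n (u s) x * -Real.sin (phase L n x) +
          modeForce L ν μ n (u s) (f s) x * Real.cos (phase L n x)) : ℝ) : ℂ) +
        ((∫ x in cell L, (modeFlux L n (u s) x * Real.cos (phase L n x) +
          modeForce L ν μ n (u s) (f s) x * Real.sin (phase L n x)) : ℝ) : ℂ)) := by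
    have hP' : Integrable (fun p : ℝ × Plane => modeFlux L n (u p.1) p.2)
      ((volume.restrict (Ioc 0 t)).prod (cellMeas L)) := hP
    have hR' : Integrable (fun p : ℝ × Plane => modeForce L ν μ n (u p.1) (f p.1) p.2)
      ((volume.restrict (Ioc 0 t)).prod (cellMeas L)) := hR
    filter_upwards [hP'.prod_right_ae, hR'.prod_right_ae] with s hs hs'
    simp only [mul_neg]
    have hn : Integrable (fun x => -(modeFlux L n (u s) x * Real.sin (phase L n x))) (cellMeas L) :=
      (integrable_mul_sin hs n).neg
    rw [fcr_eq hs, fcr_eq hs', integral_add hn (integrable_mul_cos hs' n),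
      integral_add (integrable_mul_cos hs n) (integrable_mul_sin hs' n), integral_neg]
    push_cast
    linear_combination (-((L 0 : ℂ) * L 1)⁻¹ *
      ((∫ x in cell L, modeForce L ν μ n (u s) (f s) x * Real.sin (phase L n x) : ℝ) : ℂ)) *
        Complex.I_sq
  rw [integral_congr_ae key, integral_const_mul, integral_add (ic.ofReal.const_mul _) is.ofReal,
    integral_const_mul, integral_complex_ofReal, integral_complex_ofReal]
  push_cast
  ring

end IsWeakSolution

lemma volume_cell (hL : ∀ i, 0 < L i) : volume (cell L) = ENNReal.ofReal (L 0 * L 1) := by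
  rw [cell, Real.volume_Icc_pi, Fin.prod_univ_two, ENNReal.ofReal_mul (hL 0).le]
  simp

/-- By Parseval's identity a bound for a function bounds its coefficients in `ℓ²`. -/
lemma tsum_fcr_sq_le (hL : ∀ i, 0 < L i) {w : Plane → ℝ} (hw : MemLp w 2 (cellMeas L)) {A : ℝ}
    (hA : ∀ᵐ x ∂cellMeas L, |w x| ≤ A) :
    ∑' n, ENNReal.ofReal (‖fcr L w n‖ ^ 2) ≤ ENNReal.ofReal (A ^ 2) := by
  have h0 := hL 0
  have h1 := hL 1
  simp only [← enorm_sq_eq_ofReal]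
  rw [tsum_enorm_fcr_sq hL hw]
  have h2 : ∫⁻ x in cell L, ‖w x‖ₑ ^ 2 ≤ ∫⁻ _ in cell L, ENNReal.ofReal (A ^ 2) := by
    refine lintegral_mono_ae ?_
    filter_upwards [hA] with x hx
    rw [← ofReal_norm, ← ENNReal.ofReal_pow (norm_nonneg _)]
    exact ENNReal.ofReal_le_ofReal (pow_le_pow_left₀ (norm_nonneg _) hx 2)
  rw [lintegral_const, Measure.restrict_apply_univ, volume_cell hL] at h2
  refine (mul_le_mul_right h2 _).trans_eq ?_
  rw [mul_left_comm, ← ENNReal.ofReal_mul (by positivity), inv_mul_cancel₀ (by positivity),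
    ENNReal.ofReal_one, mul_one]

lemma IsWeakPartial.fcr_eq (hL : ∀ i, 0 < L i) {i : Fin 2} {g w : Plane → ℝ}
    (hg : Integrable g (cellMeas L)) (hw : IsWeakPartial L i g w) (n) :
    fcr L w n = Complex.I * freq L n i * fcr L g n := by
  have hz : fcr L (0 : Plane → ℝ) n = 0 := by simp [fcr, fc]
  fin_cases i
  · have := fcr_of_weak hL hg (integrable_zero _ _ _) hw.1 (fun η hη => by
      simpa using hw.2 η hη) n
    simpa [hz] using this
  · have := fcr_of_weak hL (integrable_zero _ _ _) hg hw.1 (fun η hη => by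
      simpa using hw.2 η hη) n
    simpa [hz] using this

/-- The family of vorticity coefficients of a weak solution, extended to negative times by its
initial value. -/
def solModes (L : Plane) (u : ℝ → Plane → Plane) (t : ℝ) (n : Fin 2 → ℤ) : ℂ :=
  rotc L (u (max t 0)) n

lemma solModes_of_nonneg (u : ℝ → Plane → Plane) {t : ℝ} (ht : 0 ≤ t) :
    solModes L u t = rotc L (u t) := by
  funext n; rw [solModes, max_eq_left ht]

namespace IsWeakSolution

variable {ν μ : ℝ} {f : ℝ → Plane → Plane} {u₀ : Plane → Plane} {u : ℝ → Plane → Plane}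

/-- A weak solution has square integrable gradient in space-time, so that the enstrophy is
integrable in time. -/
lemma lintegral_tsum_rotc_ne_top (hL : ∀ i, 0 < L i) (hu : IsWeakSolution L ν μ f u₀ u) (T : ℝ) :
    ∫⁻ t in Ioc 0 T, ∑' n, ENNReal.ofReal (‖rotc L (u t) n‖ ^ 2) ≠ ⊤ := by
  obtain ⟨D, hD, hw⟩ := hu.gradient
  have c01 := MemLp.cylinder_slice (hD 0 1 T)
  have c10 := MemLp.cylinder_slice (hD 1 0 T)
  have hm : AEMeasurable (fun t => ∫⁻ x in cell L, ‖D 0 1 t x‖ₑ ^ 2)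
      (volume.restrict (Ioc 0 T)) := by
    have h1 : AEMeasurable (fun p : ℝ × Plane => ‖D 0 1 p.1 p.2‖ₑ ^ 2)
      ((volume.restrict (Ioc 0 T)).prod (cellMeas L)) := (hD 0 1 T).1.enorm.pow_const 2
    exact h1.lintegral_prod_right'
  have hle : ∀ᵐ t ∂(volume.restrict (Ioc 0 T)), ∑' n, ENNReal.ofReal (‖rotc L (u t) n‖ ^ 2) ≤
      3 * (ENNReal.ofReal (L 0 * L 1)⁻¹ * (∫⁻ x in cell L, ‖D 0 1 t x‖ₑ ^ 2) +
        ENNReal.ofReal (L 0 * L 1)⁻¹ * ∫⁻ x in cell L, ‖D 1 0 t x‖ₑ ^ 2) := by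
    have hw' := ae_mono (Measure.restrict_mono (μ := volume)
      (Ioc_subset_Ioi_self : Ioc (0 : ℝ) T ⊆ Ioi 0) le_rfl) hw
    filter_upwards [c01.1, c10.1, hw', ae_restrict_mem measurableSet_Ioc] with t h01 h10 hwt ht
    have hH := (hu.memH t ht.1.le).toMemL2Dot
    rw [← tsum_enorm_fcr_sq hL h01, ← tsum_enorm_fcr_sq hL h10, ← ENNReal.tsum_add,
      ← ENNReal.tsum_mul_left]
    refine ENNReal.tsum_le_tsum fun n => ?_
    rw [← enorm_sq_eq_ofReal, rotc, ← (hwt 0 1).fcr_eq hL (hH.integrable 1),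
      ← (hwt 1 0).fcr_eq hL (hH.integrable 0), sub_eq_add_neg]
    have := add_add_sq_le ‖fcr L (D 0 1 t) n‖ₑ ‖fcr L (D 1 0 t) n‖ₑ 0
    rw [zero_pow two_ne_zero, add_zero, add_zero] at this
    refine le_trans (pow_le_pow_left' ((enorm_add_le _ _).trans_eq ?_) 2) this
    rw [enorm_neg]
  refine ne_top_of_le_ne_top ?_ (lintegral_mono_ae hle)
  rw [lintegral_const_mul' _ _ (by finiteness), lintegral_add_left' (hm.const_mul _),
    lintegral_const_mul' _ _ (by finiteness), lintegral_const_mul' _ _ (by finiteness)]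
  exact ENNReal.mul_ne_top (by finiteness) (ENNReal.add_ne_top.2
    ⟨ENNReal.mul_ne_top (by finiteness) c01.2, ENNReal.mul_ne_top (by finiteness) c10.2⟩)

lemma ae_summable_rotc (hL : ∀ i, 0 < L i) (hu : IsWeakSolution L ν μ f u₀ u) {T : ℝ}
    (hm : ∀ n, AEMeasurable (fun t => rotc L (u t) n) (volume.restrict (Ioc 0 T))) :
    ∀ᵐ t ∂(volume.restrict (Ioc 0 T)), Summable fun n => ‖rotc L (u t) n‖ ^ 2 := by
  have h1 : AEMeasurable (fun t => ∑' n, ENNReal.ofReal (‖rotc L (u t) n‖ ^ 2))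
      (volume.restrict (Ioc 0 T)) :=
    AEMeasurable.tsum fun n => ((hm n).norm.pow_const 2).ennreal_ofReal
  filter_upwards [ae_lt_top' h1 (hu.lintegral_tsum_rotc_ne_top hL T)] with t ht
  have h2 := ENNReal.summable_toReal ht.ne
  simpa [ENNReal.toReal_ofReal] using h2

/-- The vorticity coefficients of a weak solution solve the vorticity equation. -/
theorem vorticityModes (hL : ∀ i, 0 < L i) (hf : IsForce L f) (hu : IsWeakSolution L ν μ f u₀ u)
    {T₀ A : ℝ} (hT₀ : 0 ≤ T₀)
    (hA : ∀ᵐ t : ℝ, T₀ ≤ t → ∃ w : Plane → ℝ, MemLp w 2 (cellMeas L) ∧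
      (∀ n, fcr L w n = rotc L (f t) n) ∧ ∀ᵐ x ∂cellMeas L, |w x| ≤ A) :
    VorticityModes L ν μ T₀ A (solModes L u) fun t => rotc L (f t) := by
  set H : ℝ → (Fin 2 → ℤ) → ℂ := fun s n =>
    fcr L (modeFlux L n (u s)) n + Complex.I * fcr L (modeForce L ν μ n (u s) (f s)) n
  have hHi : ∀ n T, 0 ≤ T → IntervalIntegrable (fun s => H s n) volume 0 T := fun n T hT => by
    rw [intervalIntegrable_iff_integrableOn_Ioc_of_le hT]
    exact (Integrable.fcr_cylinder (hu.integrable_modeFlux n T) n).add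
      ((Integrable.fcr_cylinder (hu.integrable_modeForce hf n T) n).const_mul _)
  have hcont : ∀ n, Continuous fun t => solModes L u t n := by
    intro n
    have e : (fun t => solModes L u t n) =
        fun t => rotc L u₀ n + ∫ s in (0 : ℝ)..max t 0, H s n := by
      ext t
      exact hu.rotc_eq hL hf n (le_max_right t 0)
    rw [e, continuous_iff_continuousAt]
    intro t
    have hT : 0 ≤ |t| + 1 := by positivity
    have hc : ContinuousOn (fun r => ∫ s in (0 : ℝ)..r, H s n) (Icc 0 (|t| + 1)) := by
      have := intervalIntegral.continuousOn_primitive_interval' (hHi n _ hT) left_mem_uIcc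
      rwa [uIcc_of_le hT] at this
    have hmaps : MapsTo (fun r : ℝ => max r 0) (Iio (|t| + 1)) (Icc 0 (|t| + 1)) := fun r hr =>
      ⟨le_max_right _ _, max_le hr.le hT⟩
    refine ContinuousAt.add continuousAt_const ?_
    exact ((hc.comp (by fun_prop) hmaps).continuousAt
      (Iio_mem_nhds (by linarith [le_abs_self t])))
  have hfin : ∀ T, ∫⁻ t in Ioc 0 T, ∑' n, ENNReal.ofReal (‖solModes L u t n‖ ^ 2) ≠ ⊤ := by
    intro T
    rw [setLIntegral_congr_fun measurableSet_Ioc fun t ht => by rw [solModes_of_nonneg u ht.1.le]]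
    exact hu.lintegral_tsum_rotc_ne_top hL T
  have hforce : ∀ n T, IntegrableOn (fun t => rotc L (f t) n) (Ioc 0 T) := fun n T => by
    have : IsFiniteMeasure (cylinder L T) := by unfold cylinder; infer_instance
    have hi : ∀ i, Integrable (fun t => fcr L (fun x => f t x i) n) (volume.restrict (Ioc 0 T)) :=
      fun i => Integrable.fcr_cylinder ((hf.memLp T i).integrable (by norm_num)) n
    exact ((hi 1).const_mul _).sub ((hi 0).const_mul _)
  -- The transport terms agree only at times with square summable vorticity: elsewhere the series
  -- defining `conv` need not converge, and `conv` is a junk value. Almost every time is good.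
  have hrhs : ∀ n T, ∀ᵐ s ∂(volume.restrict (Ioc 0 T)),
      H s n = modeRhs L ν μ (solModes L u s) (rotc L (f s)) n := by
    intro n T
    have hm : ∀ n, AEMeasurable (fun t => rotc L (u t) n) (volume.restrict (Ioc 0 T)) := fun n =>
      (hcont n).measurable.aemeasurable.congr ((ae_restrict_iff' measurableSet_Ioc).2
        (ae_of_all _ fun t ht => congrFun (solModes_of_nonneg u ht.1.le) n))
    have hf' := ae_mono (Measure.restrict_mono (μ := volume)
      (Ioc_subset_Ioi_self : Ioc (0 : ℝ) T ⊆ Ioi 0) le_rfl) hf.memL2Dot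
    filter_upwards [hu.ae_summable_rotc hL hm, hf', ae_restrict_mem measurableSet_Ioc]
      with s hs hfs hsm
    have hH := hu.memH s hsm.1.le
    simp only [H]
    rw [fcr_modeFlux hL hH hs, I_mul_fcr_modeForce ν μ hH.toMemL2Dot hfs,
      solModes_of_nonneg u hsm.1.le, modeRhs]
    ring
  refine
    { nonneg := hT₀
      cont := hcont
      zero := fun t => rotc_zero _
      neg := fun t n => rotc_neg (hu.memH _ (le_max_right t 0)).toMemL2Dot n
      force_int := fun n T hT => (intervalIntegrable_iff_integrableOn_Ioc_of_le hT).2 (hforce n T)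
      rhs_int := fun n T hT => ?_
      eq := fun n t ht => ?_
      energy := fun T => ?_
      enst_fin := hfin
      force := ?_ }
  · rw [intervalIntegrable_iff_integrableOn_Ioc_of_le hT]
    exact ((intervalIntegrable_iff_integrableOn_Ioc_of_le hT).1 (hHi n T hT)).congr (hrhs n T)
  · have h1 := hu.rotc_eq hL hf n ht
    have h2 := hu.rotc_eq hL hf n le_rfl
    rw [intervalIntegral.integral_same, add_zero] at h2
    rw [solModes_of_nonneg u ht, solModes_of_nonneg u le_rfl, h1, h2]
    congr 1
    rw [intervalIntegral.integral_of_le ht, intervalIntegral.integral_of_le ht]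
    exact integral_congr_ae (hrhs n t)
  · obtain ⟨C, hC⟩ := hu.bounded T
    refine ⟨max ((L 0 * L 1)⁻¹ * (C + C)) 0, le_max_right _ _, fun t ht => ?_⟩
    rw [solModes_of_nonneg u ht.1]
    exact ((hu.memH t ht.1).tsum_div_lam_le hL (hC t ht)).trans
      (ENNReal.ofReal_le_ofReal (le_max_left _ _))
  · filter_upwards [hA] with t ht h0
    obtain ⟨w, hw, hwf, hwA⟩ := ht h0
    simp only [← hwf]
    exact tsum_fcr_sq_le hL hw hwA

end IsWeakSolution

/-! ### The asymptotic bound -/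

/-- Every square summable family with the symmetry of a real function consists of the Fourier
coefficients of a real function. -/
lemma exists_fcr_eq (hL : ∀ i, 0 < L i) {c : (Fin 2 → ℤ) → ℂ} (hc : Summable fun n => ‖c n‖ ^ 2)
    (hneg : ∀ n, c (-n) = conj (c n)) :
    ∃ w : Plane → ℝ, MemLp w 2 (cellMeas L) ∧ ∀ n, fcr L w n = c n := by
  obtain ⟨h, hh, hfc⟩ := exists_fc_eq hL hc
  refine ⟨fun x => (h x).re, hh.re, fun n => ?_⟩
  have hi : Integrable h (cellMeas L) := hh.integrable (by norm_num)
  have hconj : Integrable (fun x => conj (h x)) (cellMeas L) :=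
    (Complex.conjLIE : ℂ ≃ₗᵢ[ℝ] ℂ).toContinuousLinearEquiv.toContinuousLinearMap.integrable_comp hi
  have h1 : fc L (fun x => conj (h x)) n = conj (fc L h (-n)) := by
    simp only [fc]
    rw [map_mul, Complex.conj_ofReal, ← integral_conj]
    congr 2
    ext x
    rw [map_mul, Complex.conj_conj, conj_expo]
  have e : (fun x => (((h x).re : ℝ) : ℂ)) = fun x => (1 / 2 : ℂ) * (h x + conj (h x)) := by
    ext x
    rw [Complex.add_conj]; push_cast; ring
  rw [fcr, e, fc_const_mul, fc_add hi hconj, h1, hfc, hfc, hneg, Complex.conj_conj]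
  ring

/-- From some time on, almost every force has a rotation bounded by any number above the upper
limit. -/
lemma exists_force_bound (hL : ∀ i, 0 < L i) {f : ℝ → Plane → Plane} (hf : IsForce L f) {F : ℝ≥0}
    (hF : limsup (fun t => rotSup L (f t)) (atTop ⊓ ae (volume : Measure ℝ)) = (F : ℝ≥0∞))
    {A : ℝ} (hA : (F : ℝ) < A) :
    ∃ T₀, 0 ≤ T₀ ∧ ∀ᵐ t : ℝ, T₀ ≤ t → ∃ w : Plane → ℝ, MemLp w 2 (cellMeas L) ∧
      (∀ n, fcr L w n = rotc L (f t) n) ∧ ∀ᵐ x ∂cellMeas L, |w x| ≤ A := by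
  have hA0 : 0 ≤ A := F.2.trans hA.le
  have hlt : limsup (fun t => rotSup L (f t)) (atTop ⊓ ae (volume : Measure ℝ)) <
      ENNReal.ofReal A := by
    rw [hF, ← ENNReal.ofReal_coe_nnreal]
    exact (ENNReal.ofReal_lt_ofReal_iff_of_nonneg F.2).2 hA
  have hev := eventually_lt_of_limsup_lt hlt
  rw [Filter.Eventually, Filter.mem_inf_iff] at hev
  obtain ⟨s, hs, N, hN, hsN⟩ := hev
  obtain ⟨T, hT⟩ := Filter.mem_atTop_sets.1 hs
  refine ⟨max T 1, by positivity, ?_⟩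
  have hf' := (ae_restrict_iff' measurableSet_Ioi).1 hf.memL2Dot
  filter_upwards [hN, hf'] with t htN hft ht
  have hH := hft (lt_of_lt_of_le one_pos ((le_max_right T 1).trans ht))
  have hmem : t ∈ {t | rotSup L (f t) < ENNReal.ofReal A} := by
    rw [hsN]; exact ⟨hT t ((le_max_left T 1).trans ht), htN⟩
  simp only [mem_ofPred_eq, rotSup, iInf_lt_iff] at hmem
  obtain ⟨w, hw, hwA⟩ := hmem
  have hb : ∀ᵐ x ∂cellMeas L, |w x| ≤ A := by
    have h1 : ∀ᵐ x ∂cellMeas L, ‖w x‖ₑ ≤ eLpNorm w (⊤ : ℝ≥0∞) (cellMeas L) := by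
      rw [eLpNorm_exponent_top]; exact ae_le_eLpNormEssSup
    filter_upwards [h1] with x hx
    have := hx.trans hwA.le
    rwa [← ofReal_norm, ENNReal.ofReal_le_ofReal_iff hA0] at this
  exact ⟨w, MemLp.of_bound hw.1.aestronglyMeasurable A hb, fun n => hw.fcr_eq hL hH n, hb⟩

/-- The bound for the vorticity of a weak solution, for every level above the asymptotic one. -/
lemma limsup_rotSup_le (hL : ∀ i, 0 < L i) {ν μ : ℝ} (hν : 0 < ν) (hμ : 0 < μ)
    {f : ℝ → Plane → Plane} (hf : IsForce L f) {F : ℝ≥0}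
    (hF : limsup (fun t => rotSup L (f t)) (atTop ⊓ ae (volume : Measure ℝ)) = (F : ℝ≥0∞))
    {u₀ : Plane → Plane} {u : ℝ → Plane → Plane} (hu : IsWeakSolution L ν μ f u₀ u) {ε : ℝ}
    (hε : 0 < ε) :
    limsup (fun t => rotSup L (u t)) atTop ≤ ENNReal.ofReal (((F : ℝ) + ε + ε) / μ) := by
  -- The first `ε` lifts the bound for the force above the upper limit, the second one is the margin
  -- of the maximum principle.
  obtain ⟨T₀, hT₀, hA⟩ := exists_force_bound hL hf hF (A := F + ε) (by linarith)
  have h := hu.vorticityModes hL hf hT₀ hA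
  obtain ⟨t₂, h₂, hsum, hreg⟩ := h.exists_regular_time hL hν hμ
  have h0 : 0 ≤ t₂ := hT₀.trans h₂
  set M := ((F : ℝ) + ε + ε) / μ with hM
  have hMμ : μ * M = F + ε + ε := by rw [hM]; field_simp
  set C := ∑' n, ‖solModes L u t₂ n‖
  have hbound : ∀ t, t₂ ≤ t →
      rotSup L (u t) ≤ ENNReal.ofReal (M + C * Real.exp (-μ * (t - t₂))) := by
    intro t ht
    obtain ⟨K, hK, hP, hE⟩ := hreg t ht
    have ht0 := h0.trans ht
    have hsq : Summable fun n => ‖solModes L u t n‖ ^ 2 := by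
      have h1 := ENNReal.summable_toReal
        (ne_top_of_le_ne_top hK (hP t (right_mem_Icc.2 ht)).1)
      simpa [ENNReal.toReal_ofReal] using h1
    obtain ⟨W, hW, hWz⟩ := exists_fcr_eq hL hsq (h.neg t)
    have hrot : IsWeakRot L (u t) W := isWeakRot_of_fcr hL (hu.memH t ht0).toMemL2Dot hW
      fun n => by rw [hWz, solModes_of_nonneg u ht0]
    have hmain := fun (σ : ℝ) (hσ : |σ| = 1) => h.vorticity_le hL hν hμ h₂ ht hsum hK
      (fun s hs => (hP s hs).2) hE (v := u) (ae_of_all _ fun s hs => by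
        have hs0 := h0.trans hs.le
        rw [solModes_of_nonneg u hs0]
        exact ⟨hu.memH s hs0, (hu.memH s hs0).hasVorticity hL⟩)
      (by positivity) (hA.mono fun s hs hs2 => hs (h₂.trans hs2.le)) hε hMμ hσ hW hWz
    refine (iInf₂_le W hrot).trans ?_
    rw [eLpNorm_exponent_top]
    refine eLpNormEssSup_le_of_ae_enorm_bound ?_
    filter_upwards [hmain 1 (by simp), hmain (-1) (by simp)] with x h1 h2
    rw [← ofReal_norm, Real.norm_eq_abs]
    refine ENNReal.ofReal_le_ofReal (abs_le'.2 ⟨?_, ?_⟩) <;> linarith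
  have hlim : Tendsto (fun t => ENNReal.ofReal (M + C * Real.exp (-μ * (t - t₂)))) atTop
      (𝓝 (ENNReal.ofReal (M + C * 0))) := by
    refine (ENNReal.continuous_ofReal.tendsto _).comp (tendsto_const_nhds.add
      (tendsto_const_nhds.mul (Real.tendsto_exp_atBot.comp ?_)))
    exact Tendsto.const_mul_atTop_of_neg (by linarith)
      (tendsto_atTop_add_const_right atTop (-t₂) tendsto_id)
  rw [mul_zero, add_zero] at hlim
  rw [← hlim.limsup_eq]
  exact limsup_le_limsup (eventually_atTop.2 ⟨t₂, hbound⟩)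

end PeriodicNS

end

open PeriodicNS in
theorem mainTheorem8 (L : Plane) (hL : ∀ i, 0 < L i) (ν μ : ℝ) (hν : 0 < ν) (hμ : 0 < μ)
    (f : ℝ → Plane → Plane) (hf : IsForce L f) (F : ℝ≥0)
    (hF : limsup (fun t => rotSup L (f t)) (atTop ⊓ ae (volume : Measure ℝ)) = (F : ℝ≥0∞))
    (u₀ : Plane → Plane) (u : ℝ → Plane → Plane) (hu : IsWeakSolution L ν μ f u₀ u) :
    limsup (fun t => rotSup L (u t)) atTop ≤ ENNReal.ofReal ((F : ℝ) / μ) := by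
  have hlim : Tendsto (fun ε : ℝ => ENNReal.ofReal (((F : ℝ) + ε + ε) / μ)) (𝓝[>] 0)
      (𝓝 (ENNReal.ofReal (((F : ℝ) + 0 + 0) / μ))) := by
    refine Tendsto.mono_left (Continuous.tendsto ?_ 0) nhdsWithin_le_nhds
    exact ENNReal.continuous_ofReal.comp (by fun_prop)
  rw [add_zero, add_zero] at hlim
  exact ge_of_tendsto hlim (eventually_mem_nhdsWithin.mono fun ε hε =>
    limsup_rotSup_le hL hν hμ hf hF hu hε)
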